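/- Let $n\in\{2,3\}$, let $\Omega\subset\mathbb R^n$ be a bounded domain with Lipschitz continuous boundary $S$, let $S_1\subset S$ be non-empty and relatively open, and let $X=\{u\in H^1(\Omega)^n:\ u|_{S_1}=0\}$. Put $\varepsilon_{ij}(u)=\frac12\big(\frac{\partial u_i}{\partial x_j}+\frac{\partial u_j}{\partial x_i}\big)$, $I(u)=\sum_{i,j}\varepsilon_{ij}(u)^2$, $\|u\|_X=\big(\int_\Omega I(u)\,dx\big)^{1/2}$ and $Bu=\operatorname{div}u$, so that $B\in\mathcal L(X,L_2(\Omega))$; repeated indices are summed, $\mathbb R_+=[0,\infty)$, and $(\cdot,\cdot)$ also denotes the duality between $X^*$ and $X$. Let $\tilde u\in H^1(\Omega)^n$ with $\tilde u|_{S_1}=\hat u$ and $\operatorname{div}\tilde u=0$, let $E:\Omega\to\mathbb R^n$ be measurable, let $\lambda,r>0$, and let $a_1,\dots,a_5>0$ be constants such that: (C0) for a.e. $x\in\Omega$ the function $\psi_1(\cdot,\cdot,x)$ is continuous on $\mathbb R_+^2$, and for every $(y_1,y_2)\in\mathbb R_+^2$ the function $\psi_1(y_1,y_2,\cdot)$ is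 measurable on $\Omega$; (C1a) for a.e. $x\in\Omega$ and all $y_2\in\mathbb R_+$ the function $\psi_1(\cdot,y_2,x)$ is continuously differentiable on $\mathbb R_+$ and, for all $y_1\in\mathbb R_+$, $a_1\le\psi_1(y_1,y_2,x)\le a_2$, $\psi_1(y_1,y_2,x)+2\frac{\partial\psi_1}{\partial y_1}(y_1,y_2,x)\,y_1\ge a_3$ and $\big|\frac{\partial\psi_1}{\partial y_1}(y_1,y_2,x)\big|\,y_1\le a_4$; (C4a) for a.e. $x\in\Omega$ the function $e(\cdot,x)$ is continuous on $\mathbb R_+$ with $0\le e(y,x)\le a_5$ for all $y\in\mathbb R_+$, and $e(y,\cdot)$ is measurable on $\Omega$ for every $y\in\mathbb R_+$. Define $L_3:X\to X^*$ by $$(L_3(u),h)=2\int_\Omega\big[e(|E|,x)(\lambda+I(\tilde u+u))^{-1/2}+\psi_1(I(\tilde u+u),|E|,x)\big]\varepsilon_{ij}(\tilde u+u)\,\varepsilon_{ij}(h)\,dx .$$ Let $f\in X^*$, and let $A\in\mathcal L(X,X^*)$ and $b_1,b_2>0$ satisfy $(Au,h)=(Ah,u)$, $|(Au,h)|\le b_1\|u\|_X\|h\|_X$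 and $(Au,u)\ge b_2\|u\|_X^2$ for all $u,h\in X$. Let $\|u\|_1=(Au,u)^{1/2}$, and let $X_1$ be $X$ with the norm $\|\cdot\|_1$. Put $$q_1=\min(2a_1,2a_3)\,b_1^{-1},\quad q_2=(2a_2+4a_4+4a_5\lambda^{-1/2})\,b_2^{-1},\quad q_3=q_2+r\|B^*B\|_{\mathcal L(X_1,X_1^*)},$$ $$k(t)=(1-2q_1t+q_3^2t^2)^{1/2}.$$ Then $1-2q_1t+q_3^2t^2\ge0$ for all real $t$, and the problem $$u\in X,\qquad (L_3(u),h)+r(Bu,Bh)=(f,h)\quad\forall h\in X$$ has a unique solution $u$. For every $t\in(0,2q_1q_3^{-2})$ one has $k(t)<1$, and for every $u_m\in X$ there is a unique $u_{m+1}\in X$ with $$(Au_{m+1},h)=(Au_m,h)-t\big[(L_3(u_m),h)+r(Bu_m,Bh)-(f,h)\big]\quad\forall h\in X.$$ The map $u_m\mapsto u_{m+1}$ is a contraction of $X_1$ with factor $k(t)$. For every $u_0\in X$ the sequence $(u_m)$ so generated converges to $u$ in $X_1$, and for all $m\ge0$ $$\|u_m-u\|_1\le\frac{k(t)^m}{1-k(t)}\;t\,\|L_3(u_0)+rB^*Bu_0-f\|_{X_1^*}.$$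 Moreover $t_0=q_1q_3^{-2}$ lies in $(0,2q_1q_3^{-2})$, and the function $k$ takes its minimal value $k(t_0)=(1-q_1^2q_3^{-2})^{1/2}$ at $t_0$. -/

import Mathlib

open MeasureTheory Filter Topology Set
open scoped ContDiff ENNReal RealInnerProductSpace

namespace ERFluid

noncomputable section

/-- `ℝⁿ` with the Euclidean norm. -/
abbrev Space (n : ℕ) := EuclideanSpace ℝ (Fin n)

/-- The classical partial derivative `∂φ/∂x_j`. -/
def partialD {n : ℕ} (φ : Space n → ℝ) (j : Fin n) (x : Space n) : ℝ :=
  fderiv ℝ φ x (EuclideanSpace.single j 1)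

/-- `C_c^∞(ℝⁿ)`. -/
def IsTest {n : ℕ} (φ : Space n → ℝ) : Prop :=
  ContDiff ℝ ∞ φ ∧ HasCompactSupport φ

/-- The space `L₂(Ω)`. -/
abbrev L2 {n : ℕ} (Ω : Set (Space n)) := Lp ℝ 2 (volume.restrict Ω)

/-- A bounded domain with Lipschitz continuous boundary: near every boundary point, `Ω` is the part
of the space lying strictly above the graph of a Lipschitz function, in the direction of some unit
vector `ν`. The function `γ` is constant along `ν`, i.e. it is a function of the
`n - 1` coordinates orthogonal to `ν`. -/
structure IsLipschitzDomain {n : ℕ} (Ω : Set (Space n)) : Prop where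
  isOpen : IsOpen Ω
  isConnected : IsConnected Ω
  isBounded : Bornology.IsBounded Ω
  boundary : ∀ x ∈ frontier Ω, ∃ (ρ : ℝ) (ν : Space n) (K : NNReal) (γ : Space n → ℝ),
    0 < ρ ∧ ‖ν‖ = 1 ∧ LipschitzWith K γ ∧ (∀ (y : Space n) (s : ℝ), γ (y + s • ν) = γ y) ∧
      ∀ y ∈ Metric.ball x ρ, (y ∈ Ω ↔ γ y < ⟪ν, y⟫)

/-- `S₁` is a non-empty (relatively) open subset of the boundary of `Ω`. -/
def IsOpenBoundaryPart {n : ℕ} (Ω S₁ : Set (Space n)) : Prop :=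
  S₁.Nonempty ∧ ∃ O : Set (Space n), IsOpen O ∧ S₁ = frontier Ω ∩ O

/-- `g` is the weak derivative `∂u/∂x_j` in `Ω`. -/
def IsWeakDeriv {n : ℕ} {Ω : Set (Space n)} (j : Fin n) (u g : L2 Ω) : Prop :=
  ∀ φ : Space n → ℝ, IsTest φ → tsupport φ ⊆ Ω →
    ∫ x in Ω, u x * partialD φ j x = -∫ x in Ω, g x * φ x

theorem IsTest.partialD_continuous {n : ℕ} {φ : Space n → ℝ} (h : IsTest φ) (j : Fin n) :
    Continuous (partialD φ j) := by
  have := h.1.continuous_fderiv (by simp)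
  exact this.clm_apply continuous_const

theorem IsTest.partialD_hasCompactSupport {n : ℕ} {φ : Space n → ℝ} (h : IsTest φ) (j : Fin n) :
    HasCompactSupport (partialD φ j) :=
  h.2.fderiv_apply ℝ (EuclideanSpace.single j 1)

theorem integrable_mul_test {n : ℕ} {Ω : Set (Space n)} (u : L2 Ω) {φ : Space n → ℝ}
    (hc : Continuous φ) (hs : HasCompactSupport φ) :
    Integrable (fun x => u x * φ x) (volume.restrict Ω) :=
  (Lp.memLp u).integrable_mul ((hc.memLp_of_hasCompactSupport hs (p := 2)).restrict Ω)

theorem IsWeakDeriv.zero {n : ℕ} {Ω : Set (Space n)} (j : Fin n) :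
    IsWeakDeriv j (0 : L2 Ω) 0 := by
  intro φ _ _
  have e : ∀ ψ : Space n → ℝ, ∫ x in Ω, (0 : L2 Ω) x * ψ x = 0 := by
    intro ψ
    rw [integral_eq_zero_of_ae]
    filter_upwards [Lp.coeFn_zero ℝ 2 (volume.restrict Ω)] with x hx
    rw [hx]
    simp
  rw [e, e, neg_zero]

theorem IsWeakDeriv.add {n : ℕ} {Ω : Set (Space n)} {j : Fin n} {u g v k : L2 Ω}
    (h₁ : IsWeakDeriv j u g) (h₂ : IsWeakDeriv j v k) : IsWeakDeriv j (u + v) (g + k) := by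
  intro φ hφ hs
  have e : ∀ (a b : L2 Ω) (ψ : Space n → ℝ), Continuous ψ → HasCompactSupport ψ →
      ∫ x in Ω, (a + b : L2 Ω) x * ψ x = (∫ x in Ω, a x * ψ x) + ∫ x in Ω, b x * ψ x := by
    intro a b ψ hc hs
    rw [← integral_add (integrable_mul_test a hc hs) (integrable_mul_test b hc hs)]
    apply integral_congr_ae
    filter_upwards [Lp.coeFn_add a b] with x hx
    rw [hx, Pi.add_apply, add_mul]
  rw [e _ _ _ (hφ.partialD_continuous j) (hφ.partialD_hasCompactSupport j),
    e _ _ _ hφ.1.continuous hφ.2, h₁ φ hφ hs, h₂ φ hφ hs]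
  ring

theorem IsWeakDeriv.smul {n : ℕ} {Ω : Set (Space n)} {j : Fin n} {u g : L2 Ω} (c : ℝ)
    (h : IsWeakDeriv j u g) : IsWeakDeriv j (c • u) (c • g) := by
  intro φ hφ hs
  have e : ∀ (a : L2 Ω) (ψ : Space n → ℝ),
      ∫ x in Ω, (c • a : L2 Ω) x * ψ x = c * ∫ x in Ω, a x * ψ x := by
    intro a ψ
    rw [← integral_const_mul]
    apply integral_congr_ae
    filter_upwards [Lp.coeFn_smul c a] with x hx
    simp [hx, mul_assoc]
  rw [e, e, h φ hφ hs]
  ring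

/-- The Sobolev space `H¹(Ω)ⁿ` of vector fields: a field `u ∈ L₂(Ω)ⁿ` together with its matrix of
weak derivatives `∂u_i/∂x_j ∈ L₂(Ω)` (which is determined by `u`). -/
def H1 {n : ℕ} (Ω : Set (Space n)) : Submodule ℝ ((Fin n → L2 Ω) × (Fin n → Fin n → L2 Ω)) where
  carrier := {U | ∀ i j, IsWeakDeriv j (U.1 i) (U.2 i j)}
  zero_mem' := fun _ j => IsWeakDeriv.zero j
  add_mem' := fun ha hb i j => (ha i j).add (hb i j)
  smul_mem' := fun c _ ha i j => (ha i j).smul c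

/-- The `i`-th component of a field in `H¹(Ω)ⁿ`. -/
def comp {n : ℕ} {Ω : Set (Space n)} (u : H1 Ω) (i : Fin n) : Space n → ℝ := u.1.1 i

/-- The weak derivative `∂u_i/∂x_j` of a field in `H¹(Ω)ⁿ`. -/
def grad {n : ℕ} {Ω : Set (Space n)} (u : H1 Ω) (i j : Fin n) : Space n → ℝ := u.1.2 i j

/-- `u|_{S₁} = g` in the sense of traces. The trace is the continuous extension to `H¹(Ω)ⁿ` of the
restriction map of smooth fields to the boundary: `u|_{S₁} = g` if there are smooth fields
converging to `u` in `H¹(Ω)ⁿ` and to `g` in `L₂(S₁)ⁿ`, where `S₁` carries the surface measure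
(the `(n-1)`-dimensional Hausdorff measure). -/
def HasTrace {n : ℕ} {Ω : Set (Space n)} (S₁ : Set (Space n)) (u : H1 Ω)
    (g : Space n → Fin n → ℝ) : Prop :=
  ∃ φ : ℕ → Fin n → Space n → ℝ, (∀ m i, IsTest (φ m i)) ∧
    (∀ i, Tendsto (fun m => eLpNorm (fun x => φ m i x - comp u i x) 2 (volume.restrict Ω))
      atTop (𝓝 0)) ∧
    (∀ i j, Tendsto (fun m => eLpNorm (fun x => partialD (φ m i) j x - grad u i j x) 2
      (volume.restrict Ω)) atTop (𝓝 0)) ∧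
    (∀ i, Tendsto (fun m => eLpNorm (fun x => φ m i x - g x i) 2
      ((Measure.hausdorffMeasure ((n : ℝ) - 1)).restrict S₁)) atTop (𝓝 0))

theorem partialD_add {n : ℕ} {φ ψ : Space n → ℝ} (hφ : IsTest φ) (hψ : IsTest ψ) (j : Fin n)
    (x : Space n) : partialD (fun y => φ y + ψ y) j x = partialD φ j x + partialD ψ j x := by
  unfold partialD
  rw [fderiv_fun_add (hφ.1.differentiable (by simp) x) (hψ.1.differentiable (by simp) x)]
  rfl

theorem partialD_smul {n : ℕ} {φ : Space n → ℝ} (hφ : IsTest φ) (c : ℝ) (j : Fin n)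
    (x : Space n) : partialD (fun y => c * φ y) j x = c * partialD φ j x := by
  unfold partialD
  rw [fderiv_const_mul (hφ.1.differentiable (by simp) x)]
  rfl

theorem tendsto_eLpNorm_add {n : ℕ} {μ : Measure (Space n)} {a b f : ℕ → Space n → ℝ}
    (ha : ∀ m, AEStronglyMeasurable (a m) μ) (hb : ∀ m, AEStronglyMeasurable (b m) μ)
    (hab : ∀ m, f m =ᵐ[μ] fun x => a m x + b m x)
    (h₁ : Tendsto (fun m => eLpNorm (a m) 2 μ) atTop (𝓝 0))
    (h₂ : Tendsto (fun m => eLpNorm (b m) 2 μ) atTop (𝓝 0)) :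
    Tendsto (fun m => eLpNorm (f m) 2 μ) atTop (𝓝 0) := by
  have h := h₁.add h₂
  rw [add_zero] at h
  refine tendsto_of_tendsto_of_tendsto_of_le_of_le tendsto_const_nhds h (fun _ => zero_le) ?_
  intro m
  have e : eLpNorm (f m) 2 μ = eLpNorm (a m + b m) 2 μ := eLpNorm_congr_ae (hab m)
  simp only [e]
  exact eLpNorm_add_le (ha m) (hb m) (by norm_num)

theorem tendsto_eLpNorm_smul {n : ℕ} {μ : Measure (Space n)} {a f : ℕ → Space n → ℝ} (c : ℝ)
    (hab : ∀ m, f m =ᵐ[μ] fun x => c * a m x)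
    (h₁ : Tendsto (fun m => eLpNorm (a m) 2 μ) atTop (𝓝 0)) :
    Tendsto (fun m => eLpNorm (f m) 2 μ) atTop (𝓝 0) := by
  have h := ENNReal.Tendsto.const_mul (a := ‖c‖ₑ) h₁ (Or.inr (by simp))
  rw [mul_zero] at h
  refine h.congr fun m => ?_
  rw [eLpNorm_congr_ae (hab m), ← eLpNorm_const_smul]
  rfl

theorem HasTrace.add_zero_trace {n : ℕ} {Ω S₁ : Set (Space n)} {u v : H1 Ω}
    (hu : HasTrace S₁ u 0) (hv : HasTrace S₁ v 0) : HasTrace S₁ (u + v) 0 := by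
  obtain ⟨φ, hφ, a₁, a₂, a₃⟩ := hu
  obtain ⟨ψ, hψ, b₁, b₂, b₃⟩ := hv
  refine ⟨fun m i x => φ m i x + ψ m i x,
    fun m i => ⟨(hφ m i).1.add (hψ m i).1, (hφ m i).2.add (hψ m i).2⟩, fun i => ?_,
    fun i j => ?_, fun i => ?_⟩
  · refine tendsto_eLpNorm_add (fun m => ?_) (fun m => ?_) (fun m => ?_) (a₁ i) (b₁ i)
    · exact (hφ m i).1.continuous.aestronglyMeasurable.sub (Lp.aestronglyMeasurable (u.1.1 i))
    · exact (hψ m i).1.continuous.aestronglyMeasurable.sub (Lp.aestronglyMeasurable (v.1.1 i))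
    · filter_upwards [Lp.coeFn_add (u.1.1 i) (v.1.1 i)] with x hx
      have : comp (u + v) i x = comp u i x + comp v i x := hx
      rw [this]; ring
  · refine tendsto_eLpNorm_add (fun m => ?_) (fun m => ?_) (fun m => ?_) (a₂ i j) (b₂ i j)
    · exact ((hφ m i).partialD_continuous j).aestronglyMeasurable.sub
        (Lp.aestronglyMeasurable (u.1.2 i j))
    · exact ((hψ m i).partialD_continuous j).aestronglyMeasurable.sub
        (Lp.aestronglyMeasurable (v.1.2 i j))
    · filter_upwards [Lp.coeFn_add (u.1.2 i j) (v.1.2 i j)] with x hx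
      have : grad (u + v) i j x = grad u i j x + grad v i j x := hx
      rw [this, partialD_add (hφ m i) (hψ m i)]; ring
  · refine tendsto_eLpNorm_add (fun m => ?_) (fun m => ?_) (fun m => ?_) (a₃ i) (b₃ i)
    · simpa using (hφ m i).1.continuous.aestronglyMeasurable
    · simpa using (hψ m i).1.continuous.aestronglyMeasurable
    · exact Eventually.of_forall fun x => by simp

theorem HasTrace.smul_zero_trace {n : ℕ} {Ω S₁ : Set (Space n)} {u : H1 Ω} (c : ℝ)
    (hu : HasTrace S₁ u 0) : HasTrace S₁ (c • u) 0 := by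
  obtain ⟨φ, hφ, a₁, a₂, a₃⟩ := hu
  refine ⟨fun m i x => c * φ m i x,
    fun m i => ⟨contDiff_const.mul (hφ m i).1, (hφ m i).2.mul_left⟩, fun i => ?_,
    fun i j => ?_, fun i => ?_⟩
  · refine tendsto_eLpNorm_smul c (fun m => ?_) (a₁ i)
    filter_upwards [Lp.coeFn_smul c (u.1.1 i)] with x hx
    have : comp (c • u) i x = c * comp u i x := hx
    rw [this]; ring
  · refine tendsto_eLpNorm_smul c (fun m => ?_) (a₂ i j)
    filter_upwards [Lp.coeFn_smul c (u.1.2 i j)] with x hx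
    have : grad (c • u) i j x = c * grad u i j x := hx
    rw [this, partialD_smul (hφ m i)]; ring
  · exact tendsto_eLpNorm_smul c (fun m => Eventually.of_forall fun x => by simp) (a₃ i)

theorem HasTrace.zero {n : ℕ} {Ω S₁ : Set (Space n)} : HasTrace S₁ (0 : H1 Ω) 0 := by
  refine ⟨fun _ _ _ => 0, fun _ _ => ⟨contDiff_const, HasCompactSupport.zero⟩, fun i => ?_,
    fun i j => ?_, fun i => ?_⟩
  · have e : (fun x => (0 : ℝ) - comp (0 : H1 Ω) i x) =ᵐ[volume.restrict Ω] 0 := by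
      filter_upwards [Lp.coeFn_zero ℝ 2 (volume.restrict Ω)] with x hx
      have : comp (0 : H1 Ω) i x = 0 := hx
      simp [this]
    simp only [eLpNorm_congr_ae e]
    simp
  · have e : (fun x => partialD (fun _ => (0 : ℝ)) j x - grad (0 : H1 Ω) i j x)
        =ᵐ[volume.restrict Ω] 0 := by
      filter_upwards [Lp.coeFn_zero ℝ 2 (volume.restrict Ω)] with x hx
      have : grad (0 : H1 Ω) i j x = 0 := hx
      simp [this, partialD]
    simp [eLpNorm_congr_ae e]
  · simp

/-- The space `X` of fields `u ∈ H¹(Ω)ⁿ` with `u|_{S₁} = 0`. -/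
def X {n : ℕ} (Ω S₁ : Set (Space n)) : Submodule ℝ (H1 Ω) where
  carrier := {u | HasTrace S₁ u 0}
  zero_mem' := HasTrace.zero
  add_mem' := fun ha hb => ha.add_zero_trace hb
  smul_mem' := fun c _ ha => ha.smul_zero_trace c

section Operators

variable {n : ℕ} {Ω S₁ : Set (Space n)}

/-- The rate of strain tensor `ε_ij(u) = (∂u_i/∂x_j + ∂u_j/∂x_i) / 2`. -/
def strain (u : H1 Ω) (i j : Fin n) (x : Space n) : ℝ :=
  (grad u i j x + grad u j i x) / 2

/-- `ε_ij(u) ε_ij(h)`, summed over `i` and `j`. -/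
def strainDot (u h : H1 Ω) (x : Space n) : ℝ :=
  ∑ i, ∑ j, strain u i j x * strain h i j x

/-- The second invariant `I(u) = ∑ ε_ij(u)²`. -/
def inv2 (u : H1 Ω) (x : Space n) : ℝ := ∑ i, ∑ j, strain u i j x ^ 2

/-- The divergence. -/
def divg (u : H1 Ω) (x : Space n) : ℝ := ∑ i, grad u i i x

/-- `‖u‖_X = (∫_Ω I(u) dx)^{1/2}`. -/
def normX (u : X Ω S₁) : ℝ := √(∫ x in Ω, inv2 u.1 x)

/-- `(Bu, Bh) = ∫_Ω div u div h dx`, i.e. the duality `(B*Bu, h)` with `B = div`. -/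
def divForm (u h : X Ω S₁) : ℝ := ∫ x in Ω, divg u.1 x * divg h.1 x

/-- `(L₃(u), h)`, that is
`2 ∫_Ω [e(|E|,x) (λ + I(ũ+u))^{-1/2} + ψ₁(I(ũ+u),|E|,x)] ε_ij(ũ+u) ε_ij(h) dx`. -/
def L3 (lam : ℝ) (e : ℝ → Space n → ℝ) (ψ₁ : ℝ → ℝ → Space n → ℝ) (E : Space n → Space n)
    (ut : H1 Ω) (u h : X Ω S₁) : ℝ :=
  2 * ∫ x in Ω, (e ‖E x‖ x * (√(lam + inv2 (ut + u.1) x))⁻¹ + ψ₁ (inv2 (ut + u.1) x) ‖E x‖ x)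
    * strainDot (ut + u.1) h.1 x

/-- `f ∈ X*`: continuity of a linear functional with respect to `‖·‖_X`. -/
def IsBoundedX (f : X Ω S₁ →ₗ[ℝ] ℝ) : Prop := ∃ C : ℝ, ∀ h, |f h| ≤ C * normX h

/-- A linear operator `A : X → X*`, with `A u h = (Au, h)`, that is self-adjoint, bounded with
constant `b₁` and coercive with constant `b₂`. -/
structure IsPreconditioner (A : X Ω S₁ →ₗ[ℝ] X Ω S₁ →ₗ[ℝ] ℝ) (b₁ b₂ : ℝ) : Prop where
  pos₁ : 0 < b₁
  pos₂ : 0 < b₂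
  symm : ∀ u h, A u h = A h u
  bounded : ∀ u h, |A u h| ≤ b₁ * normX u * normX h
  coercive : ∀ u, b₂ * normX u ^ 2 ≤ A u u

/-- `‖u‖₁ = (Au, u)^{1/2}`, the norm of `X₁`. -/
def norm1 (A : X Ω S₁ →ₗ[ℝ] X Ω S₁ →ₗ[ℝ] ℝ) (u : X Ω S₁) : ℝ := √(A u u)

/-- The norm of a functional in `X₁*`, the dual of `(X, ‖·‖₁)`. -/
def dualNorm1 (A : X Ω S₁ →ₗ[ℝ] X Ω S₁ →ₗ[ℝ] ℝ) (ℓ : X Ω S₁ → ℝ) : ℝ :=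
  sInf {C : ℝ | 0 ≤ C ∧ ∀ h, |ℓ h| ≤ C * norm1 A h}

/-- The norm in `𝓛(X₁, X₁*)` of the operator `T` with `(Tu, h) = a u h`. -/
def opNorm1 (A : X Ω S₁ →ₗ[ℝ] X Ω S₁ →ₗ[ℝ] ℝ) (a : X Ω S₁ → X Ω S₁ → ℝ) : ℝ :=
  sInf {C : ℝ | 0 ≤ C ∧ ∀ u h, |a u h| ≤ C * norm1 A u * norm1 A h}

/-- `u` solves `(L₃(u), h) + r (Bu, Bh) = (f, h)` for all `h ∈ X`. -/
def IsSolution (lam r : ℝ) (e : ℝ → Space n → ℝ) (ψ₁ : ℝ → ℝ → Space n → ℝ)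
    (E : Space n → Space n) (ut : H1 Ω) (f : X Ω S₁ →ₗ[ℝ] ℝ) (u : X Ω S₁) : Prop :=
  ∀ h, L3 lam e ψ₁ E ut u h + r * divForm u h = f h

/-- One step `u ↦ w` of the iteration:
`(Aw, h) = (Au, h) - t [(L₃(u), h) + r (Bu, Bh) - (f, h)]` for all `h ∈ X`. -/
def IsStep (lam r : ℝ) (e : ℝ → Space n → ℝ) (ψ₁ : ℝ → ℝ → Space n → ℝ)
    (E : Space n → Space n) (ut : H1 Ω) (f : X Ω S₁ →ₗ[ℝ] ℝ)
    (A : X Ω S₁ →ₗ[ℝ] X Ω S₁ →ₗ[ℝ] ℝ) (t : ℝ) (u w : X Ω S₁) : Prop :=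
  ∀ h, A w h = A u h - t * (L3 lam e ψ₁ E ut u h + r * divForm u h - f h)

end Operators

section Constants

/-- Condition (C0): `ψ₁` is a Carathéodory function on `ℝ₊² × Ω`. -/
def CondC0 {n : ℕ} (Ω : Set (Space n)) (ψ₁ : ℝ → ℝ → Space n → ℝ) : Prop :=
  (∀ᵐ x ∂(volume.restrict Ω),
    ContinuousOn (fun y : ℝ × ℝ => ψ₁ y.1 y.2 x) (Ici 0 ×ˢ Ici 0)) ∧
  ∀ y₁ y₂ : ℝ, 0 ≤ y₁ → 0 ≤ y₂ → AEMeasurable (fun x => ψ₁ y₁ y₂ x) (volume.restrict Ω)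

/-- Condition (C1a). The derivative in `y₁` at the end point `0` of `ℝ₊` is one-sided. -/
def CondC1a {n : ℕ} (Ω : Set (Space n)) (ψ₁ : ℝ → ℝ → Space n → ℝ) (a₁ a₂ a₃ a₄ : ℝ) : Prop :=
  ∀ᵐ x ∂(volume.restrict Ω), ∀ y₂ : ℝ, 0 ≤ y₂ →
    ContDiffOn ℝ 1 (fun y => ψ₁ y y₂ x) (Ici 0) ∧
    ∀ y₁ : ℝ, 0 ≤ y₁ →
      (a₁ ≤ ψ₁ y₁ y₂ x ∧ ψ₁ y₁ y₂ x ≤ a₂) ∧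
      a₃ ≤ ψ₁ y₁ y₂ x + 2 * derivWithin (fun y => ψ₁ y y₂ x) (Ici 0) y₁ * y₁ ∧
      |derivWithin (fun y => ψ₁ y y₂ x) (Ici 0) y₁| * y₁ ≤ a₄

/-- Condition (C4a). -/
def CondC4a {n : ℕ} (Ω : Set (Space n)) (e : ℝ → Space n → ℝ) (a₅ : ℝ) : Prop :=
  (∀ᵐ x ∂(volume.restrict Ω), ContinuousOn (fun y => e y x) (Ici 0) ∧
    ∀ y : ℝ, 0 ≤ y → 0 ≤ e y x ∧ e y x ≤ a₅) ∧
  ∀ y : ℝ, 0 ≤ y → AEMeasurable (fun x => e y x) (volume.restrict Ω)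

/-- `q₁ = min(2a₁, 2a₃) b₁⁻¹`. -/
def q1 (a₁ a₃ b₁ : ℝ) : ℝ := min (2 * a₁) (2 * a₃) * b₁⁻¹

/-- `q₂ = (2a₂ + 4a₄ + 4a₅ λ^{-1/2}) b₂⁻¹`. -/
def q2 (a₂ a₄ a₅ lam b₂ : ℝ) : ℝ := (2 * a₂ + 4 * a₄ + 4 * a₅ * (√lam)⁻¹) * b₂⁻¹

/-- `q₃ = q₂ + r ‖B*B‖_{𝓛(X₁, X₁*)}`. -/
def q3 {n : ℕ} {Ω S₁ : Set (Space n)} (A : X Ω S₁ →ₗ[ℝ] X Ω S₁ →ₗ[ℝ] ℝ)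
    (a₂ a₄ a₅ lam b₂ r : ℝ) : ℝ :=
  q2 a₂ a₄ a₅ lam b₂ + r * opNorm1 A divForm

/-- `k(t) = (1 - 2 q₁ t + q₃² t²)^{1/2}`. -/
def rate (q₁ q₃ t : ℝ) : ℝ := √(1 - 2 * q₁ * t + q₃ ^ 2 * t ^ 2)

end Constants

end

end ERFluid

open ERFluid

/-! The residual F(u) = L₃(u) + r B*Bu - f is strongly monotone and Lipschitz on X₁, which is a
Hilbert space under the inner product (Au, h). If G(u) is the Riesz representer of F(u), one step of
the iteration is u ↦ u - t G(u). Expanding the square of the difference of two steps, and using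
monotonicity with constant q₁ and the Lipschitz bound q₃, gives the factor 1 - 2q₁t + q₃²t². The
Banach fixed point theorem then supplies the solution, the convergence and the a priori bound
(`norm_step_sub_le`, `exists_iteration_hilbert`). Testing both estimates on one nonzero vector shows
q₁ ≤ q₃, hence the radicand is nonnegative; the statements on t₀ are completion of a square.

The constants come from a pointwise estimate. The stress is ξ ↦ θ(|ξ|²) ξ with θ(y) = κ(λ +
y)^{-1/2} + ψ₁(y) and ξ the strain. The mean value theorem along a segment, tested against a fixed
vector (`exists_mean_value_radial`), bounds it below by min(a₁, a₃) and above by a₂ + 2a₄ +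
2a₅λ^{-1/2}. Integration doubles these constants because of the factor 2 in L₃, and b₁, b₂ convert
‖·‖_X into ‖·‖₁.

The analytic weight lies in showing that ‖·‖_X is a complete norm on X, that is, in Korn's
inequality on a Lipschitz domain (`IsLipschitzDomain.exists_korn_hasTrace`). For a smooth field φ,
split ∇φ = V + W, where V is the L₂ projection onto the closure of gradients of test fields
supported in Ω. Integration by parts bounds V by the strain (`exists_helmholtz`). The remainder W
has curl-free and divergence-free rows, so its entries are harmonic, and its skew part w has ∂_k
w_ij = ∂_j S_ik - ∂_i S_jk with S the symmetric part. Interior estimates for harmonic functions then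
bound dist(x, ∂Ω) |∇w| in L₂ by S (`exists_weightedEnergy_le`).

A Poincaré inequality whose gradient carries the distance weight
(`IsLipschitzDomain.exists_weighted_poincare`) turns this into a bound of w minus a constant. It
combines a Hardy inequality in boundary charts with chains of balls in the interior. Thus ∇φ is
close to a constant skew matrix and φ to a rigid motion (`IsLipschitzDomain.exists_korn_rigid`).

The rigid motion is removed by the boundary values on S₁: its trace on a graph is the trace of φ
minus that of a field small in H¹, and a rigid motion vanishing on a piece of a graph is zero
(`Chart.rigid_eq_zero`). Since rigid motions form a finite-dimensional space, this uniqueness is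
already an estimate. Approximation by smooth fields carries the inequality to X. -/

namespace ERFluid

noncomputable section

/-! ### Tonelli's theorem along lines of a fixed direction -/

section LineIntegrals

variable {n : ℕ}

/-- Insert the indicator of 0 < ⟪ν, x⟫ < 1, swap the integrals and translate x by -s • ν. For each x
the indicator then has integral 1 in s. This slices space along ν without choosing coordinates on
the orthogonal hyperplane. -/
theorem lintegral_eq_slab (ν : Space n) (hν : ‖ν‖ = 1) {F : Space n → ℝ≥0∞} (hF : Measurable F) :
    ∫⁻ x, F x = ∫⁻ x in {x : Space n | ⟪ν, x⟫ ∈ Ioo (0 : ℝ) 1}, ∫⁻ s : ℝ, F (x + s • ν) := by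
  have hZ : MeasurableSet {x : Space n | ⟪ν, x⟫ ∈ Ioo (0 : ℝ) 1} :=
    (isOpen_Ioo.preimage (by fun_prop : Continuous fun x : Space n => ⟪ν, x⟫)).measurableSet
  have hI : Measurable fun q : ℝ => (Ioo (0 : ℝ) 1).indicator (fun _ => (1 : ℝ≥0∞)) q :=
    measurable_const.indicator measurableSet_Ioo
  have key : ∀ x : Space n, {x : Space n | ⟪ν, x⟫ ∈ Ioo (0 : ℝ) 1}.indicator
      (fun x => ∫⁻ s : ℝ, F (x + s • ν)) x =
      ∫⁻ s : ℝ, (Ioo (0 : ℝ) 1).indicator (fun _ => (1 : ℝ≥0∞)) ⟪ν, x⟫ * F (x + s • ν) := by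
    intro x
    rw [lintegral_const_mul _ (by fun_prop)]
    by_cases hx : ⟪ν, x⟫ ∈ Ioo (0 : ℝ) 1
    · rw [indicator_of_mem (by exact hx), indicator_of_mem hx, one_mul]
    · rw [indicator_of_notMem (by exact hx), indicator_of_notMem hx, zero_mul]
  rw [← lintegral_indicator hZ]
  simp_rw [key]
  rw [lintegral_lintegral_swap]
  · have h2 : ∀ s : ℝ, ∫⁻ x : Space n,
        (Ioo (0 : ℝ) 1).indicator (fun _ => (1 : ℝ≥0∞)) ⟪ν, x⟫ * F (x + s • ν) =
        ∫⁻ x : Space n, (Ioo (0 : ℝ) 1).indicator (fun _ => (1 : ℝ≥0∞)) (⟪ν, x⟫ - s) * F x := by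
      intro s
      rw [← lintegral_add_right_eq_self (fun x : Space n =>
        (Ioo (0 : ℝ) 1).indicator (fun _ => (1 : ℝ≥0∞)) (⟪ν, x⟫ - s) * F x) (s • ν)]
      congr 1 with x
      rw [inner_add_right, inner_smul_right, real_inner_self_eq_norm_sq, hν]
      simp
    simp_rw [h2]
    rw [lintegral_lintegral_swap]
    · congr 1 with x
      rw [lintegral_mul_const]
      · have h3 : ∫⁻ s : ℝ, (Ioo (0 : ℝ) 1).indicator (fun _ => (1 : ℝ≥0∞)) (⟪ν, x⟫ - s) = 1 := by
          rw [lintegral_sub_left_eq_self (fun s => (Ioo (0 : ℝ) 1).indicator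
            (fun _ => (1 : ℝ≥0∞)) s)]
          rw [lintegral_indicator measurableSet_Ioo]
          simp
        rw [h3, one_mul]
      · exact hI.comp (by fun_prop)
    · refine Measurable.aemeasurable ?_
      refine Measurable.mul ?_ ?_
      · exact hI.comp (by fun_prop)
      · exact hF.comp (by fun_prop)
  · refine Measurable.aemeasurable ?_
    refine Measurable.mul ?_ ?_
    · exact hI.comp (by fun_prop)
    · exact hF.comp (by fun_prop)

/-- An inequality between integrals over all lines of a given direction integrates up. -/
theorem lintegral_le_of_line (ν : Space n) (hν : ‖ν‖ = 1) {F G : Space n → ℝ≥0∞}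
    (hF : Measurable F) (hG : Measurable G)
    (h : ∀ x, ∫⁻ s : ℝ, F (x + s • ν) ≤ ∫⁻ s : ℝ, G (x + s • ν)) :
    ∫⁻ x, F x ≤ ∫⁻ x, G x := by
  rw [lintegral_eq_slab ν hν hF, lintegral_eq_slab ν hν hG]
  exact lintegral_mono fun x => h x

end LineIntegrals

/-! ### One-dimensional Hardy and Cauchy–Schwarz inequalities -/

section Hardy

/-- Integrate (t f²)' = f² + 2t f f' and absorb by 2t f f' ≥ -f²/2 - 2t² f'². The boundary term at ε
has a favourable sign and is dropped, so nothing depends on the behaviour of f near 0. -/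
theorem setIntegral_sq_le_of_endpoint {f f' : ℝ → ℝ} {ε τ : ℝ} (hε : 0 < ε) (hτ : ε ≤ τ)
    (hf : ∀ t ∈ Icc ε τ, HasDerivAt f (f' t) t) (hf' : ContinuousOn f' (Icc ε τ)) :
    ∫ t in ε..τ, f t ^ 2 ≤ 2 * τ * f τ ^ 2 + 4 * ∫ t in ε..τ, t ^ 2 * f' t ^ 2 := by
  have hfc : ContinuousOn f (Icc ε τ) := fun t ht => (hf t ht).continuousAt.continuousWithinAt
  have u : uIcc ε τ = Icc ε τ := uIcc_of_le hτ
  have i1 : IntervalIntegrable (fun t => f t ^ 2) volume ε τ :=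
    ContinuousOn.intervalIntegrable (by rw [u]; fun_prop)
  have i2 : IntervalIntegrable (fun t => t ^ 2 * f' t ^ 2) volume ε τ :=
    ContinuousOn.intervalIntegrable (by rw [u]; fun_prop)
  have i3 : IntervalIntegrable (fun t => 1 * f t ^ 2 + t * (2 * f t * f' t)) volume ε τ :=
    ContinuousOn.intervalIntegrable (by rw [u]; fun_prop)
  have ftc : ∫ t in ε..τ, (1 * f t ^ 2 + t * (2 * f t * f' t)) = τ * f τ ^ 2 - ε * f ε ^ 2 := by
    refine intervalIntegral.integral_eq_sub_of_hasDerivAt (f := fun t => t * f t ^ 2) ?_ i3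
    intro t ht
    rw [u] at ht
    have := (hasDerivAt_id t).mul ((hf t ht).pow 2)
    refine this.congr_deriv ?_
    simp
  have low : ∫ t in ε..τ, ((1 / 2) * f t ^ 2 - 2 * (t ^ 2 * f' t ^ 2)) ≤
      ∫ t in ε..τ, (1 * f t ^ 2 + t * (2 * f t * f' t)) := by
    refine intervalIntegral.integral_mono_on hτ ((i1.const_mul _).sub (i2.const_mul _)) i3 ?_
    intro t _
    nlinarith [sq_nonneg (f t + 2 * (t * f' t))]
  rw [intervalIntegral.integral_sub (i1.const_mul _) (i2.const_mul _),
    intervalIntegral.integral_const_mul, intervalIntegral.integral_const_mul, ftc] at low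
  nlinarith [mul_nonneg hε.le (sq_nonneg (f ε))]

theorem setLIntegral_Ioo_ofReal_eq {g : ℝ → ℝ} {a b : ℝ} (hab : a ≤ b)
    (hg : ContinuousOn g (Icc a b)) (h0 : ∀ t, 0 ≤ g t) :
    ∫⁻ t in Ioo a b, ENNReal.ofReal (g t) = ENNReal.ofReal (∫ t in a..b, g t) := by
  rw [intervalIntegral.integral_of_le hab, integral_Ioc_eq_integral_Ioo,
    ofReal_integral_eq_lintegral_ofReal]
  · exact (hg.integrableOn_compact isCompact_Icc).mono_set Ioo_subset_Icc_self
  · exact Eventually.of_forall h0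

/-- A Hardy inequality on an interval, without boundary condition. -/
theorem lintegral_sq_le_hardy {f f' : ℝ → ℝ} {h : ℝ} (hh : 0 < h)
    (hf : ∀ t ∈ Ioo 0 h, HasDerivAt f (f' t) t) (hf' : ContinuousOn f' (Ioo 0 h)) :
    ∫⁻ t in Ioo 0 h, ENNReal.ofReal (f t ^ 2) ≤
      5 * (∫⁻ t in Ioo (h / 2) h, ENNReal.ofReal (f t ^ 2)) +
        4 * ∫⁻ t in Ioo 0 h, ENNReal.ofReal (t ^ 2 * f' t ^ 2) := by
  set R := ∫⁻ t in Ioo 0 h, ENNReal.ofReal (t ^ 2 * f' t ^ 2) with hR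
  have hfc : ContinuousOn f (Ioo 0 h) := fun t ht => (hf t ht).continuousAt.continuousWithinAt
  -- For a fixed endpoint τ in the upper half, exhaust (0, h/2] by the intervals (ε_k, τ). The cap
  -- h/4 in ε_k keeps ε_k ≤ τ.
  have step1 : ∀ τ ∈ Ioo (h / 2) h, ∫⁻ t in Ioc 0 (h / 2), ENNReal.ofReal (f t ^ 2) ≤
      ENNReal.ofReal (2 * h) * ENNReal.ofReal (f τ ^ 2) + 4 * R := by
    intro τ hτ
    have hU : Ioc 0 (h / 2) ⊆ ⋃ k : ℕ, Ioo (min ((h / 4)) ((1 : ℝ) / (k + 1))) τ := by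
      intro t ht
      obtain ⟨k, hk⟩ := exists_nat_one_div_lt ht.1
      exact mem_iUnion.2 ⟨k, lt_of_le_of_lt (min_le_right _ _) hk, lt_of_le_of_lt ht.2 hτ.1⟩
    refine (lintegral_mono_set hU).trans ?_
    rw [setLIntegral_iUnion_of_directed]
    · refine iSup_le fun k => ?_
      set ε := min ((h / 4)) ((1 : ℝ) / (k + 1)) with hεd
      have hε : 0 < ε := lt_min (by positivity) (by positivity)
      have hετ : ε ≤ τ := (min_le_left _ _).trans (by have := hτ.1; linarith)
      have sub : Icc ε τ ⊆ Ioo 0 h := fun t ht => ⟨hε.trans_le ht.1, ht.2.trans_lt hτ.2⟩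
      have hfc' := hfc.mono sub
      have hfcont := hf'.mono sub
      have m := setIntegral_sq_le_of_endpoint hε hετ (fun t ht => hf t (sub ht)) hfcont
      rw [setLIntegral_Ioo_ofReal_eq hετ (by fun_prop) (fun t => sq_nonneg _)]
      refine (ENNReal.ofReal_le_ofReal m).trans ?_
      have hτ0 : 0 < τ := lt_of_lt_of_le hε hετ
      rw [ENNReal.ofReal_add (by positivity)
        (mul_nonneg (by norm_num) (intervalIntegral.integral_nonneg hετ fun t _ => by positivity)),
        ENNReal.ofReal_mul (by positivity), ENNReal.ofReal_mul (q := ∫ _ in _.._, _) (by norm_num),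
        ← setLIntegral_Ioo_ofReal_eq hετ (by fun_prop) (fun t => by positivity)]
      gcongr
      · exact hτ.2.le
      · simp
      · exact lintegral_mono_set (Ioo_subset_Icc_self.trans sub)
    · refine Monotone.directed_le fun a b hab => ?_
      refine Ioo_subset_Ioo_left (min_le_min_left _ ?_)
      gcongr
  -- Average over τ ∈ (h/2, h): the length h/2 turns the factor 2h into 4. Adding the upper half
  -- itself later makes it 5.
  have step2 : ∫⁻ t in Ioc 0 (h / 2), ENNReal.ofReal (f t ^ 2) ≤
      4 * (∫⁻ t in Ioo (h / 2) h, ENNReal.ofReal (f t ^ 2)) + 4 * R := by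
    have hi := setLIntegral_mono' (μ := volume) measurableSet_Ioo step1
    have hm : AEMeasurable (fun t => ENNReal.ofReal (f t ^ 2)) (volume.restrict (Ioo (h / 2) h)) :=
      ((hfc.mono (Ioo_subset_Ioo_left (by linarith))).aemeasurable measurableSet_Ioo).pow_const 2
        |>.ennreal_ofReal
    rw [lintegral_add_right _ measurable_const, lintegral_const_mul'' _ hm] at hi
    simp only [lintegral_const, MeasurableSet.univ, Measure.restrict_apply, univ_inter,
      Real.volume_Ioo] at hi
    have e2 : h - h / 2 = h / 2 := by ring
    rw [e2] at hi
    have hc : ENNReal.ofReal (h / 2) ≠ 0 := by simpa using hh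
    have hc' : ENNReal.ofReal (h / 2) ≠ ⊤ := ENNReal.ofReal_ne_top
    have e3 : ENNReal.ofReal (2 * h) = 4 * ENNReal.ofReal (h / 2) := by
      rw [show (4 : ℝ≥0∞) = ENNReal.ofReal 4 by simp, ← ENNReal.ofReal_mul (by norm_num)]
      congr 1; ring
    rw [e3] at hi
    have : (∫⁻ t in Ioc 0 (h / 2), ENNReal.ofReal (f t ^ 2)) * ENNReal.ofReal (h / 2) ≤
        (4 * (∫⁻ t in Ioo (h / 2) h, ENNReal.ofReal (f t ^ 2)) + 4 * R) *
          ENNReal.ofReal (h / 2) := by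
      refine hi.trans (le_of_eq ?_)
      ring
    exact (ENNReal.mul_le_mul_iff_left hc hc').1 this
  have e : Ioo 0 h = Ioc 0 (h / 2) ∪ Ioo (h / 2) h :=
    (Ioc_union_Ioo_eq_Ioo (by positivity) (by linarith)).symm
  calc ∫⁻ t in Ioo 0 h, ENNReal.ofReal (f t ^ 2)
      ≤ (∫⁻ t in Ioc 0 (h / 2), ENNReal.ofReal (f t ^ 2)) +
        ∫⁻ t in Ioo (h / 2) h, ENNReal.ofReal (f t ^ 2) := by
        rw [e]; exact lintegral_union_le _ _ _
    _ ≤ _ := by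
        refine (add_le_add_left step2 _).trans (le_of_eq ?_)
        ring

/-- With m = f 1 - f 0, the mean of f', integrate f'² ≥ 2m f' - m². -/
theorem sq_sub_le_lintegral_deriv_sq {f f' : ℝ → ℝ} (hf : ∀ t ∈ Icc (0 : ℝ) 1, HasDerivAt f (f' t) t)
    (hf' : ContinuousOn f' (Icc 0 1)) :
    ENNReal.ofReal ((f 1 - f 0) ^ 2) ≤ ∫⁻ t in Ioo (0 : ℝ) 1, ENNReal.ofReal (f' t ^ 2) := by
  rw [setLIntegral_Ioo_ofReal_eq zero_le_one (by fun_prop) (fun t => sq_nonneg _)]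
  refine ENNReal.ofReal_le_ofReal ?_
  have u : uIcc (0 : ℝ) 1 = Icc 0 1 := uIcc_of_le zero_le_one
  have i1 : IntervalIntegrable f' volume 0 1 :=
    ContinuousOn.intervalIntegrable (by rw [u]; exact hf')
  have i2 : IntervalIntegrable (fun t => f' t ^ 2) volume 0 1 :=
    ContinuousOn.intervalIntegrable (by rw [u]; fun_prop)
  have ftc : ∫ t in (0 : ℝ)..1, f' t = f 1 - f 0 :=
    intervalIntegral.integral_eq_sub_of_hasDerivAt (fun t ht => hf t (u ▸ ht)) i1
  set m := f 1 - f 0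
  have h0 : 0 ≤ ∫ t in (0 : ℝ)..1, (f' t ^ 2 - (2 * m * f' t - m ^ 2)) :=
    intervalIntegral.integral_nonneg zero_le_one fun t _ => by nlinarith [sq_nonneg (f' t - m)]
  rw [intervalIntegral.integral_sub i2 ((i1.const_mul _).sub intervalIntegrable_const),
    intervalIntegral.integral_sub (i1.const_mul _) intervalIntegrable_const,
    intervalIntegral.integral_const_mul, ftc] at h0
  simp at h0
  nlinarith

end Hardy

/-! ### Mean oscillation and the interior Poincaré inequality -/

section InteriorPoincare

variable {n : ℕ}

/-- The function `p` is measurable, and continuously differentiable in `Ω`. -/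
structure IsC1On (Ω : Set (Space n)) (p : Space n → ℝ) : Prop where
  measurable : Measurable p
  differentiableAt : ∀ x ∈ Ω, DifferentiableAt ℝ p x
  continuousOn_fderiv : ContinuousOn (fderiv ℝ p) Ω

theorem IsC1On.mono {Ω U : Set (Space n)} {p : Space n → ℝ} (h : IsC1On Ω p) (hU : U ⊆ Ω) :
    IsC1On U p :=
  ⟨h.measurable, fun x hx => h.differentiableAt x (hU hx), h.continuousOn_fderiv.mono hU⟩

/-- The mean oscillation integral `∫_U ∫_V |p(x) - p(y)|²`. -/
def osc (p : Space n → ℝ) (U V : Set (Space n)) : ℝ≥0∞ :=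
  ∫⁻ x in U, ∫⁻ y in V, ENNReal.ofReal ((p x - p y) ^ 2)

theorem osc_mono {p : Space n → ℝ} {U V U' V' : Set (Space n)} (hU : U ⊆ U') (hV : V ⊆ V') :
    osc p U V ≤ osc p U' V' :=
  (lintegral_mono_set hU).trans (lintegral_mono fun _ => lintegral_mono_set hV)

theorem measurable_ofReal_sub_sq {p : Space n → ℝ} (hp : Measurable p) :
    Measurable fun z : Space n × Space n => ENNReal.ofReal ((p z.1 - p z.2) ^ 2) := by fun_prop

theorem osc_comm {p : Space n → ℝ} (hp : Measurable p) (U V : Set (Space n)) :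
    osc p U V = osc p V U := by
  unfold osc
  rw [lintegral_lintegral_swap (measurable_ofReal_sub_sq hp).aemeasurable]
  congr 1 with y
  congr 1 with x
  congr 1
  ring

theorem osc_union_le {p : Space n → ℝ} (hp : Measurable p) (U V : Set (Space n)) :
    osc p (U ∪ V) (U ∪ V) ≤ osc p U U + 2 * osc p U V + osc p V V := by
  have h1 : ∀ W : Set (Space n), osc p W (U ∪ V) ≤ osc p W U + osc p W V := by
    intro W
    unfold osc
    rw [← lintegral_add_left]
    · exact lintegral_mono fun x => lintegral_union_le _ _ _
    · exact Measurable.lintegral_prod_right (measurable_ofReal_sub_sq hp)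
  calc osc p (U ∪ V) (U ∪ V) ≤ osc p U (U ∪ V) + osc p V (U ∪ V) := lintegral_union_le _ _ _
    _ ≤ (osc p U U + osc p U V) + (osc p V U + osc p V V) := add_le_add (h1 U) (h1 V)
    _ = _ := by rw [osc_comm hp V U]; ring

theorem ofReal_sub_sq_le (a b c : ℝ) : ENNReal.ofReal ((a - b) ^ 2) ≤
    2 * ENNReal.ofReal ((a - c) ^ 2) + 2 * ENNReal.ofReal ((c - b) ^ 2) := by
  rw [show (2 : ℝ≥0∞) = ENNReal.ofReal 2 by simp, ← ENNReal.ofReal_mul (by norm_num),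
    ← ENNReal.ofReal_mul (by norm_num), ← ENNReal.ofReal_add (by positivity) (by positivity)]
  exact ENNReal.ofReal_le_ofReal (by nlinarith [sq_nonneg ((a - c) - (c - b))])

/-- Interpose a third point z ∈ W between x and y and integrate |a - b|² ≤ 2|a - c|² + 2|c - b|²
over U × V × W. -/
theorem osc_mul_volume_le {p : Space n → ℝ} (hp : Measurable p) (U V W : Set (Space n)) :
    osc p U V * volume W ≤ 2 * volume V * osc p U W + 2 * volume U * osc p W V := by
  have m1 : Measurable fun z : (Space n × Space n) × Space n =>
      ENNReal.ofReal ((p z.1.1 - p z.2) ^ 2) := by fun_prop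
  have mxy (x : Space n) : Measurable fun y => ENNReal.ofReal ((p x - p y) ^ 2) := by fun_prop
  have myx (x : Space n) : Measurable fun y => ENNReal.ofReal ((p y - p x) ^ 2) := by fun_prop
  have e1 : osc p U V * volume W =
      ∫⁻ x in U, ∫⁻ y in V, ∫⁻ _ in W, ENNReal.ofReal ((p x - p y) ^ 2) := by
    unfold osc
    rw [← lintegral_mul_const _ (Measurable.lintegral_prod_right (measurable_ofReal_sub_sq hp))]
    congr 1 with x
    rw [← lintegral_mul_const _ (mxy x)]
    congr 1 with y
    simp
  have mW : Measurable fun x => ∫⁻ z in W, ENNReal.ofReal ((p x - p z) ^ 2) :=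
    Measurable.lintegral_prod_right (measurable_ofReal_sub_sq hp)
  have mW' : Measurable fun y => ∫⁻ z in W, ENNReal.ofReal ((p z - p y) ^ 2) := by
    convert mW using 4
    ring_nf
  have e2 : ∀ x y, ∫⁻ _ in W, ENNReal.ofReal ((p x - p y) ^ 2) ≤
      2 * (∫⁻ z in W, ENNReal.ofReal ((p x - p z) ^ 2)) +
      2 * (∫⁻ z in W, ENNReal.ofReal ((p z - p y) ^ 2)) := by
    intro x y
    rw [← lintegral_const_mul _ (mxy x), ← lintegral_const_mul _ (myx y),
      ← lintegral_add_left ((mxy x).const_mul _)]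
    exact lintegral_mono fun z => ofReal_sub_sq_le _ _ _
  have e3 : osc p W V = ∫⁻ y in V, ∫⁻ z in W, ENNReal.ofReal ((p z - p y) ^ 2) :=
    lintegral_lintegral_swap (measurable_ofReal_sub_sq hp).aemeasurable
  rw [e1, e3]
  calc _ ≤ ∫⁻ x in U, ∫⁻ y in V, (2 * (∫⁻ z in W, ENNReal.ofReal ((p x - p z) ^ 2)) +
      2 * (∫⁻ z in W, ENNReal.ofReal ((p z - p y) ^ 2))) :=
        lintegral_mono fun x => lintegral_mono fun y => e2 x y
    _ = ∫⁻ x in U, (2 * volume V * (∫⁻ z in W, ENNReal.ofReal ((p x - p z) ^ 2)) +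
        2 * ∫⁻ y in V, ∫⁻ z in W, ENNReal.ofReal ((p z - p y) ^ 2)) := by
        congr 1 with x
        rw [lintegral_add_left measurable_const, lintegral_const_mul _ mW']
        congr 1
        simp
        ring
    _ = _ := by
        rw [lintegral_add_right _ measurable_const, lintegral_const_mul _ mW]
        simp only [lintegral_const, MeasurableSet.univ, Measure.restrict_apply, univ_inter, osc]
        ring

/-- Only the cross term needs work: route it through the overlap W = U ∩ V, where both factors are
oscillations within U or within V. -/
theorem osc_union_le_of_overlap {p : Space n → ℝ} (hp : Measurable p) {U V : Set (Space n)}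
    (h0 : volume (U ∩ V) ≠ 0) (h1 : volume (U ∩ V) ≠ ⊤) :
    osc p (U ∪ V) (U ∪ V) ≤ (1 + 4 * (volume U + volume V) * (volume (U ∩ V))⁻¹) *
      (osc p U U + osc p V V) := by
  set W := U ∩ V
  have h2 : osc p U V ≤ (2 * volume V * osc p U U + 2 * volume U * osc p V V) * (volume W)⁻¹ := by
    rw [← div_eq_mul_inv, ENNReal.le_div_iff_mul_le (Or.inl h0) (Or.inl h1)]
    refine (osc_mul_volume_le hp U V W).trans ?_
    gcongr
    · exact osc_mono subset_rfl inter_subset_left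
    · exact osc_mono inter_subset_right subset_rfl
  calc _ ≤ osc p U U + 2 * osc p U V + osc p V V := osc_union_le hp U V
    _ ≤ osc p U U + 2 * ((2 * volume V * osc p U U + 2 * volume U * osc p V V) *
        (volume W)⁻¹) + osc p V V := by gcongr
    _ ≤ osc p U U + 2 * ((2 * (volume U + volume V) * osc p U U +
          2 * (volume U + volume V) * osc p V V) * (volume W)⁻¹) + osc p V V := by
        gcongr
        · exact le_add_self
        · exact le_self_add
    _ = _ := by ring

/-- The Poincaré inequality on a bounded convex open set. -/
theorem osc_le_of_convex {B : Set (Space n)} (hB : IsOpen B) (hc : Convex ℝ B) {r : ℝ}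
    (hr : ∀ x ∈ B, ∀ y ∈ B, ‖y - x‖ ≤ r) {p : Space n → ℝ} (hp : IsC1On B p) :
    osc p B B ≤ ENNReal.ofReal (r ^ 2) * volume (Metric.closedBall (0 : Space n) r) *
      ∫⁻ x in B, ENNReal.ofReal (‖fderiv ℝ p x‖ ^ 2) := by
  set N : Space n → ℝ≥0∞ := B.indicator fun x => ENNReal.ofReal (‖fderiv ℝ p x‖ ^ 2) with hN
  have hBm := hB.measurableSet
  have hNm : Measurable N := by
    classical
    have : Measurable (B.indicator fun x => ‖fderiv ℝ p x‖ ^ 2) := by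
      rw [← piecewise_eq_indicator]
      refine (hp.continuousOn_fderiv.norm.pow 2).measurable_piecewise
        (continuousOn_const (c := (0 : ℝ))) hBm
    have e : N = fun x => ENNReal.ofReal (B.indicator (fun x => ‖fderiv ℝ p x‖ ^ 2) x) := by
      funext x
      by_cases hx : x ∈ B <;> simp [hN, hx]
    rw [e]
    exact this.ennreal_ofReal
  set c : ℝ≥0∞ := ENNReal.ofReal (r ^ 2)
  -- By convexity the whole segment from x to x + h stays in B, so the one-dimensional estimate
  -- applies to θ ↦ p(x + θh).
  have line : ∀ x ∈ B, ∀ h, x + h ∈ B → ENNReal.ofReal ((p x - p (x + h)) ^ 2) ≤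
      c * ∫⁻ θ in Ioo (0 : ℝ) 1, N (x + θ • h) := by
    intro x hx h hxh
    have hmem : ∀ θ ∈ Icc (0 : ℝ) 1, x + θ • h ∈ B := by
      intro θ hθ
      have := hc hx hxh (sub_nonneg.2 hθ.2) hθ.1 (by ring)
      convert this using 1
      module
    have hd : ∀ θ ∈ Icc (0 : ℝ) 1,
        HasDerivAt (fun θ : ℝ => p (x + θ • h)) (fderiv ℝ p (x + θ • h) h) θ := by
      intro θ hθ
      have h1 : HasDerivAt (fun θ : ℝ => x + θ • h) h θ := by
        simpa using ((hasDerivAt_id θ).smul_const h).const_add x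
      exact (hp.differentiableAt _ (hmem θ hθ)).hasFDerivAt.comp_hasDerivAt θ h1
    have hdc : ContinuousOn (fun θ : ℝ => fderiv ℝ p (x + θ • h) h) (Icc 0 1) :=
      (hp.continuousOn_fderiv.comp (by fun_prop) hmem).clm_apply continuousOn_const
    have := sq_sub_le_lintegral_deriv_sq hd hdc
    simp only [one_smul, zero_smul, add_zero] at this
    rw [show (p x - p (x + h)) ^ 2 = (p (x + h) - p x) ^ 2 by ring]
    refine this.trans ?_
    rw [← lintegral_const_mul _ (by fun_prop)]
    refine setLIntegral_mono' measurableSet_Ioo fun θ hθ => ?_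
    rw [hN, indicator_of_mem (hmem θ (Ioo_subset_Icc_self hθ)), ← ENNReal.ofReal_mul (sq_nonneg r)]
    refine ENNReal.ofReal_le_ofReal ?_
    have hle : |fderiv ℝ p (x + θ • h) h| ≤ r * ‖fderiv ℝ p (x + θ • h)‖ := by
      refine ((fderiv ℝ p (x + θ • h)).le_opNorm h).trans ?_
      rw [mul_comm]
      have := hr x hx _ hxh
      rw [add_sub_cancel_left] at this
      gcongr
    rw [← mul_pow, ← sq_abs]
    gcongr
  -- Substitute y = x + h. The displacement h stays in a ball of radius r, and x may range over the
  -- whole space because N vanishes outside B.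
  have sub1 : osc p B B ≤ ∫⁻ x, ∫⁻ h in Metric.closedBall (0 : Space n) r,
      c * ∫⁻ θ in Ioo (0 : ℝ) 1, N (x + θ • h) := by
    unfold osc
    rw [← lintegral_indicator hBm]
    refine lintegral_mono fun x => ?_
    by_cases hx : x ∈ B
    · rw [indicator_of_mem hx, ← lintegral_indicator hBm,
        ← lintegral_add_left_eq_self _ x, ← lintegral_indicator Metric.isClosed_closedBall.measurableSet]
      refine lintegral_mono fun h => ?_
      by_cases hh : x + h ∈ B
      · have : h ∈ Metric.closedBall (0 : Space n) r := by
          have := hr x hx _ hh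
          rw [add_sub_cancel_left] at this
          simpa using this
        rw [indicator_of_mem hh, indicator_of_mem this]
        exact line x hx h hh
      · rw [indicator_of_notMem hh]
        exact zero_le
    · rw [indicator_of_notMem hx]
      exact zero_le
  refine sub1.trans ?_
  have mm : Measurable fun q : (Space n × Space n) × ℝ => N (q.1.1 + q.2 • q.1.2) :=
    hNm.comp (by fun_prop)
  have mi : Measurable fun q : Space n × Space n => ∫⁻ θ in Ioo (0 : ℝ) 1, N (q.1 + θ • q.2) :=
    Measurable.lintegral_prod_right mm
  rw [lintegral_lintegral_swap (mi.const_mul c).aemeasurable]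
  -- Translation invariance makes the x-integral independent of both θ and h; integrating over h
  -- then only contributes the volume of the ball.
  have inner : ∀ h : Space n, ∫⁻ x, c * ∫⁻ θ in Ioo (0 : ℝ) 1, N (x + θ • h) = c * ∫⁻ x, N x := by
    intro h
    have mh : Measurable fun x : Space n => ∫⁻ θ in Ioo (0 : ℝ) 1, N (x + θ • h) :=
      mi.comp (by fun_prop : Measurable fun x : Space n => (x, h))
    rw [lintegral_const_mul _ mh, lintegral_lintegral_swap]
    · congr 1
      simp_rw [lintegral_add_right_eq_self]
      simp
    · exact (hNm.comp (by fun_prop : Measurable fun q : Space n × ℝ => q.1 + q.2 • h)).aemeasurable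
  simp_rw [inner]
  rw [lintegral_const, hN, lintegral_indicator hBm]
  simp only [MeasurableSet.univ, Measure.restrict_apply, univ_inter]
  exact le_of_eq (by ring)

/-- The weighted Dirichlet integral `∫_Ω dist(x, ∂Ω)² |∇p|²`. -/
def weightedEnergy (Ω : Set (Space n)) (p : Space n → ℝ) : ℝ≥0∞ :=
  ∫⁻ x in Ω, ENNReal.ofReal (Metric.infDist x Ωᶜ ^ 2 * ‖fderiv ℝ p x‖ ^ 2)

/-- `U` is an open subset of `Ω` on which the oscillation of every function is bounded by its
weighted energy in `Ω`. -/
def OscControlled (Ω U : Set (Space n)) : Prop :=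
  IsOpen U ∧ U ⊆ Ω ∧ ∃ C : ℝ≥0∞, C ≠ ⊤ ∧ ∀ p, IsC1On Ω p → osc p U U ≤ C * weightedEnergy Ω p

theorem OscControlled.union {Ω U V : Set (Space n)} (hU : OscControlled Ω U)
    (hV : OscControlled Ω V) (hb : volume Ω ≠ ⊤) (hne : (U ∩ V).Nonempty) :
    OscControlled Ω (U ∪ V) := by
  obtain ⟨hUo, hUs, C, hC, hCp⟩ := hU
  obtain ⟨hVo, hVs, D, hD, hDp⟩ := hV
  have fin : ∀ W : Set (Space n), W ⊆ Ω → volume W ≠ ⊤ := fun W hW =>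
    measure_ne_top_of_subset hW hb
  have h0 : volume (U ∩ V) ≠ 0 := ((hUo.inter hVo).measure_pos volume hne).ne'
  refine ⟨hUo.union hVo, union_subset hUs hVs,
    (1 + 4 * (volume U + volume V) * (volume (U ∩ V))⁻¹) * (C + D), ?_, fun p hp => ?_⟩
  · refine ENNReal.mul_ne_top (ENNReal.add_ne_top.2 ⟨by simp, ?_⟩) (ENNReal.add_ne_top.2 ⟨hC, hD⟩)
    refine ENNReal.mul_ne_top (ENNReal.mul_ne_top (by simp)
      (ENNReal.add_ne_top.2 ⟨fin U hUs, fin V hVs⟩)) (ENNReal.inv_ne_top.2 h0)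
  · refine (osc_union_le_of_overlap hp.measurable h0
      (fin _ (inter_subset_left.trans hUs))).trans ?_
    rw [mul_assoc _ (C + D), add_mul C D]
    exact mul_le_mul_right (add_le_add (hCp p hp) (hDp p hp)) _

/-- A ball of half the available radius stays at distance at least r from the complement, so there
the unweighted energy is at most r⁻² times the weighted one. -/
theorem exists_ball_oscControlled {Ω : Set (Space n)} (hΩ : IsOpen Ω) (hne : Ωᶜ.Nonempty)
    {x : Space n} (hx : x ∈ Ω) : ∃ r > 0, OscControlled Ω (Metric.ball x r) := by
  obtain ⟨ρ, hρ, hb⟩ := Metric.isOpen_iff.1 hΩ x hx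
  set r := ρ / 2 with hrd
  have hr : 0 < r := by positivity
  have hsub : Metric.ball x r ⊆ Ω := (Metric.ball_subset_ball (by linarith)).trans hb
  have hdist : ∀ y ∈ Metric.ball x r, r ≤ Metric.infDist y Ωᶜ := by
    intro y hy
    refine (Metric.le_infDist hne).2 fun z hz => ?_
    by_contra hlt
    push Not at hlt
    refine hz (hb ?_)
    rw [Metric.mem_ball] at hy ⊢
    have := dist_triangle z y x
    rw [dist_comm z y] at this
    linarith
  refine ⟨r, hr, Metric.isOpen_ball, hsub, ENNReal.ofReal ((2 * r) ^ 2) *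
    volume (Metric.closedBall (0 : Space n) (2 * r)) * ENNReal.ofReal ((r ^ 2)⁻¹), ?_, ?_⟩
  · exact ENNReal.mul_ne_top (ENNReal.mul_ne_top ENNReal.ofReal_ne_top
      measure_closedBall_lt_top.ne) ENNReal.ofReal_ne_top
  · intro p hp
    refine (osc_le_of_convex Metric.isOpen_ball (convex_ball x r) (r := 2 * r) ?_
      (hp.mono hsub)).trans ?_
    · intro y hy z hz
      rw [Metric.mem_ball] at hy hz
      rw [← dist_eq_norm]
      have := dist_triangle_right z y x
      linarith
    · rw [mul_assoc _ (ENNReal.ofReal ((r ^ 2)⁻¹))]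
      gcongr
      rw [weightedEnergy, ← lintegral_const_mul' _ _ ENNReal.ofReal_ne_top]
      refine (setLIntegral_mono' Metric.isOpen_ball.measurableSet fun y hy => ?_).trans
        (lintegral_mono_set hsub)
      rw [← ENNReal.ofReal_mul (by positivity)]
      refine ENNReal.ofReal_le_ofReal ?_
      have h1 : 1 ≤ (r ^ 2)⁻¹ * Metric.infDist y Ωᶜ ^ 2 := by
        rw [inv_mul_eq_div, one_le_div (by positivity)]
        gcongr
        exact hdist y hy
      rw [← mul_assoc]
      exact le_mul_of_one_le_left (sq_nonneg _) h1

/-- Every compact subset of a domain is contained in an open subset on which oscillation is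
controlled. -/
theorem exists_oscControlled_of_isCompact {Ω K : Set (Space n)} (hΩ : IsOpen Ω)
    (hcon : IsConnected Ω) (hne : Ωᶜ.Nonempty) (hb : volume Ω ≠ ⊤) (hK : IsCompact K)
    (hKΩ : K ⊆ Ω) : ∃ U, K ⊆ U ∧ U.Nonempty ∧ OscControlled Ω U := by
  obtain ⟨x₀, hx₀⟩ := hcon.nonempty
  obtain ⟨r₀, hr₀, hB₀⟩ := exists_ball_oscControlled hΩ hne hx₀
  -- Points joined to x₀ by a controlled set. Gluing small balls shows that A and its complement in
  -- Ω are both open, so connectedness gives A = Ω.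
  set A := {x ∈ Ω | ∃ U, x ∈ U ∧ x₀ ∈ U ∧ OscControlled Ω U} with hA
  have hstep : ∀ x ∈ Ω, ∃ r > 0, Metric.ball x r ⊆ Ω ∧
      ((Metric.ball x r ∩ A).Nonempty → Metric.ball x r ⊆ A) := by
    intro x hx
    obtain ⟨r, hr, hB⟩ := exists_ball_oscControlled hΩ hne hx
    refine ⟨r, hr, hB.2.1, ?_⟩
    rintro ⟨z, hzB, hzΩ, U, hzU, h0U, hU⟩ y hy
    exact ⟨hB.2.1 hy, Metric.ball x r ∪ U, Or.inl hy, Or.inr h0U, hB.union hU hb ⟨z, hzB, hzU⟩⟩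
  have hAo : IsOpen A := by
    rw [Metric.isOpen_iff]
    intro x hx
    obtain ⟨r, hr, -, h⟩ := hstep x hx.1
    exact ⟨r, hr, h ⟨x, Metric.mem_ball_self hr, hx⟩⟩
  have hBo : IsOpen (Ω \ A) := by
    rw [Metric.isOpen_iff]
    intro x hx
    obtain ⟨r, hr, hs, h⟩ := hstep x hx.1
    refine ⟨r, hr, fun y hy => ⟨hs hy, fun hyA => hx.2 (h ⟨y, hy, hyA⟩ (Metric.mem_ball_self hr))⟩⟩
  have hAΩ : Ω ⊆ A := by
    by_contra hcontra
    obtain ⟨y, hyΩ, hyA⟩ := not_subset.1 hcontra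
    obtain ⟨z, hz, hz1, hz2⟩ := hcon.isPreconnected A (Ω \ A) hAo hBo
      (fun x hx => by by_cases h : x ∈ A <;> simp [h, hx])
      ⟨x₀, hx₀, hx₀, _, Metric.mem_ball_self hr₀, Metric.mem_ball_self hr₀, hB₀⟩
      ⟨y, hyΩ, hyΩ, hyA⟩
    exact hz2.2 hz1
  -- Keeping x₀ in every set makes any two of them overlap, so the finite unions produced by
  -- compactness remain controlled.
  have hcov : ∃ U, K ⊆ U ∧ x₀ ∈ U ∧ OscControlled Ω U := by
    refine hK.induction_on (p := fun K => ∃ U, K ⊆ U ∧ x₀ ∈ U ∧ OscControlled Ω U) ?_ ?_ ?_ ?_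
    · exact ⟨_, empty_subset _, Metric.mem_ball_self hr₀, hB₀⟩
    · rintro s t hst ⟨U, hU, h⟩
      exact ⟨U, hst.trans hU, h⟩
    · rintro s t ⟨U, hU, h0U, hUc⟩ ⟨V, hV, h0V, hVc⟩
      exact ⟨U ∪ V, union_subset_union hU hV, Or.inl h0U, hUc.union hVc hb ⟨x₀, h0U, h0V⟩⟩
    · intro x hx
      obtain ⟨-, U, hxU, h0U, hUc⟩ := hAΩ (hKΩ hx)
      exact ⟨U, mem_nhdsWithin_of_mem_nhds (hUc.1.mem_nhds hxU), U, subset_rfl, h0U, hUc⟩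
  obtain ⟨U, hKU, h0, hU⟩ := hcov
  exact ⟨U, hKU, ⟨x₀, h0⟩, hU⟩

end InteriorPoincare

/-! ### Boundary charts and the distance-weighted Poincaré inequality -/

section BoundaryCharts

variable {n : ℕ}

/-- A boundary chart of `Ω` near `x₀`, of size less than `δ`: in a cylinder around `x₀` with axis
`ν`, the set `Ω` is the part lying above the graph of the Lipschitz function `γ`. -/
structure Chart (Ω : Set (Space n)) (x₀ : Space n) (δ : ℝ) where
  ν : Space n
  K : NNReal
  γ : Space n → ℝ
  a : ℝ
  a_pos : 0 < a
  norm_ν : ‖ν‖ = 1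
  lipschitz : LipschitzWith K γ
  γ_add : ∀ (y : Space n) (s : ℝ), γ (y + s • ν) = γ y
  γ_center : γ x₀ = ⟪ν, x₀⟫
  dist_lt : ∀ y, ‖(y - x₀) - ⟪ν, y - x₀⟫ • ν‖ < a → |⟪ν, y⟫ - γ y| < a → dist y x₀ < δ
  mem_iff : ∀ y, ‖(y - x₀) - ⟪ν, y - x₀⟫ • ν‖ < a → |⟪ν, y⟫ - γ y| < a →
    (y ∈ Ω ↔ 0 < ⟪ν, y⟫ - γ y)
  le_infDist : ∀ y, ‖(y - x₀) - ⟪ν, y - x₀⟫ • ν‖ < a → 0 < ⟪ν, y⟫ - γ y → ⟪ν, y⟫ - γ y < a →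
    ⟪ν, y⟫ - γ y ≤ (1 + K) * Metric.infDist y Ωᶜ

/-- The ball in the definition of a Lipschitz domain is traded for a cylinder adapted to the graph.
The centre lies on the graph because it is a limit of points of Ω without belonging to Ω. The
distance estimate holds because the height over the graph is (1 + K)-Lipschitz. -/
theorem IsLipschitzDomain.nonempty_chart {Ω : Set (Space n)} (hΩ : IsLipschitzDomain Ω)
    {x₀ : Space n} (hx₀ : x₀ ∈ frontier Ω) {δ : ℝ} (hδ : 0 < δ) : Nonempty (Chart Ω x₀ δ) := by
  obtain ⟨ρ, ν, K, γ, hρ, hν, hγ, hγν, hmem⟩ := hΩ.boundary x₀ hx₀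
  have hx₀Ω : x₀ ∉ Ω := fun h => by
    have := hΩ.isOpen.inter_frontier_eq
    exact (this ▸ (⟨h, hx₀⟩ : x₀ ∈ Ω ∩ frontier Ω) : x₀ ∈ (∅ : Set _))
  have hcompl : Ωᶜ.Nonempty := ⟨x₀, hx₀Ω⟩
  have hγc := hγ.continuous
  have hcenter : γ x₀ = ⟪ν, x₀⟫ := by
    refine le_antisymm ?_ (not_lt.1 fun h => hx₀Ω ((hmem x₀ (Metric.mem_ball_self hρ)).2 h))
    by_contra hlt
    push Not at hlt
    have hop : IsOpen {y : Space n | ⟪ν, y⟫ < γ y} := isOpen_lt (by fun_prop) hγc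
    obtain ⟨z, ⟨hz1, hz2⟩, hz3⟩ := mem_closure_iff.1 (frontier_subset_closure hx₀) _
      (hop.inter Metric.isOpen_ball) ⟨hlt, Metric.mem_ball_self hρ⟩
    exact lt_asymm hz1 ((hmem z hz2).1 hz3)
  set b := min δ (ρ / 2)
  have hb : 0 < b := lt_min hδ (by positivity)
  have hK : (0 : ℝ) ≤ K := K.2
  -- A point of the cylinder is within a of the axis and, along it, within a + K a of the centre;
  -- the total (K + 2) a must stay below b.
  set a := b / (K + 3) with ha
  have ha0 : 0 < a := by positivity
  have hab : (K + 2) * a < b := by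
    have : (K + 3) * a = b := by rw [ha]; field_simp
    nlinarith
  have hdist : ∀ y, ‖(y - x₀) - ⟪ν, y - x₀⟫ • ν‖ < a → |⟪ν, y⟫ - γ y| < a → dist y x₀ < b := by
    intro y h1 h2
    have e1 : γ y = γ (x₀ + ((y - x₀) - ⟪ν, y - x₀⟫ • ν)) := by
      rw [← hγν (x₀ + ((y - x₀) - ⟪ν, y - x₀⟫ • ν)) ⟪ν, y - x₀⟫]
      congr 1
      abel
    have h3 : |γ y - γ x₀| ≤ K * a := by
      have := hγ.dist_le_mul (x₀ + ((y - x₀) - ⟪ν, y - x₀⟫ • ν)) x₀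
      rw [← e1, Real.dist_eq, dist_eq_norm, add_sub_cancel_left] at this
      exact this.trans (by gcongr)
    have h4 : |⟪ν, y - x₀⟫| ≤ a + K * a := by
      rw [inner_sub_right, ← hcenter]
      calc |⟪ν, y⟫ - γ x₀| = |(⟪ν, y⟫ - γ y) + (γ y - γ x₀)| := by ring_nf
        _ ≤ _ := (abs_add_le _ _).trans (add_le_add h2.le h3)
    rw [dist_eq_norm]
    calc ‖y - x₀‖ = ‖((y - x₀) - ⟪ν, y - x₀⟫ • ν) + ⟪ν, y - x₀⟫ • ν‖ := by congr 1; abel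
      _ ≤ ‖(y - x₀) - ⟪ν, y - x₀⟫ • ν‖ + ‖⟪ν, y - x₀⟫ • ν‖ := norm_add_le _ _
      _ ≤ a + (a + K * a) := by
          rw [norm_smul, hν, mul_one]
          exact add_le_add h1.le h4
      _ < b := by linarith
  refine ⟨⟨ν, K, γ, a, ha0, hν, hγ, hγν, hcenter, fun y h1 h2 => (hdist y h1 h2).trans_le
    (min_le_left _ _), fun y h1 h2 => ?_, fun y h1 h2 h3 => ?_⟩⟩
  · rw [hmem y, sub_pos]
    exact (hdist y h1 h2).trans_le ((min_le_right _ _).trans (by linarith))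
  -- A point z closer to y than height/(1 + K) still has positive height, and b ≤ ρ/2 leaves room
  -- for z to lie in the ball of radius ρ. Hence z would belong to Ω.
  · rw [← div_le_iff₀' (by positivity), Metric.le_infDist hcompl]
    intro z hz
    by_contra hlt
    push Not at hlt
    rw [lt_div_iff₀ (by positivity)] at hlt
    refine hz ((hmem z ?_).2 ?_)
    · have hy := hdist y h1 (by rwa [abs_of_pos h2])
      have hyz : dist y z < a := by
        have : dist y z ≤ dist y z * (1 + K) := le_mul_of_one_le_right dist_nonneg (by linarith)
        linarith
      have hb2 : b ≤ ρ / 2 := min_le_right _ _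
      have : a ≤ b := by nlinarith
      rw [Metric.mem_ball]
      have := dist_triangle z y x₀
      rw [dist_comm z y] at this
      linarith
    · have g1 : |γ z - γ y| ≤ K * dist y z := by
        have := hγ.dist_le_mul z y
        rwa [Real.dist_eq, dist_comm z y] at this
      have g2 : |⟪ν, y - z⟫| ≤ dist y z := by
        have := abs_real_inner_le_norm ν (y - z)
        rwa [hν, one_mul, ← dist_eq_norm] at this
      rw [inner_sub_right] at g2
      have := le_abs_self (γ z - γ y)
      have := le_abs_self (⟪ν, y⟫ - ⟪ν, z⟫)
      nlinarith

namespace Chart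

variable {Ω : Set (Space n)} {x₀ : Space n} {δ : ℝ} (c : Chart Ω x₀ δ)

/-- The height over the graph. -/
def height (y : Space n) : ℝ := ⟪c.ν, y⟫ - c.γ y

/-- The distance from the axis of the chart. -/
def axisDist (y : Space n) : ℝ := ‖(y - x₀) - ⟪c.ν, y - x₀⟫ • c.ν‖

/-- The part of the chart that lies in `Ω`. -/
def upper : Set (Space n) := {y | c.axisDist y < c.a ∧ c.height y ∈ Ioo 0 c.a}

/-- The chart neighbourhood of `x₀`. -/
def nhd : Set (Space n) := {y | c.axisDist y < c.a ∧ |c.height y| < c.a}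

theorem continuous_height : Continuous c.height := by
  have := c.lipschitz.continuous
  unfold height
  fun_prop

theorem continuous_axisDist : Continuous c.axisDist := by
  unfold axisDist
  fun_prop

theorem isOpen_upper : IsOpen c.upper :=
  (isOpen_lt c.continuous_axisDist continuous_const).inter
    (isOpen_Ioo.preimage c.continuous_height)

theorem isOpen_nhd : IsOpen c.nhd :=
  (isOpen_lt c.continuous_axisDist continuous_const).inter
    (isOpen_lt c.continuous_height.abs continuous_const)

theorem center_mem_nhd : x₀ ∈ c.nhd := by
  refine ⟨?_, ?_⟩
  · simpa [axisDist] using c.a_pos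
  · simpa [height, c.γ_center] using c.a_pos

theorem height_add (x : Space n) (s : ℝ) : c.height (x + s • c.ν) = c.height x + s := by
  unfold height
  rw [c.γ_add, inner_add_right, inner_smul_right, real_inner_self_eq_norm_sq, c.norm_ν]
  ring

theorem axisDist_add (x : Space n) (s : ℝ) : c.axisDist (x + s • c.ν) = c.axisDist x := by
  unfold axisDist
  congr 1
  rw [add_sub_right_comm, inner_add_right, inner_smul_right, real_inner_self_eq_norm_sq, c.norm_ν]
  module

theorem upper_subset_nhd : c.upper ⊆ c.nhd := fun y hy =>
  ⟨hy.1, by rw [abs_of_pos hy.2.1]; exact hy.2.2⟩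

theorem upper_subset : c.upper ⊆ Ω := fun y hy =>
  (c.mem_iff y hy.1 (c.upper_subset_nhd hy).2).2 hy.2.1

theorem inter_nhd_subset : Ω ∩ c.nhd ⊆ c.upper := fun y hy =>
  ⟨hy.2.1, (c.mem_iff y hy.2.1 hy.2.2).1 hy.1, (abs_lt.1 hy.2.2).2⟩

/-- The height grows at unit speed along the axis while the distance to the axis is constant.
Parametrised by height, each line thus meets `upper` either in (0, a) or not at all. -/
theorem lintegral_upper_line (F : Space n → ℝ≥0∞) (x : Space n) :
    ∫⁻ s : ℝ, c.upper.indicator F (x + s • c.ν) =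
      if c.axisDist x < c.a then ∫⁻ t in Ioo 0 c.a, F (x + (t - c.height x) • c.ν) else 0 := by
  split_ifs with hx
  · rw [← lintegral_sub_right_eq_self _ (c.height x), ← lintegral_indicator measurableSet_Ioo]
    congr 1 with t
    by_cases ht : t ∈ Ioo 0 c.a
    · rw [indicator_of_mem ht, indicator_of_mem]
      refine ⟨?_, ?_⟩
      · rwa [c.axisDist_add]
      · rw [c.height_add]
        simpa using ht
    · rw [indicator_of_notMem ht, indicator_of_notMem]
      intro h
      refine ht ?_
      have := h.2
      rw [c.height_add] at this
      simpa using this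
  · rw [← lintegral_zero (μ := (volume : Measure ℝ))]
    congr 1 with s
    rw [indicator_of_notMem]
    intro h
    have := h.1
    rw [c.axisDist_add] at this
    exact hx this

end Chart

theorem measurable_indicator_ofReal {U : Set (Space n)} (hU : MeasurableSet U) {g : Space n → ℝ}
    (hg : ContinuousOn g U) : Measurable (U.indicator fun x => ENNReal.ofReal (g x)) := by
  classical
  have : Measurable (U.indicator g) := by
    rw [← piecewise_eq_indicator]
    exact hg.measurable_piecewise (continuousOn_const (c := (0 : ℝ))) hU
  have e : (U.indicator fun x => ENNReal.ofReal (g x)) =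
      fun x => ENNReal.ofReal (U.indicator g x) := by
    funext x
    by_cases hx : x ∈ U <;> simp [hx]
  rw [e]
  exact this.ennreal_ofReal

/-- The Hardy inequality in a boundary chart. -/
theorem Chart.lintegral_upper_le {Ω : Set (Space n)} {x₀ : Space n} {δ : ℝ} (c : Chart Ω x₀ δ)
    {p : Space n → ℝ} (hp : IsC1On Ω p) :
    ∫⁻ x in c.upper, ENNReal.ofReal (p x ^ 2) ≤
      5 * (∫⁻ x in c.upper ∩ {x | c.a / 2 < c.height x}, ENNReal.ofReal (p x ^ 2)) +
        4 * ∫⁻ x in c.upper, ENNReal.ofReal (c.height x ^ 2 * ‖fderiv ℝ p x‖ ^ 2) := by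
  have hpu := hp.mono c.upper_subset
  have hpc : ContinuousOn p c.upper := fun x hx =>
    (hpu.differentiableAt x hx).continuousAt.continuousWithinAt
  have hfc := hpu.continuousOn_fderiv
  have hm := c.isOpen_upper.measurableSet
  have hT : MeasurableSet {x | c.a / 2 < c.height x} :=
    (isOpen_lt continuous_const c.continuous_height).measurableSet
  have hh := c.continuous_height.continuousOn (s := c.upper)
  have m1 := measurable_indicator_ofReal hm (hpc.pow 2)
  have m2 : Measurable (c.upper.indicator
      fun x => ENNReal.ofReal (c.height x ^ 2 * ‖fderiv ℝ p x‖ ^ 2)) :=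
    measurable_indicator_ofReal hm (by fun_prop)
  have m3 : Measurable (c.upper.indicator ({x | c.a / 2 < c.height x}.indicator
      fun x => ENNReal.ofReal (p x ^ 2))) := by
    rw [indicator_indicator, inter_comm, ← indicator_indicator]
    exact m1.indicator hT
  have e3 : ∫⁻ x in c.upper ∩ {x | c.a / 2 < c.height x}, ENNReal.ofReal (p x ^ 2) =
      ∫⁻ x, c.upper.indicator ({x | c.a / 2 < c.height x}.indicator
        fun x => ENNReal.ofReal (p x ^ 2)) x := by
    rw [← lintegral_indicator (hm.inter hT), indicator_indicator]
  rw [e3, ← lintegral_indicator hm, ← lintegral_indicator hm, ← lintegral_const_mul _ m3,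
    ← lintegral_const_mul _ m2, ← lintegral_add_left (m3.const_mul _)]
  -- On each line parallel to the axis this is the one-dimensional Hardy inequality in the height
  -- variable; the derivative along the unit vector ν is at most the norm of the gradient.
  refine lintegral_le_of_line c.ν c.norm_ν m1 ((m3.const_mul _).add (m2.const_mul _)) fun x => ?_
  have mline : Measurable fun s : ℝ => x + s • c.ν := by fun_prop
  have m3' : Measurable fun s : ℝ => c.upper.indicator ({x | c.a / 2 < c.height x}.indicator
      fun x => ENNReal.ofReal (p x ^ 2)) (x + s • c.ν) := m3.comp mline
  have m2' : Measurable fun s : ℝ => c.upper.indicator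
      (fun x => ENNReal.ofReal (c.height x ^ 2 * ‖fderiv ℝ p x‖ ^ 2)) (x + s • c.ν) :=
    m2.comp mline
  rw [lintegral_add_left (m3'.const_mul _), lintegral_const_mul _ m3', lintegral_const_mul _ m2', c.lintegral_upper_line, c.lintegral_upper_line, c.lintegral_upper_line]
  split_ifs with hx
  swap
  · simp
  have hin : ∀ t ∈ Ioo 0 c.a, x + (t - c.height x) • c.ν ∈ c.upper := by
    intro t ht
    refine ⟨by rwa [c.axisDist_add], ?_⟩
    rw [c.height_add]
    simpa using ht
  have hd : ∀ t ∈ Ioo 0 c.a, HasDerivAt (fun t : ℝ => p (x + (t - c.height x) • c.ν))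
      (fderiv ℝ p (x + (t - c.height x) • c.ν) c.ν) t := by
    intro t ht
    have h1 : HasDerivAt (fun t : ℝ => x + (t - c.height x) • c.ν) c.ν t := by
      simpa using (((hasDerivAt_id t).sub_const (c.height x)).smul_const c.ν).const_add x
    exact (hpu.differentiableAt _ (hin t ht)).hasFDerivAt.comp_hasDerivAt t h1
  have hdc : ContinuousOn (fun t : ℝ => fderiv ℝ p (x + (t - c.height x) • c.ν) c.ν)
      (Ioo 0 c.a) :=
    (hfc.comp (by fun_prop) hin).clm_apply continuousOn_const
  refine (lintegral_sq_le_hardy c.a_pos hd hdc).trans ?_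
  refine add_le_add (mul_le_mul_right ?_ _) (mul_le_mul_right ?_ _)
  · rw [← lintegral_indicator measurableSet_Ioo, ← lintegral_indicator measurableSet_Ioo]
    refine lintegral_mono fun t => ?_
    by_cases ht : t ∈ Ioo (c.a / 2) c.a
    · have ht' : t ∈ Ioo 0 c.a := ⟨by have := c.a_pos; have := ht.1; linarith, ht.2⟩
      rw [indicator_of_mem ht, indicator_of_mem ht', indicator_of_mem]
      show c.a / 2 < c.height _
      rw [c.height_add]
      have := ht.1
      linarith
    · rw [indicator_of_notMem ht]
      exact zero_le
  · refine setLIntegral_mono' measurableSet_Ioo fun t ht => ?_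
    refine ENNReal.ofReal_le_ofReal ?_
    rw [c.height_add]
    have hle := (fderiv ℝ p (x + (t - c.height x) • c.ν)).le_opNorm c.ν
    rw [c.norm_ν, mul_one, Real.norm_eq_abs] at hle
    rw [show c.height x + (t - c.height x) = t by ring,
      ← sq_abs (fderiv ℝ p (x + (t - c.height x) • c.ν) c.ν)]
    gcongr

theorem IsC1On.sub_const {Ω : Set (Space n)} {p : Space n → ℝ} (hp : IsC1On Ω p) (b : ℝ) :
    IsC1On Ω fun x => p x - b := by
  have e : fderiv ℝ (fun x => p x - b) = fderiv ℝ p := by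
    funext x
    exact fderiv_sub_const b
  exact ⟨hp.measurable.sub_const b, fun x hx => (hp.differentiableAt x hx).sub_const b,
    e ▸ hp.continuousOn_fderiv⟩

theorem weightedEnergy_sub_const (Ω : Set (Space n)) (p : Space n → ℝ) (b : ℝ) :
    weightedEnergy Ω (fun x => p x - b) = weightedEnergy Ω p := by
  unfold weightedEnergy
  simp_rw [fderiv_sub_const]

theorem IsLipschitzDomain.isCompact_infDist_ge {Ω : Set (Space n)} (hΩ : IsLipschitzDomain Ω)
    {b : ℝ} (hb : 0 < b) : IsCompact {x | b ≤ Metric.infDist x Ωᶜ} ∧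
      {x | b ≤ Metric.infDist x Ωᶜ} ⊆ Ω := by
  have hsub : {x | b ≤ Metric.infDist x Ωᶜ} ⊆ Ω := by
    intro x hx
    by_contra h
    have : Metric.infDist x Ωᶜ = 0 := Metric.infDist_zero_of_mem h
    rw [mem_ofPred_eq, this] at hx
    linarith
  exact ⟨Metric.isCompact_of_isClosed_isBounded
    (isClosed_le continuous_const (Metric.continuous_infDist_pt _)) (hΩ.isBounded.subset hsub), hsub⟩

/-- Near each boundary point Hardy's inequality controls p by its values at heights above a/2, which
lie in a compact part of Ω, and by a height-weighted gradient. Since height ≤ (1 + K) dist, the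
weight becomes the distance. Compactness of the frontier leaves finitely many charts. -/
theorem IsLipschitzDomain.exists_boundary_layer {Ω : Set (Space n)} (hΩ : IsLipschitzDomain Ω) :
    ∃ O : Set (Space n), frontier Ω ⊆ O ∧ IsOpen O ∧ ∃ K, IsCompact K ∧ K ⊆ Ω ∧ ∃ C : ℝ≥0∞, C ≠ ⊤ ∧
      ∀ p, IsC1On Ω p → ∫⁻ x in Ω ∩ O, ENNReal.ofReal (p x ^ 2) ≤
        C * ((∫⁻ x in K, ENNReal.ofReal (p x ^ 2)) + weightedEnergy Ω p) := by
  have hcomp : IsCompact (frontier Ω) :=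
    Metric.isCompact_of_isClosed_isBounded isClosed_frontier
      (hΩ.isBounded.closure.subset frontier_subset_closure)
  refine hcomp.induction_on (p := fun s => ∃ O : Set (Space n), s ⊆ O ∧ IsOpen O ∧
    ∃ K, IsCompact K ∧ K ⊆ Ω ∧ ∃ C : ℝ≥0∞, C ≠ ⊤ ∧
      ∀ p, IsC1On Ω p → ∫⁻ x in Ω ∩ O, ENNReal.ofReal (p x ^ 2) ≤
        C * ((∫⁻ x in K, ENNReal.ofReal (p x ^ 2)) + weightedEnergy Ω p)) ?_ ?_ ?_ ?_
  · exact ⟨∅, subset_rfl, isOpen_empty, ∅, isCompact_empty, empty_subset _, 0, by simp, by simp⟩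
  · rintro s t hst ⟨O, hO, h⟩
    exact ⟨O, hst.trans hO, h⟩
  · rintro s t ⟨O, hs, hO, K, hK, hKΩ, C, hC, h⟩ ⟨O', ht, hO', K', hK', hKΩ', C', hC', h'⟩
    refine ⟨O ∪ O', union_subset_union hs ht, hO.union hO', K ∪ K', hK.union hK',
      union_subset hKΩ hKΩ', C + C', ENNReal.add_ne_top.2 ⟨hC, hC'⟩, fun p hp => ?_⟩
    rw [inter_union_distrib_left, add_mul]
    refine (lintegral_union_le _ _ _).trans (add_le_add ((h p hp).trans ?_) ((h' p hp).trans ?_))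
    · gcongr
      exact subset_union_left
    · gcongr
      exact subset_union_right
  · intro x hx
    obtain ⟨c⟩ := hΩ.nonempty_chart hx one_pos
    have hK0 : (0 : ℝ) ≤ c.K := c.K.2
    set b := c.a / 2 / (1 + c.K) with hbd
    have hb : 0 < b := by have := c.a_pos; positivity
    refine ⟨c.nhd, mem_nhdsWithin_of_mem_nhds (c.isOpen_nhd.mem_nhds c.center_mem_nhd),
      c.nhd, subset_rfl, c.isOpen_nhd, {x | b ≤ Metric.infDist x Ωᶜ},
      (hΩ.isCompact_infDist_ge hb).1, (hΩ.isCompact_infDist_ge hb).2,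
      5 + 4 * ENNReal.ofReal ((1 + c.K) ^ 2), by finiteness, fun p hp => ?_⟩
    refine (lintegral_mono_set c.inter_nhd_subset).trans ((c.lintegral_upper_le hp).trans ?_)
    have h1 : ∫⁻ x in c.upper ∩ {x | c.a / 2 < c.height x}, ENNReal.ofReal (p x ^ 2) ≤
        ∫⁻ x in {x | b ≤ Metric.infDist x Ωᶜ}, ENNReal.ofReal (p x ^ 2) := by
      refine lintegral_mono_set fun y hy => ?_
      have h2 := c.le_infDist y hy.1.1 hy.1.2.1 hy.1.2.2
      have h3 : c.a / 2 < c.height y := hy.2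
      rw [mem_ofPred_eq, hbd, div_le_iff₀' (by positivity)]
      exact h3.le.trans h2
    have h2 : ∫⁻ x in c.upper, ENNReal.ofReal (c.height x ^ 2 * ‖fderiv ℝ p x‖ ^ 2) ≤
        ENNReal.ofReal ((1 + c.K) ^ 2) * weightedEnergy Ω p := by
      unfold weightedEnergy
      rw [← lintegral_const_mul' _ _ ENNReal.ofReal_ne_top]
      refine (setLIntegral_mono' c.isOpen_upper.measurableSet fun y hy => ?_).trans
        (lintegral_mono_set c.upper_subset)
      rw [← ENNReal.ofReal_mul (by positivity)]
      refine ENNReal.ofReal_le_ofReal ?_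
      have h2 := c.le_infDist y hy.1 hy.2.1 hy.2.2
      have h3 : 0 ≤ c.height y := hy.2.1.le
      rw [← mul_assoc]
      refine mul_le_mul_of_nonneg_right ?_ (sq_nonneg _)
      rw [← mul_pow]
      exact pow_le_pow_left₀ h3 h2 2
    calc _ ≤ 5 * (∫⁻ x in {x | b ≤ Metric.infDist x Ωᶜ}, ENNReal.ofReal (p x ^ 2)) +
        4 * (ENNReal.ofReal ((1 + c.K) ^ 2) * weightedEnergy Ω p) := by gcongr
      _ ≤ 5 * (∫⁻ x in {x | b ≤ Metric.infDist x Ωᶜ}, ENNReal.ofReal (p x ^ 2)) +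
        4 * (ENNReal.ofReal ((1 + c.K) ^ 2) * weightedEnergy Ω p) +
        (5 * weightedEnergy Ω p + 4 * ENNReal.ofReal ((1 + c.K) ^ 2) *
          ∫⁻ x in {x | b ≤ Metric.infDist x Ωᶜ}, ENNReal.ofReal (p x ^ 2)) := le_self_add
      _ = _ := by ring

theorem IsLipschitzDomain.compl_nonempty {Ω : Set (Space n)} (hΩ : IsLipschitzDomain Ω)
    (hn : 0 < n) : Ωᶜ.Nonempty := by
  have : Nonempty (Fin n) := ⟨⟨0, hn⟩⟩
  by_contra h
  rw [not_nonempty_iff_eq_empty, compl_empty_iff] at h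
  have := hΩ.isBounded
  rw [h] at this
  exact NormedSpace.unbounded_univ ℝ (Space n) this

/-- The improved Poincaré inequality on a Lipschitz domain, in which the gradient is weighted with
the distance from the boundary. -/
theorem IsLipschitzDomain.exists_weighted_poincare {Ω : Set (Space n)} (hΩ : IsLipschitzDomain Ω)
    (hn : 0 < n) : ∃ C : ℝ≥0∞, C ≠ ⊤ ∧ ∀ p, IsC1On Ω p →
      ∃ b : ℝ, ∫⁻ x in Ω, ENNReal.ofReal ((p x - b) ^ 2) ≤ C * weightedEnergy Ω p := by
  obtain ⟨O, hfO, hO, K, hK, hKΩ, C, hC, h⟩ := hΩ.exists_boundary_layer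
  -- What the boundary layer leaves uncovered, together with the compact set on which its estimate
  -- depends, is a compact subset of Ω. The interior theory therefore applies to both at once.
  have hK' : IsCompact (K ∪ closure Ω \ O) :=
    hK.union (hΩ.isBounded.isCompact_closure.diff hO)
  have hsub : K ∪ closure Ω \ O ⊆ Ω := by
    refine union_subset hKΩ fun x hx => ?_
    by_contra hxΩ
    exact hx.2 (hfO ⟨hx.1, fun hi => hxΩ (interior_subset hi)⟩)
  have hvol : volume Ω ≠ ⊤ := hΩ.isBounded.measure_lt_top.ne
  obtain ⟨U, hKU, hUne, hUo, hUΩ, D, hD, hosc⟩ := exists_oscControlled_of_isCompact hΩ.isOpen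
    hΩ.isConnected (hΩ.compl_nonempty hn) hvol hK' hsub
  have hU0 : volume U ≠ 0 := (hUo.measure_pos volume hUne).ne'
  have hU1 : volume U ≠ ⊤ := measure_ne_top_of_subset hUΩ hvol
  refine ⟨C * ((volume U)⁻¹ * D + 1) + (volume U)⁻¹ * D, ?_, fun p hp => ?_⟩
  · have : (volume U)⁻¹ ≠ ⊤ := ENNReal.inv_ne_top.2 hU0
    finiteness
  -- The constant b is the value p(y) at a point y where the integral of |p(y) - p|² over U does not
  -- exceed its average over y. No integrability of p is needed.
  obtain ⟨y, -, hy⟩ := exists_le_setLAverage (f := fun y => ∫⁻ x in U,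
    ENNReal.ofReal ((p y - p x) ^ 2)) hU0 hU1
    (Measurable.lintegral_prod_right (measurable_ofReal_sub_sq hp.measurable)).aemeasurable
  rw [setLAverage_eq] at hy
  have hyU : ∫⁻ x in U, ENNReal.ofReal ((p x - p y) ^ 2) ≤
      (volume U)⁻¹ * D * weightedEnergy Ω p := by
    calc ∫⁻ x in U, ENNReal.ofReal ((p x - p y) ^ 2)
        = ∫⁻ x in U, ENNReal.ofReal ((p y - p x) ^ 2) := by
          congr 1 with x
          congr 1
          ring
      _ ≤ _ := hy
      _ = (volume U)⁻¹ * osc p U U := by rw [ENNReal.div_eq_inv_mul]; rfl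
      _ ≤ _ := by
          rw [mul_assoc]
          gcongr
          exact hosc p hp
  refine ⟨p y, ?_⟩
  have hcov : Ω ⊆ (Ω ∩ O) ∪ U := by
    intro x hx
    by_cases hxO : x ∈ O
    · exact Or.inl ⟨hx, hxO⟩
    · exact Or.inr (hKU (Or.inr ⟨subset_closure hx, hxO⟩))
  calc _ ≤ (∫⁻ x in Ω ∩ O, ENNReal.ofReal ((p x - p y) ^ 2)) +
      ∫⁻ x in U, ENNReal.ofReal ((p x - p y) ^ 2) :=
        (lintegral_mono_set hcov).trans (lintegral_union_le _ _ _)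
    _ ≤ C * ((volume U)⁻¹ * D * weightedEnergy Ω p + weightedEnergy Ω p) +
        (volume U)⁻¹ * D * weightedEnergy Ω p := by
        refine add_le_add ((h _ (hp.sub_const (p y))).trans ?_) hyU
        rw [weightedEnergy_sub_const]
        gcongr
        exact (lintegral_mono_set (subset_union_left.trans hKU)).trans hyU
    _ = _ := by ring

end BoundaryCharts

/-! ### Radial mollifiers -/

section RadialKernel

/-- A smooth nonincreasing function on the line that vanishes on `[1, ∞)`. -/
def profile (q : ℝ) : ℝ := expNegInvGlue (1 - q)

theorem contDiff_profile : ContDiff ℝ ∞ profile :=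
  expNegInvGlue.contDiff.comp (contDiff_const.sub contDiff_id)

theorem contDiff_deriv_profile : ContDiff ℝ ∞ (deriv profile) :=
  (contDiff_infty_iff_deriv.1 contDiff_profile).2

theorem contDiff_deriv_deriv_profile : ContDiff ℝ ∞ (deriv (deriv profile)) :=
  (contDiff_infty_iff_deriv.1 contDiff_deriv_profile).2

theorem profile_eventuallyEq {q : ℝ} (hq : 1 < q) : profile =ᶠ[𝓝 q] fun _ => 0 := by
  filter_upwards [lt_mem_nhds hq] with x hx
  exact expNegInvGlue.zero_of_nonpos (by linarith)

theorem deriv_profile_eventuallyEq {q : ℝ} (hq : 1 < q) : deriv profile =ᶠ[𝓝 q] fun _ => 0 := by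
  filter_upwards [(profile_eventuallyEq hq).deriv] with x hx
  rw [hx]
  simp

theorem deriv_deriv_profile_of_one_lt {q : ℝ} (hq : 1 < q) : deriv (deriv profile) q = 0 := by
  rw [(deriv_profile_eventuallyEq hq).deriv_eq]
  simp

theorem deriv_profile_nonpos (q : ℝ) : deriv profile q ≤ 0 := by
  have : Antitone profile := fun a b hab => expNegInvGlue.monotone (by linarith)
  exact this.deriv_nonpos

theorem exists_bound_of_vanish {F : ℝ → ℝ} (hF : Continuous F) (h0 : ∀ q, 1 < q → F q = 0) :
    ∃ M, 0 ≤ M ∧ ∀ q, 0 ≤ q → |F q| ≤ M := by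
  obtain ⟨M, hM⟩ := isCompact_Icc.exists_bound_of_continuousOn (s := Icc (0 : ℝ) 1) hF.continuousOn
  refine ⟨max M 0, le_max_right _ _, fun q hq => ?_⟩
  by_cases h1 : q ≤ 1
  · exact (hM q ⟨hq, h1⟩).trans (le_max_left _ _)
  · rw [h0 q (not_le.1 h1), abs_zero]
    exact le_max_right _ _

variable {n : ℕ}

/-- The function `y ↦ F(|y - x|² / s²)`. -/
def radial (F : ℝ → ℝ) (s : ℝ) (x y : Space n) : ℝ := F (‖y - x‖ ^ 2 / s ^ 2)

theorem contDiff_radial {F : ℝ → ℝ} (hF : ContDiff ℝ ∞ F) (s : ℝ) (x : Space n) :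
    ContDiff ℝ ∞ (radial F s x) :=
  hF.comp (((contDiff_id.sub contDiff_const).norm_sq ℝ).div_const _)

theorem radial_eq_zero {F : ℝ → ℝ} (h0 : ∀ q, 1 < q → F q = 0) {s : ℝ} (hs : 0 < s)
    {x y : Space n} (hy : s < dist y x) : radial F s x y = 0 := by
  refine h0 _ ?_
  rw [one_lt_div (by positivity), ← dist_eq_norm]
  gcongr

theorem tsupport_radial_subset {F : ℝ → ℝ} (h0 : ∀ q, 1 < q → F q = 0) {s : ℝ} (hs : 0 < s)
    (x : Space n) : tsupport (radial F s x) ⊆ Metric.closedBall x s := by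
  refine closure_minimal (fun y hy => ?_) Metric.isClosed_closedBall
  by_contra h
  rw [Metric.mem_closedBall, not_le] at h
  exact hy (radial_eq_zero h0 hs h)

theorem isTest_radial {F : ℝ → ℝ} (hF : ContDiff ℝ ∞ F) (h0 : ∀ q, 1 < q → F q = 0) {s : ℝ}
    (hs : 0 < s) (x : Space n) : IsTest (radial F s x) :=
  ⟨contDiff_radial hF s x, HasCompactSupport.of_support_subset_isCompact
    (isCompact_closedBall x s) (subset_closure.trans (tsupport_radial_subset h0 hs x))⟩

theorem partialD_radial {F : ℝ → ℝ} (hF : Differentiable ℝ F) (s : ℝ) (x y : Space n) (k : Fin n) :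
    partialD (radial F s x) k y = radial (deriv F) s x y * (2 * (y - x) k / s ^ 2) := by
  have h1 : HasFDerivAt (fun y : Space n => ‖y - x‖ ^ 2 / s ^ 2)
      ((s ^ 2)⁻¹ • (2 • (innerSL ℝ (y - x)))) y := by
    have := ((hasFDerivAt_id y).sub_const x).norm_sq.const_mul ((s ^ 2)⁻¹)
    refine (this.congr_of_eventuallyEq (Eventually.of_forall fun z => ?_)).congr_fderiv ?_
    · simp [div_eq_inv_mul]
    · ext v
      simp
  have h2 := (hF (‖y - x‖ ^ 2 / s ^ 2)).hasDerivAt.comp_hasFDerivAt y h1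
  unfold partialD
  have e : radial F s x = F ∘ fun y : Space n => ‖y - x‖ ^ 2 / s ^ 2 := rfl
  rw [e, h2.fderiv]
  simp [radial, EuclideanSpace.inner_single_right]
  left
  ring

/-- With q = |y - x|²/s², the Laplacian of F(q) is s⁻² (4q F'' + 2n F'). The same expression occurs
in the derivative of the mollifier in its width; see `hasDerivAt_mollifier`. -/
theorem sum_partialD_partialD_radial {F : ℝ → ℝ} (hF : ContDiff ℝ ∞ F) {s : ℝ} (hs : 0 < s)
    (x y : Space n) : ∑ k, partialD (partialD (radial F s x) k) k y =
      (s ^ 2)⁻¹ * radial (fun q => 4 * q * deriv (deriv F) q + 2 * n * deriv F q) s x y := by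
  have hF1 : Differentiable ℝ F := hF.differentiable (by simp)
  have hF' := (contDiff_infty_iff_deriv.1 hF).2
  have hF2 : Differentiable ℝ (deriv F) := hF'.differentiable (by simp)
  have key : ∀ k, partialD (partialD (radial F s x) k) k y =
      radial (deriv (deriv F)) s x y * (4 * (y - x) k ^ 2 / s ^ 4) +
        radial (deriv F) s x y * (2 / s ^ 2) := by
    intro k
    have e : partialD (radial F s x) k =
        fun y => radial (deriv F) s x y * (2 * (y - x) k / s ^ 2) := by
      funext z
      exact partialD_radial hF1 s x z k
    have d1 : DifferentiableAt ℝ (radial (deriv F) s x) y :=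
      (contDiff_radial hF' s x).differentiable (by simp) y
    have d2 : HasFDerivAt (fun y : Space n => 2 * (y - x) k / s ^ 2)
        ((2 / s ^ 2) • (EuclideanSpace.proj k : Space n →L[ℝ] ℝ)) y := by
      have := (((EuclideanSpace.proj k : Space n →L[ℝ] ℝ).hasFDerivAt (x := y)).sub_const
        (x k)).const_mul (2 / s ^ 2)
      refine this.congr_of_eventuallyEq (Eventually.of_forall fun z => ?_)
      simp
      ring
    have h := d1.hasFDerivAt.fun_mul d2
    have h3 : fderiv ℝ (radial (deriv F) s x) y (EuclideanSpace.single k 1) =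
        radial (deriv (deriv F)) s x y * (2 * (y - x) k / s ^ 2) := partialD_radial hF2 s x y k
    rw [e]
    unfold partialD
    rw [h.fderiv]
    have h4 : (EuclideanSpace.proj k : Space n →L[ℝ] ℝ) (EuclideanSpace.single k 1) = 1 := by simp
    simp only [add_apply, smul_apply, h3, h4, smul_eq_mul]
    ring
  simp_rw [key]
  rw [Finset.sum_add_distrib, ← Finset.mul_sum, ← Finset.sum_div, ← Finset.mul_sum,
    ← EuclideanSpace.real_norm_sq_eq]
  simp only [radial, Finset.sum_const, Finset.card_univ, Fintype.card_fin, nsmul_eq_mul]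
  field_simp

/-- The radial mollifier of width `s` centred at `x`, of total mass independent of `s` and `x`. -/
def mollifier (s : ℝ) (x y : Space n) : ℝ :=
  (s ^ n)⁻¹ * radial (fun q => -2 * deriv profile q) s x y

theorem contDiff_mollifierProfile : ContDiff ℝ ∞ fun q => -2 * deriv profile q :=
  contDiff_const.mul contDiff_deriv_profile

theorem mollifierProfile_eq_zero (q : ℝ) (hq : 1 < q) : -2 * deriv profile q = 0 := by
  rw [(deriv_profile_eventuallyEq hq).eq_of_nhds, mul_zero]

theorem isTest_mollifier {s : ℝ} (hs : 0 < s) (x : Space n) : IsTest (mollifier s x) := by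
  have := isTest_radial contDiff_mollifierProfile mollifierProfile_eq_zero hs x
  exact ⟨contDiff_const.mul this.1, this.2.mul_left⟩

theorem mollifier_eq_zero {s : ℝ} (hs : 0 < s) {x y : Space n} (hy : s < dist y x) :
    mollifier s x y = 0 := by
  unfold mollifier
  rw [radial_eq_zero mollifierProfile_eq_zero hs hy, mul_zero]

theorem tsupport_mollifier_subset {s : ℝ} (hs : 0 < s) (x : Space n) :
    tsupport (mollifier s x) ⊆ Metric.closedBall x s := by
  refine closure_minimal (fun y hy => ?_) Metric.isClosed_closedBall
  by_contra h
  rw [Metric.mem_closedBall, not_le] at h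
  exact hy (mollifier_eq_zero hs h)

theorem mollifier_nonneg {s : ℝ} (hs : 0 < s) (x y : Space n) : 0 ≤ mollifier s x y :=
  mul_nonneg (by positivity) (by have := deriv_profile_nonpos (‖y - x‖ ^ 2 / s ^ 2)
                                 show 0 ≤ -2 * _; linarith)

theorem mollifier_symm (s : ℝ) (x y : Space n) : mollifier s x y = mollifier s 0 (x - y) := by
  unfold mollifier radial
  rw [sub_zero, norm_sub_rev]

theorem exists_mollifier_bound (n : ℕ) : ∃ M, 0 ≤ M ∧ ∀ (s : ℝ) (_ : 0 < s) (x y : Space n),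
    |mollifier s x y| ≤ M * (s ^ n)⁻¹ := by
  obtain ⟨M, hM, h⟩ := exists_bound_of_vanish contDiff_mollifierProfile.continuous
    mollifierProfile_eq_zero
  refine ⟨M, hM, fun s hs x y => ?_⟩
  unfold mollifier
  rw [abs_mul, abs_of_pos (by positivity), mul_comm]
  gcongr
  exact h _ (by positivity)

theorem exists_partialD_mollifier_bound (n : ℕ) : ∃ M, 0 ≤ M ∧ ∀ (s : ℝ) (_ : 0 < s)
    (x y : Space n) (k : Fin n), |partialD (mollifier s x) k y| ≤ M * (s ^ (n + 1))⁻¹ := by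
  obtain ⟨M, hM, h⟩ := exists_bound_of_vanish (F := deriv fun q => -2 * deriv profile q)
    (contDiff_infty_iff_deriv.1 contDiff_mollifierProfile).2.continuous (fun q hq => by
      have : (fun q => -2 * deriv profile q) =ᶠ[𝓝 q] fun _ => 0 := by
        filter_upwards [lt_mem_nhds hq] with x hx using mollifierProfile_eq_zero x hx
      rw [this.deriv_eq]
      simp)
  refine ⟨2 * M, by positivity, fun s hs x y k => ?_⟩
  have e : partialD (mollifier s x) k y = (s ^ n)⁻¹ *
      partialD (radial (fun q => -2 * deriv profile q) s x) k y :=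
    partialD_smul (isTest_radial contDiff_mollifierProfile mollifierProfile_eq_zero hs x) _ k y
  rw [e, partialD_radial (contDiff_mollifierProfile.differentiable (by simp))]
  by_cases hy : s < dist y x
  · have : radial (deriv fun q => -2 * deriv profile q) s x y = 0 := by
      refine radial_eq_zero (fun q hq => ?_) hs hy
      have : (fun q => -2 * deriv profile q) =ᶠ[𝓝 q] fun _ => 0 := by
        filter_upwards [lt_mem_nhds hq] with x hx using mollifierProfile_eq_zero x hx
      rw [this.deriv_eq]
      simp
    rw [this]
    simp
    positivity
  · push Not at hy
    have h1 : |(y - x) k| ≤ s := by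
      refine le_trans ?_ hy
      rw [dist_eq_norm]
      exact PiLp.norm_apply_le (y - x) k
    have h2 : |radial (deriv fun q => -2 * deriv profile q) s x y| ≤ M := h _ (by positivity)
    rw [abs_mul, abs_mul, abs_div, abs_mul, abs_of_pos (by positivity : 0 < (s ^ n)⁻¹),
      abs_of_pos (by positivity : 0 < s ^ 2), abs_two]
    calc (s ^ n)⁻¹ * (|radial (deriv fun q => -2 * deriv profile q) s x y| *
        (2 * |(y - x) k| / s ^ 2)) ≤ (s ^ n)⁻¹ * (M * (2 * s / s ^ 2)) := by gcongr
      _ = _ := by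
        field_simp
        ring

/-- This identity dictates the profile -2F': the width derivative of s⁻ⁿ (-2F'(q)) equals s^{1-n}
times the Laplacian of the compactly supported function F(q), with F the function `profile`. Pairing
with a weakly harmonic function therefore gives zero. -/
theorem hasDerivAt_mollifier {s : ℝ} (hs : 0 < s) (x y : Space n) :
    HasDerivAt (fun s => mollifier s x y) ((s ^ (n + 1))⁻¹ * radial
      (fun q => 4 * q * deriv (deriv profile) q + 2 * n * deriv profile q) s x y) s := by
  have h1 : HasDerivAt (fun s : ℝ => (s ^ n)⁻¹) (-(n * s ^ (n - 1)) / (s ^ n) ^ 2) s :=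
    (hasDerivAt_pow n s).fun_inv (by positivity)
  have h2 : HasDerivAt (fun s : ℝ => ‖y - x‖ ^ 2 / s ^ 2)
      (‖y - x‖ ^ 2 * (-(2 * s) / (s ^ 2) ^ 2)) s := by
    have := ((hasDerivAt_pow 2 s).fun_inv (by positivity)).const_mul (‖y - x‖ ^ 2)
    simpa [div_eq_mul_inv] using this
  have h3 : DifferentiableAt ℝ (deriv profile) (‖y - x‖ ^ 2 / s ^ 2) :=
    contDiff_deriv_profile.differentiable (by simp) _
  have h4 := h1.fun_mul ((h3.hasDerivAt.comp s h2).const_mul (-2))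
  refine h4.congr_deriv ?_
  simp only [radial, Function.comp]
  have hn : (n : ℝ) * s ^ (n - 1) = n * s ^ n / s := by
    rcases n with _ | m
    · simp
    · simp [pow_succ]
      field_simp
  rw [hn]
  field_simp
  ring

/-- The total mass of the mollifiers. -/
def mollifierMass (n : ℕ) : ℝ := ∫ y : Space n, mollifier 1 0 y

theorem integral_mollifier {s : ℝ} (hs : 0 < s) (x : Space n) :
    ∫ y, mollifier s x y = mollifierMass n := by
  have e : ∀ y : Space n, mollifier s x y = (s ^ n)⁻¹ * mollifier 1 0 (s⁻¹ • (y - x)) := by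
    intro y
    unfold mollifier radial
    rw [sub_zero, norm_smul, norm_inv, Real.norm_of_nonneg hs.le]
    congr 2
    simp
    field_simp
  simp_rw [e]
  rw [integral_const_mul, integral_sub_right_eq_self (fun y => mollifier 1 0 (s⁻¹ • y)),
    Measure.integral_comp_inv_smul_of_nonneg _ _ hs.le, mollifierMass]
  simp
  field_simp

/-- If the mass vanished, the nonnegative continuous kernel would vanish identically. Then `profile`
would have zero derivative on [0, 1), contradicting `profile` 0 > 0 = `profile` 1. Positive
dimension provides a vector of each length √q. -/
theorem mollifierMass_pos (hn : 0 < n) : 0 < mollifierMass n := by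
  have hc : Continuous (mollifier 1 (0 : Space n)) := (isTest_mollifier one_pos _).1.continuous
  have h0 : ∀ y : Space n, 0 ≤ mollifier 1 0 y := mollifier_nonneg one_pos 0
  refine (integral_nonneg h0).lt_of_ne fun hz => ?_
  have hint : Integrable (mollifier 1 (0 : Space n)) :=
    hc.integrable_of_hasCompactSupport (isTest_mollifier one_pos _).2
  have h1 : mollifier 1 (0 : Space n) = 0 :=
    Continuous.ae_eq_iff_eq volume hc continuous_const |>.1
      ((integral_eq_zero_iff_of_nonneg h0 hint).1 hz.symm)
  have h2 : ∀ q ∈ Ico (0 : ℝ) 1, HasDerivWithinAt profile 0 (Ici q) q := by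
    intro q hq
    have h3 := congrFun h1 (EuclideanSpace.single ⟨0, hn⟩ √q)
    simp [mollifier, radial, Real.sq_sqrt hq.1] at h3
    have := (contDiff_profile.differentiable (by simp) q).hasDerivAt
    rw [h3] at this
    exact this.hasDerivWithinAt
  have h3 := constant_of_has_deriv_right_zero contDiff_profile.continuous.continuousOn h2 1
    ⟨zero_le_one, le_rfl⟩
  have h4 : 0 < profile 0 := expNegInvGlue.pos_of_pos (by norm_num)
  have h5 : profile 1 = 0 := expNegInvGlue.zero_of_nonpos (by norm_num)
  linarith

end RadialKernel

/-! ### Weyl's lemma -/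

section Weyl

variable {n : ℕ} {Ω : Set (Space n)} {w : Space n → ℝ}

/-- `Δw = 0` in `Ω` in the sense of distributions. -/
def WeaklyHarmonic (Ω : Set (Space n)) (w : Space n → ℝ) : Prop :=
  ∀ ψ : Space n → ℝ, IsTest ψ → tsupport ψ ⊆ Ω →
    ∫ x in Ω, w x * ∑ k, partialD (partialD ψ k) k x = 0

/-- The mollification of `w` at scale `s`. -/
def mollify (Ω : Set (Space n)) (w : Space n → ℝ) (s : ℝ) (x : Space n) : ℝ :=
  ∫ y in Ω, w y * mollifier s x y

/-- Differentiate under the integral; the derivative is s^{1-n} ∫ w Δ(radial test function), and the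
closed ball inside Ω makes that test function admissible. The domination is uniform for widths above
s/2. -/
theorem WeaklyHarmonic.hasDerivAt_mollify (hw : WeaklyHarmonic Ω w)
    (hi : IntegrableOn w Ω) {s : ℝ} (hs : 0 < s) {x : Space n}
    (hx : Metric.closedBall x s ⊆ Ω) : HasDerivAt (fun s => mollify Ω w s x) 0 s := by
  set F : ℝ → ℝ := fun q => 4 * q * deriv (deriv profile) q + 2 * n * deriv profile q
  have hFc : Continuous F := by
    have := contDiff_deriv_profile.continuous
    have := contDiff_deriv_deriv_profile.continuous
    fun_prop
  have hF0 : ∀ q, 1 < q → F q = 0 := fun q hq => by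
    simp [F, deriv_deriv_profile_of_one_lt hq, (deriv_profile_eventuallyEq hq).eq_of_nhds]
  obtain ⟨M, hM0, hM⟩ := exists_bound_of_vanish hFc hF0
  obtain ⟨M', hM'0, hM'⟩ := exists_mollifier_bound n
  have hrad : ∀ s : ℝ, Continuous (radial F s x) := fun s => hFc.comp (by fun_prop)
  have main := (hasDerivAt_integral_of_dominated_loc_of_deriv_le (μ := volume.restrict Ω)
    (F := fun s y => w y * mollifier s x y)
    (F' := fun s y => w y * ((s ^ (n + 1))⁻¹ * radial F s x y))
    (bound := fun y => |w y| * (((s / 2) ^ (n + 1))⁻¹ * M))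
    (s := Ioi (s / 2)) (x₀ := s) (Ioi_mem_nhds (by linarith)) ?_ ?_ ?_ ?_ ?_ ?_).2
  · refine main.congr_deriv ?_
    have h := hw _ (isTest_radial contDiff_profile
      (fun q hq => (profile_eventuallyEq hq).eq_of_nhds) hs x)
      ((tsupport_radial_subset (fun q hq => (profile_eventuallyEq hq).eq_of_nhds) hs x).trans hx)
    simp_rw [sum_partialD_partialD_radial contDiff_profile hs] at h
    have e : ∀ y, w y * ((s ^ (n + 1))⁻¹ * radial F s x y) =
        (s ^ 2 * (s ^ (n + 1))⁻¹) * (w y * ((s ^ 2)⁻¹ * radial F s x y)) := by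
      intro y
      field_simp
    simp_rw [e]
    rw [integral_const_mul, h, mul_zero]
  · filter_upwards [lt_mem_nhds hs] with t ht
    exact hi.aestronglyMeasurable.mul (isTest_mollifier ht x).1.continuous.aestronglyMeasurable
  · exact hi.mul_bdd (c := M' * (s ^ n)⁻¹)
      (isTest_mollifier hs x).1.continuous.aestronglyMeasurable
      (Eventually.of_forall fun y => hM' s hs x y)
  · exact hi.aestronglyMeasurable.mul
      ((hrad s).const_mul _).aestronglyMeasurable
  · refine Eventually.of_forall fun y t ht => ?_
    have ht' : s / 2 < t := ht
    have ht0 : 0 < t := by linarith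
    rw [norm_mul, norm_mul, Real.norm_eq_abs, Real.norm_eq_abs, Real.norm_eq_abs,
      abs_of_pos (by positivity : 0 < (t ^ (n + 1))⁻¹)]
    gcongr
    exact hM _ (by positivity)
  · exact (Integrable.abs hi).mul_const _
  · refine Eventually.of_forall fun y t ht => ?_
    have ht' : s / 2 < t := ht
    exact (hasDerivAt_mollifier (by linarith) x y).const_mul (w y)

theorem WeaklyHarmonic.mollify_eq (hw : WeaklyHarmonic Ω w) (hi : IntegrableOn w Ω) {a b : ℝ}
    (ha : 0 < a) (hab : a ≤ b) {x : Space n} (hx : Metric.closedBall x b ⊆ Ω) :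
    mollify Ω w b x = mollify Ω w a x := by
  have hd : ∀ s ∈ Icc a b, HasDerivAt (fun s => mollify Ω w s x) 0 s := fun s hs =>
    hw.hasDerivAt_mollify hi (ha.trans_le hs.1)
      ((Metric.closedBall_subset_closedBall hs.2).trans hx)
  exact constant_of_has_deriv_right_zero (f := fun s => mollify Ω w s x)
    (fun s hs => (hd s hs).continuousAt.continuousWithinAt)
    (fun s hs => (hd s ⟨hs.1, hs.2.le⟩).hasDerivWithinAt) b ⟨hab, le_rfl⟩

/-- Lebesgue differentiation over balls: after division by the mass, the kernels have integral one,
live in a ball of radius s and are bounded by a constant over its volume. -/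
theorem ae_tendsto_mollify (hn : 0 < n) (hΩ : IsOpen Ω) (hi : IntegrableOn w Ω) :
    ∀ᵐ x ∂(volume.restrict Ω),
      Tendsto (fun s => mollify Ω w s x) (𝓝[>] 0) (𝓝 (mollifierMass n * w x)) := by
  have hm := hΩ.measurableSet
  have hi' : Integrable (Ω.indicator w) := (integrable_indicator_iff hm).2 hi
  have hmass := mollifierMass_pos hn
  obtain ⟨M, hM0, hM⟩ := exists_mollifier_bound n
  rw [ae_restrict_iff' hm]
  filter_upwards [(Besicovitch.vitaliFamily (volume : Measure (Space n))).ae_tendsto_average_norm_sub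
    hi'.locallyIntegrable] with x h₀ hxΩ
  have h1 := h₀.comp (Besicovitch.tendsto_filterAt volume x)
  have hpos : ∀ᶠ s : ℝ in 𝓝[>] 0, 0 < s := self_mem_nhdsWithin
  have h2 := tendsto_integral_smul_of_tendsto_average_norm_sub
    (g := fun s y => (mollifierMass n)⁻¹ * mollifier s x y)
    ((mollifierMass n)⁻¹ * M * volume.real (Metric.ball (0 : Space n) 1)) h1 ?_ ?_ ?_ ?_
  · rw [indicator_of_mem hxΩ] at h2
    refine (h2.const_mul (mollifierMass n)).congr fun s => ?_
    unfold mollify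
    rw [← integral_indicator hm, ← integral_const_mul]
    congr 1 with y
    by_cases hy : y ∈ Ω
    · simp only [indicator_of_mem hy, smul_eq_mul]
      field_simp
    · simp [indicator_of_notMem hy]
  · exact Eventually.of_forall fun s => hi'.integrableOn
  · refine tendsto_const_nhds.congr' ?_
    filter_upwards [hpos] with s hs
    rw [integral_const_mul, integral_mollifier hs, inv_mul_cancel₀ hmass.ne']
  · filter_upwards [hpos] with s hs y hy
    by_contra h
    rw [Metric.mem_closedBall, not_le] at h
    exact hy (by simp [mollifier_eq_zero hs h])
  · filter_upwards [hpos] with s hs y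
    have hv : 0 < volume.real (Metric.ball (0 : Space n) 1) :=
      ENNReal.toReal_pos (Metric.measure_ball_pos _ _ one_pos).ne' measure_ball_lt_top.ne
    rw [abs_mul, abs_of_pos (by positivity), Measure.addHaar_real_closedBall _ _ hs.le,
      finrank_euclideanSpace_fin]
    calc (mollifierMass n)⁻¹ * |mollifier s x y| ≤ (mollifierMass n)⁻¹ * (M * (s ^ n)⁻¹) := by
          gcongr
          exact hM s hs x y
      _ = _ := by field_simp

end Weyl

/-! ### Interior gradient estimates for weakly harmonic functions -/

section InteriorEstimates

variable {n : ℕ} {Ω : Set (Space n)} {w : Space n → ℝ}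

theorem closedBall_subset_of_lt_infDist {s : ℝ} {x : Space n} (hs : s < Metric.infDist x Ωᶜ) :
    Metric.closedBall x s ⊆ Ω := by
  intro y hy
  by_contra h
  have := Metric.infDist_le_dist_of_mem (x := x) (show y ∈ Ωᶜ from h)
  rw [Metric.mem_closedBall, dist_comm] at hy
  linarith

theorem infDist_compl_pos (hΩ : IsOpen Ω) (hne : Ωᶜ.Nonempty) {x : Space n} (hx : x ∈ Ω) :
    0 < Metric.infDist x Ωᶜ :=
  (hΩ.isClosed_compl.notMem_iff_infDist_pos hne).1 (by simpa using hx)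

theorem mollify_eq_convolution (hΩ : MeasurableSet Ω) (w : Space n → ℝ) (s : ℝ) :
    mollify Ω w s = convolution (Ω.indicator w) (mollifier s 0)
      (ContinuousLinearMap.lsmul ℝ ℝ) volume := by
  funext x
  unfold mollify convolution
  rw [← integral_indicator hΩ]
  congr 1 with y
  by_cases hy : y ∈ Ω
  · simp [hy, ← mollifier_symm]
  · simp [hy]

theorem partialD_mollifier {s : ℝ} (hs : 0 < s) (x y : Space n) (k : Fin n) :
    partialD (mollifier s x) k y = -partialD (mollifier s 0) k (x - y) := by
  have h1 : HasFDerivAt (fun y : Space n => x - y) (-ContinuousLinearMap.id ℝ (Space n)) y :=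
    (hasFDerivAt_id y).const_sub x
  have h2 := ((isTest_mollifier hs (0 : Space n)).1.differentiable (by simp) (x - y)).hasFDerivAt
  have h3 := h2.comp y h1
  have e : mollifier s x = mollifier s 0 ∘ fun y => x - y := by
    funext z
    exact mollifier_symm s x z
  unfold partialD
  rw [e, h3.fderiv]
  simp

theorem contDiff_mollify (hΩ : MeasurableSet Ω) (hi : IntegrableOn w Ω) {s : ℝ} (hs : 0 < s) :
    ContDiff ℝ ∞ (mollify Ω w s) := by
  rw [mollify_eq_convolution hΩ]
  exact (isTest_mollifier hs 0).2.contDiff_convolution_right _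
    ((integrable_indicator_iff hΩ).2 hi).locallyIntegrable (isTest_mollifier hs 0).1

theorem partialD_mollify (hΩ : MeasurableSet Ω) (hi : IntegrableOn w Ω) {s : ℝ} (hs : 0 < s)
    (x : Space n) (k : Fin n) :
    partialD (mollify Ω w s) k x = -∫ y in Ω, w y * partialD (mollifier s x) k y := by
  have ht := isTest_mollifier hs (0 : Space n)
  have hloc := ((integrable_indicator_iff hΩ).2 hi).locallyIntegrable
  have h := ht.2.hasFDerivAt_convolution_right (ContinuousLinearMap.lsmul ℝ ℝ) hloc
    (ht.1.of_le (by simp)) x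
  rw [mollify_eq_convolution hΩ]
  unfold partialD
  rw [h.fderiv, convolution_precompR_apply _ hloc (ht.2.fderiv ℝ)
    (ht.1.continuous_fderiv (by simp))]
  unfold convolution
  rw [← integral_neg, ← integral_indicator hΩ]
  congr 1 with y
  by_cases hy : y ∈ Ω
  · have := partialD_mollifier hs x y k
    unfold partialD at this
    simp only [hy, indicator_of_mem, this]
    simp
  · simp [hy]

/-- A weakly harmonic function has a continuously differentiable representative, whose gradient is
given by an integral over any ball contained in the domain. -/
theorem WeaklyHarmonic.exists_representative (hw : WeaklyHarmonic Ω w) (hn : 0 < n)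
    (hΩ : IsOpen Ω) (hne : Ωᶜ.Nonempty) (hi : IntegrableOn w Ω) :
    ∃ p, IsC1On Ω p ∧ p =ᵐ[volume.restrict Ω] w ∧ ∀ x ∈ Ω, ∀ s, 0 < s → s < Metric.infDist x Ωᶜ →
      ∀ k, partialD p k x =
        -((mollifierMass n)⁻¹ * ∫ y in Ω, w y * partialD (mollifier s x) k y) := by
  classical
  have hm := hΩ.measurableSet
  have hmass := mollifierMass_pos hn
  have heq : ∀ x, ∀ a b, 0 < a → 0 < b → a < Metric.infDist x Ωᶜ → b < Metric.infDist x Ωᶜ →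
      mollify Ω w a x = mollify Ω w b x := by
    intro x a b ha hb ha' hb'
    rcases le_total a b with h | h
    · exact (hw.mollify_eq hi ha h (closedBall_subset_of_lt_infDist hb')).symm
    · exact hw.mollify_eq hi hb h (closedBall_subset_of_lt_infDist ha')
  -- The scale dist/2 varies with x, but mollification does not depend on the admissible scale. Near
  -- each point p therefore agrees with a mollification at a fixed scale, which is smooth.
  set p : Space n → ℝ := Ω.indicator
    fun x => (mollifierMass n)⁻¹ * mollify Ω w (Metric.infDist x Ωᶜ / 2) x with hp
  have hloc : ∀ x ∈ Ω, ∀ s, 0 < s → s < Metric.infDist x Ωᶜ →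
      p =ᶠ[𝓝 x] fun z => (mollifierMass n)⁻¹ * mollify Ω w s z := by
    intro x hx s hs hsx
    have ho : IsOpen {z | s < Metric.infDist z Ωᶜ} :=
      isOpen_lt continuous_const (Metric.continuous_infDist_pt _)
    filter_upwards [hΩ.mem_nhds hx, ho.mem_nhds hsx] with z hz hsz
    have hd := infDist_compl_pos hΩ hne hz
    rw [hp, indicator_of_mem hz, heq z _ s (by linarith) hs (by linarith) hsz]
  have hsmooth : ∀ s, 0 < s → ContDiff ℝ ∞ fun z => (mollifierMass n)⁻¹ * mollify Ω w s z :=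
    fun s hs => contDiff_const.mul (contDiff_mollify hm hi hs)
  have hscale : ∀ x ∈ Ω, 0 < Metric.infDist x Ωᶜ / 2 ∧
      Metric.infDist x Ωᶜ / 2 < Metric.infDist x Ωᶜ := fun x hx => by
    have hd := infDist_compl_pos hΩ hne hx
    constructor <;> linarith
  have hdiff : ∀ x ∈ Ω, DifferentiableAt ℝ p x := fun x hx =>
    ((hsmooth _ (hscale x hx).1).differentiable (by simp) x).congr_of_eventuallyEq
      (hloc x hx _ (hscale x hx).1 (hscale x hx).2)
  refine ⟨p, ⟨?_, hdiff, ?_⟩, ?_, ?_⟩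
  · have hc : ContinuousOn p Ω := fun x hx => (hdiff x hx).continuousAt.continuousWithinAt
    have := hc.measurable_piecewise (continuousOn_const (c := (0 : ℝ))) hm
    rw [show (fun _ : Space n => (0 : ℝ)) = 0 from rfl, piecewise_eq_indicator] at this
    rwa [hp, indicator_indicator, inter_self, ← hp] at this
  · intro x hx
    have e := (hloc x hx _ (hscale x hx).1 (hscale x hx).2).fderiv (𝕜 := ℝ)
    exact (((hsmooth _ (hscale x hx).1).continuous_fderiv (by simp)).continuousAt.congr
      e.symm).continuousWithinAt
  · filter_upwards [ae_tendsto_mollify hn hΩ hi, ae_restrict_mem hm] with x hx hxΩ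
    have hlim : Tendsto (fun s => mollify Ω w s x) (𝓝[>] 0) (𝓝 (mollifierMass n * p x)) := by
      refine tendsto_const_nhds.congr' ?_
      filter_upwards [self_mem_nhdsWithin,
        mem_nhdsWithin_of_mem_nhds (Iio_mem_nhds (infDist_compl_pos hΩ hne hxΩ))] with s hs hs'
      rw [(hloc x hxΩ s hs hs').eq_of_nhds]
      field_simp
    exact mul_left_cancel₀ hmass.ne' (tendsto_nhds_unique hlim hx)
  · intro x hx s hs hsx k
    have e := (hloc x hx s hs hsx).fderiv_eq (𝕜 := ℝ)
    unfold partialD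
    rw [e, fderiv_const_mul ((contDiff_mollify hm hi hs).differentiable (by simp) x)]
    have := partialD_mollify hm hi hs x k
    unfold partialD at this
    simp only [smul_apply, this, smul_eq_mul]
    ring

theorem norm_fderiv_le_sum (p : Space n → ℝ) (x : Space n) :
    ‖fderiv ℝ p x‖ ≤ ∑ k, |partialD p k x| := by
  refine ContinuousLinearMap.opNorm_le_bound _ (Finset.sum_nonneg fun _ _ => abs_nonneg _)
    fun v => ?_
  have hv : v = ∑ k, v k • (EuclideanSpace.single k (1 : ℝ) : Space n) := by
    ext i
    simp [Finset.sum_apply, Pi.single_apply]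
  calc ‖fderiv ℝ p x v‖ = ‖∑ k, v k • partialD p k x‖ := by
        conv_lhs => rw [hv]
        rw [map_sum]
        simp only [map_smul]
        rfl
    _ ≤ ∑ k, ‖v k • partialD p k x‖ := norm_sum_le _ _
    _ ≤ ∑ k, |partialD p k x| * ‖v‖ := by
        refine Finset.sum_le_sum fun k _ => ?_
        rw [norm_smul, mul_comm, Real.norm_eq_abs]
        gcongr
        exact PiLp.norm_apply_le v k
    _ = _ := by rw [Finset.sum_mul]

theorem sq_integral_le {α : Type*} [MeasurableSpace α] {μ : Measure α} [IsFiniteMeasure μ]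
    {f : α → ℝ} (hf : Integrable f μ) (hf2 : Integrable (fun x => f x ^ 2) μ) :
    (∫ x, f x ∂μ) ^ 2 ≤ μ.real univ * ∫ x, f x ^ 2 ∂μ := by
  set V := μ.real univ
  set I := ∫ x, f x ∂μ with hI
  have hV : 0 ≤ V := measureReal_nonneg
  rcases hV.eq_or_lt with h0 | hpos
  · have : μ = 0 := by
      have h : μ.real univ = 0 := h0.symm
      rwa [measureReal_eq_zero_iff, Measure.measure_univ_eq_zero] at h
    simp [hI, this]
  · have h := integral_nonneg (μ := μ) (f := fun x => (V * f x - I) ^ 2) fun x => sq_nonneg _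
    have e : ∀ x, (V * f x - I) ^ 2 = V ^ 2 * f x ^ 2 - (2 * V * I * f x - I ^ 2) := fun x => by ring
    simp_rw [e] at h
    have i1 : Integrable (fun x => 2 * V * I * f x - I ^ 2) μ :=
      (hf.const_mul _).sub (integrable_const _)
    rw [integral_sub (hf2.const_mul _) i1,
      integral_sub (hf.const_mul _) (integrable_const _), integral_const_mul, integral_const_mul,
      integral_const, smul_eq_mul, ← hI] at h
    have h' : 0 ≤ V * (V * (∫ x, f x ^ 2 ∂μ) - I ^ 2) := by
      refine h.trans (le_of_eq ?_)
      ring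
    have := nonneg_of_mul_nonneg_right h' hpos
    linarith

/-- Write d for the distance to the complement and swap the integrals. If |x - y| ≤ d(x)/2, then
d(x)/2 ≤ d(y), so x lies in the ball of radius d(y) about y, and d(y)/3 ≤ d(x)/2. The kernel is then
at most (d(y)/3)⁻ⁿ on that ball, whence 3ⁿ times the volume of the unit ball. -/
theorem lintegral_whitney_le (hΩ : IsOpen Ω) (hne : Ωᶜ.Nonempty) {T : Space n → ℝ≥0∞}
    (hT : Measurable T) :
    ∫⁻ x in Ω, ENNReal.ofReal (((Metric.infDist x Ωᶜ / 2) ^ n)⁻¹) *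
        ∫⁻ y in Metric.closedBall x (Metric.infDist x Ωᶜ / 2), T y ≤
      ENNReal.ofReal (3 ^ n) * volume (Metric.ball (0 : Space n) 1) * ∫⁻ y in Ω, T y := by
  have hm := hΩ.measurableSet
  have hdc : Continuous fun x : Space n => Metric.infDist x Ωᶜ := Metric.continuous_infDist_pt _
  set W : Set (Space n × Space n) :=
    {z | z.1 ∈ Ω ∧ dist z.2 z.1 ≤ Metric.infDist z.1 Ωᶜ / 2} with hW
  have hWm : MeasurableSet W := by
    have h1 : MeasurableSet {z : Space n × Space n | dist z.2 z.1 ≤ Metric.infDist z.1 Ωᶜ / 2} :=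
      measurableSet_le (by fun_prop) (by fun_prop)
    exact (measurable_fst hm).inter h1
  set k : Space n × Space n → ℝ≥0∞ := W.indicator
    fun z => ENNReal.ofReal (((Metric.infDist z.1 Ωᶜ / 2) ^ n)⁻¹) * T z.2 with hk
  have hkm : Measurable k := by
    refine Measurable.indicator ?_ hWm
    fun_prop
  have e1 : ∫⁻ x in Ω, ENNReal.ofReal (((Metric.infDist x Ωᶜ / 2) ^ n)⁻¹) *
        ∫⁻ y in Metric.closedBall x (Metric.infDist x Ωᶜ / 2), T y = ∫⁻ x, ∫⁻ y, k (x, y) := by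
    rw [← lintegral_indicator hm]
    congr 1 with x
    by_cases hx : x ∈ Ω
    · rw [indicator_of_mem hx, ← lintegral_const_mul _ hT,
        ← lintegral_indicator Metric.isClosed_closedBall.measurableSet]
      congr 1 with y
      by_cases hy : y ∈ Metric.closedBall x (Metric.infDist x Ωᶜ / 2)
      · rw [indicator_of_mem hy, hk, indicator_of_mem (show (x, y) ∈ W from ⟨hx, hy⟩)]
      · rw [indicator_of_notMem hy, hk, indicator_of_notMem (fun h => hy h.2)]
    · rw [indicator_of_notMem hx]
      symm
      rw [lintegral_eq_zero_iff (by fun_prop)]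
      refine Eventually.of_forall fun y => ?_
      exact indicator_of_notMem (fun h : (x, y) ∈ W => hx h.1) _
  rw [e1, lintegral_lintegral_swap (f := fun x y => k (x, y)) hkm.aemeasurable,
    ← lintegral_const_mul _ hT, ← lintegral_indicator hm]
  refine lintegral_mono fun y => ?_
  by_cases hy : y ∈ Ω
  swap
  · rw [indicator_of_notMem hy, nonpos_iff_eq_zero, lintegral_eq_zero_iff (by fun_prop)]
    refine Eventually.of_forall fun x => ?_
    refine indicator_of_notMem (s := W) (a := (x, y)) ?_ _
    rintro ⟨h1, h2⟩
    have hd := infDist_compl_pos hΩ hne h1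
    exact hy (closedBall_subset_of_lt_infDist (s := Metric.infDist x Ωᶜ / 2) (x := x)
      (by simp only at hd; linarith) h2)
  rw [indicator_of_mem hy]
  set d := Metric.infDist y Ωᶜ
  have hd : 0 < d := infDist_compl_pos hΩ hne hy
  have hle : ∀ x, k (x, y) ≤ (Metric.closedBall y d).indicator
      (fun _ => ENNReal.ofReal ((d / 3) ^ n)⁻¹ * T y) x := by
    intro x
    by_cases hx : (x, y) ∈ W
    · have h1 : dist y x ≤ Metric.infDist x Ωᶜ / 2 := hx.2
      have h2 : Metric.infDist x Ωᶜ ≤ d + dist x y := Metric.infDist_le_infDist_add_dist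
      have h3 : d ≤ Metric.infDist x Ωᶜ + dist y x := Metric.infDist_le_infDist_add_dist
      rw [dist_comm x y] at h2
      have h4 : x ∈ Metric.closedBall y d := by
        rw [Metric.mem_closedBall, dist_comm]
        linarith
      rw [indicator_of_mem h4, hk, indicator_of_mem hx]
      have h5 : d / 3 ≤ Metric.infDist x Ωᶜ / 2 := by linarith
      simp only
      gcongr ENNReal.ofReal ?_ * _
      exact inv_anti₀ (by positivity) (pow_le_pow_left₀ (by positivity) h5 n)
    · rw [hk, indicator_of_notMem hx]
      exact zero_le
  refine (lintegral_mono hle).trans ?_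
  rw [lintegral_indicator Metric.isClosed_closedBall.measurableSet, lintegral_const]
  simp only [MeasurableSet.univ, Measure.restrict_apply, univ_inter]
  rw [Measure.addHaar_closedBall _ _ hd.le, finrank_euclideanSpace_fin]
  refine le_of_eq ?_
  have : ENNReal.ofReal ((d / 3) ^ n)⁻¹ * ENNReal.ofReal (d ^ n) = ENNReal.ofReal (3 ^ n) := by
    rw [← ENNReal.ofReal_mul (by positivity)]
    congr 1
    rw [div_pow]
    field_simp
  rw [← this]
  ring

/-- A weakly harmonic function whose weak gradient is, locally, a combination of first derivatives
of square integrable functions is bounded by these functions in the weighted energy. -/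
theorem exists_weightedEnergy_le (hn : 0 < n) : ∃ C : ℝ≥0∞, C ≠ ⊤ ∧
    ∀ (Ω : Set (Space n)), IsOpen Ω → Ωᶜ.Nonempty → volume Ω ≠ ⊤ →
      ∀ w S : Space n → ℝ, IntegrableOn w Ω → WeaklyHarmonic Ω w → Measurable S →
        IntegrableOn (fun x => S x ^ 2) Ω →
        (∀ ψ k, IsTest ψ → tsupport ψ ⊆ Ω →
          |∫ x in Ω, w x * partialD ψ k x| ≤ ∫ x in Ω, |S x| * ∑ j, |partialD ψ j x|) →
        ∃ p, IsC1On Ω p ∧ p =ᵐ[volume.restrict Ω] w ∧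
          weightedEnergy Ω p ≤ C * ∫⁻ x in Ω, ENNReal.ofReal (S x ^ 2) := by
  obtain ⟨M, hM0, hM⟩ := exists_partialD_mollifier_bound n
  have hmass := mollifierMass_pos hn
  set v := volume.real (Metric.ball (0 : Space n) 1) with hv
  set C₁ := n * ((mollifierMass n)⁻¹ * (n * M)) with hC₁
  have hC₁0 : 0 ≤ C₁ := by positivity
  refine ⟨ENNReal.ofReal (4 * C₁ ^ 2 * v) *
    (ENNReal.ofReal (3 ^ n) * volume (Metric.ball (0 : Space n) 1)), ?_, ?_⟩
  · have := (measure_ball_lt_top (μ := volume) (x := (0 : Space n)) (r := 1)).ne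
    finiteness
  intro Ω hΩ hne hvol w S hi hw hS hS2 hbound
  obtain ⟨p, hp, hpw, hgrad⟩ := hw.exists_representative hn hΩ hne hi
  refine ⟨p, hp, hpw, ?_⟩
  have hm := hΩ.measurableSet
  have : IsFiniteMeasure (volume.restrict Ω) := ⟨by simpa using hvol.lt_top⟩
  have hS1 : IntegrableOn (fun x => |S x|) Ω := by
    have h2 : MemLp S 2 (volume.restrict Ω) :=
      (memLp_two_iff_integrable_sq hS.aestronglyMeasurable).2 hS2
    exact (h2.integrable (by norm_num)).abs
  -- At scale s = d/2 the gradient is a pairing of w with a derivative of the mollifier, hence at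
  -- most a multiple of s^{-(n+1)} ∫_B |S|. Cauchy–Schwarz on the ball B contributes sⁿ, and d² =
  -- 4s² leaves the factor s⁻ⁿ. One n in C₁ counts components of the gradient, the other the
  -- derivatives in the hypothesis.
  have hpt : ∀ x ∈ Ω, ENNReal.ofReal (Metric.infDist x Ωᶜ ^ 2 * ‖fderiv ℝ p x‖ ^ 2) ≤
      ENNReal.ofReal (4 * C₁ ^ 2 * v) * (ENNReal.ofReal (((Metric.infDist x Ωᶜ / 2) ^ n)⁻¹) *
        ∫⁻ y in Metric.closedBall x (Metric.infDist x Ωᶜ / 2), ENNReal.ofReal (S y ^ 2)) := by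
    intro x hx
    set d := Metric.infDist x Ωᶜ with hd
    have hd0 : 0 < d := infDist_compl_pos hΩ hne hx
    set s := d / 2 with hs
    have hs0 : 0 < s := by positivity
    have hsd : s < d := by linarith
    set B := Metric.closedBall x s with hB
    have hBm : MeasurableSet B := Metric.isClosed_closedBall.measurableSet
    have hBΩ : B ⊆ Ω := closedBall_subset_of_lt_infDist hsd
    have hk : ∀ k, |partialD p k x| ≤
        (mollifierMass n)⁻¹ * (n * M * (s ^ (n + 1))⁻¹ * ∫ y in B, |S y|) := by
      intro k
      rw [hgrad x hx s hs0 hsd k, abs_neg, abs_mul, abs_of_pos (inv_pos.2 hmass)]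
      gcongr
      refine (hbound _ k (isTest_mollifier hs0 x)
        ((tsupport_mollifier_subset hs0 x).trans hBΩ)).trans ?_
      have hz : ∀ y, y ∉ B → ∀ j, partialD (mollifier s x) j y = 0 := by
        intro y hy j
        have : y ∉ tsupport (mollifier s x) := fun h => hy (tsupport_mollifier_subset hs0 x h)
        unfold partialD
        rw [fderiv_of_notMem_tsupport ℝ this]
        simp
      have e : ∫ y in Ω, |S y| * ∑ j, |partialD (mollifier s x) j y| =
          ∫ y in B, |S y| * ∑ j, |partialD (mollifier s x) j y| := by
        rw [setIntegral_eq_of_subset_of_forall_sdiff_eq_zero hm hBΩ]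
        intro y hy
        simp [hz y hy.2]
      rw [e, ← integral_const_mul]
      refine integral_mono_of_nonneg (Eventually.of_forall fun y => by positivity)
        ((hS1.mono_set hBΩ).const_mul _) (Eventually.of_forall fun y => ?_)
      simp only
      rw [mul_comm (|S y|)]
      gcongr
      calc ∑ j, |partialD (mollifier s x) j y| ≤ ∑ _j : Fin n, M * (s ^ (n + 1))⁻¹ :=
            Finset.sum_le_sum fun j _ => hM s hs0 x y j
        _ = _ := by simp; ring
    have hgradle : ‖fderiv ℝ p x‖ ≤ C₁ * (s ^ (n + 1))⁻¹ * ∫ y in B, |S y| := by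
      refine (norm_fderiv_le_sum p x).trans ((Finset.sum_le_sum fun k _ => hk k).trans ?_)
      simp only [Finset.sum_const, Finset.card_univ, Fintype.card_fin, nsmul_eq_mul, hC₁]
      exact le_of_eq (by ring)
    have hcs : (∫ y in B, |S y|) ^ 2 ≤ s ^ n * v * ∫ y in B, S y ^ 2 := by
      have : IsFiniteMeasure (volume.restrict B) :=
        ⟨by simpa using measure_closedBall_lt_top⟩
      have h2 : Integrable (fun y => |S y| ^ 2) (volume.restrict B) := by
        simp only [sq_abs]
        exact hS2.mono_set hBΩ
      have h := sq_integral_le (hS1.mono_set hBΩ) h2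
      simp only [sq_abs] at h
      rwa [measureReal_restrict_apply_univ, hB, Measure.addHaar_real_closedBall _ _ hs0.le,
        finrank_euclideanSpace_fin] at h
    have hnn : 0 ≤ ∫ y in B, |S y| := integral_nonneg fun y => abs_nonneg _
    have hreal : d ^ 2 * ‖fderiv ℝ p x‖ ^ 2 ≤
        4 * C₁ ^ 2 * v * ((s ^ n)⁻¹ * ∫ y in B, S y ^ 2) := by
      calc d ^ 2 * ‖fderiv ℝ p x‖ ^ 2 ≤ d ^ 2 * (C₁ * (s ^ (n + 1))⁻¹ * ∫ y in B, |S y|) ^ 2 := by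
            gcongr
        _ = d ^ 2 * (C₁ * (s ^ (n + 1))⁻¹) ^ 2 * (∫ y in B, |S y|) ^ 2 := by ring
        _ ≤ d ^ 2 * (C₁ * (s ^ (n + 1))⁻¹) ^ 2 * (s ^ n * v * ∫ y in B, S y ^ 2) := by gcongr
        _ = _ := by
            have : d = 2 * s := by rw [hs]; ring
            rw [this]
            field_simp
            ring
    refine (ENNReal.ofReal_le_ofReal hreal).trans (le_of_eq ?_)
    rw [ENNReal.ofReal_mul (p := 4 * C₁ ^ 2 * v) (by positivity),
      ENNReal.ofReal_mul (p := (s ^ n)⁻¹) (by positivity),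
      ofReal_integral_eq_lintegral_ofReal (hS2.mono_set hBΩ)
        (Eventually.of_forall fun y => sq_nonneg _)]
  refine (setLIntegral_mono' hm hpt).trans ?_
  rw [lintegral_const_mul' _ _ ENNReal.ofReal_ne_top, mul_assoc (ENNReal.ofReal (4 * C₁ ^ 2 * v))]
  exact mul_le_mul_right (lintegral_whitney_le hΩ hne (hS.pow_const 2).ennreal_ofReal) _

end InteriorEstimates

/-! ### Integration by parts for test functions -/

section TestFunctions

variable {n : ℕ} {Ω : Set (Space n)}

theorem IsTest.partialD {φ : Space n → ℝ} (h : IsTest φ) (j : Fin n) : IsTest (partialD φ j) :=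
  ⟨(h.1.fderiv_right (m := ∞) (by simp)).clm_apply contDiff_const, h.partialD_hasCompactSupport j⟩

theorem tsupport_partialD_subset (φ : Space n → ℝ) (j : Fin n) :
    tsupport (partialD φ j) ⊆ tsupport φ :=
  tsupport_fderiv_apply_subset ℝ _

theorem IsTest.memLp {φ : Space n → ℝ} (h : IsTest φ) (Ω : Set (Space n)) :
    MemLp φ 2 (volume.restrict Ω) :=
  (h.1.continuous.memLp_of_hasCompactSupport h.2).restrict Ω

theorem IsTest.integrable_mul {φ ψ : Space n → ℝ} (hφ : IsTest φ) (hψ : IsTest ψ) :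
    Integrable fun x => φ x * ψ x :=
  (hφ.1.continuous.mul hψ.1.continuous).integrable_of_hasCompactSupport hφ.2.mul_right

theorem integral_mul_partialD {φ ψ : Space n → ℝ} (hφ : IsTest φ) (hψ : IsTest ψ) (k : Fin n) :
    ∫ x, φ x * partialD ψ k x = -∫ x, partialD φ k x * ψ x :=
  integral_mul_fderiv_eq_neg_fderiv_mul_of_integrable ((hφ.partialD k).integrable_mul hψ)
    (hφ.integrable_mul (hψ.partialD k)) (hφ.integrable_mul hψ)
    (fun x _ => hφ.1.differentiable (by simp) x) (fun x _ => hψ.1.differentiable (by simp) x)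

theorem partialD_comm {φ : Space n → ℝ} (hφ : IsTest φ) (j k : Fin n) :
    partialD (partialD φ j) k = partialD (partialD φ k) j := by
  funext x
  have hd : DifferentiableAt ℝ (fderiv ℝ φ) x :=
    (hφ.1.fderiv_right (m := ∞) (by simp)).differentiable (by simp) x
  have hs : IsSymmSndFDerivAt ℝ φ x :=
    hφ.1.contDiffAt.isSymmSndFDerivAt (by
      rw [minSmoothness_of_isRCLikeNormedField]
      exact WithTop.coe_le_coe.2 le_top)
  have e : ∀ a b : Fin n, partialD (partialD φ a) b x =
      fderiv ℝ (fderiv ℝ φ) x (EuclideanSpace.single b 1) (EuclideanSpace.single a 1) := by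
    intro a b
    have h := hd.hasFDerivAt.clm_apply (hasFDerivAt_const (EuclideanSpace.single a (1 : ℝ)) x)
    have e' : partialD φ a = fun y => fderiv ℝ φ y (EuclideanSpace.single a 1) := rfl
    rw [e', ERFluid.partialD, h.fderiv]
    simp
  rw [e, e]
  exact hs _ _

theorem setIntegral_mul_of_tsupport {ψ : Space n → ℝ} (hψ : tsupport ψ ⊆ Ω) (g : Space n → ℝ) :
    ∫ x in Ω, g x * ψ x = ∫ x, g x * ψ x :=
  setIntegral_eq_integral_of_forall_compl_eq_zero fun x hx => by
    rw [image_eq_zero_of_notMem_tsupport fun h => hx (hψ h), mul_zero]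

/-- Both sides equal minus the integral of φ against the mixed second derivative of ψ. Only ψ needs
support in Ω, so φ may be nonzero at the boundary. -/
theorem setIntegral_partialD_mul_partialD_comm {φ ψ : Space n → ℝ} (hφ : IsTest φ)
    (hψ : IsTest ψ) (hs : tsupport ψ ⊆ Ω) (j k : Fin n) :
    ∫ x in Ω, partialD φ j x * partialD ψ k x = ∫ x in Ω, partialD φ k x * partialD ψ j x := by
  rw [setIntegral_mul_of_tsupport ((tsupport_partialD_subset ψ k).trans hs),
    setIntegral_mul_of_tsupport ((tsupport_partialD_subset ψ j).trans hs)]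
  have h1 := integral_mul_partialD hφ (hψ.partialD k) j
  have h2 := integral_mul_partialD hφ (hψ.partialD j) k
  rw [partialD_comm hψ k j] at h1
  linarith

end TestFunctions

/-! ### Splitting off the harmonic part of a gradient -/

section Helmholtz

variable {n : ℕ} {Ω : Set (Space n)}

/-- Square integrable matrix fields on `Ω`. -/
abbrev MatrixField (Ω : Set (Space n)) := PiLp 2 fun _ : Fin n × Fin n => L2 Ω

/-- The element of `MatrixField Ω` given by a family of functions. -/
def MatrixField.mk (F : Fin n → Fin n → Space n → ℝ)
    (hF : ∀ i j, MemLp (F i j) 2 (volume.restrict Ω)) : MatrixField Ω :=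
  WithLp.toLp 2 fun z => (hF z.1 z.2).toLp

theorem inner_toLp_left {f : Space n → ℝ} (hf : MemLp f 2 (volume.restrict Ω)) (v : L2 Ω) :
    ⟪hf.toLp, v⟫ = ∫ x in Ω, v x * f x := by
  rw [L2.inner_def]
  refine integral_congr_ae ?_
  filter_upwards [hf.coeFn_toLp] with x hx
  rw [hx]
  simp

theorem inner_toLp_toLp {f g : Space n → ℝ} (hf : MemLp f 2 (volume.restrict Ω))
    (hg : MemLp g 2 (volume.restrict Ω)) : ⟪hf.toLp, hg.toLp⟫ = ∫ x in Ω, f x * g x := by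
  rw [inner_toLp_left]
  refine integral_congr_ae ?_
  filter_upwards [hg.coeFn_toLp] with x hx
  rw [hx, mul_comm]

theorem MatrixField.inner_mk (F : Fin n → Fin n → Space n → ℝ)
    (hF : ∀ i j, MemLp (F i j) 2 (volume.restrict Ω)) (V : MatrixField Ω) :
    ⟪MatrixField.mk F hF, V⟫ = ∑ i, ∑ j, ⟪(hF i j).toLp, V (i, j)⟫ := by
  rw [PiLp.inner_apply, Fintype.sum_prod_type]
  rfl

/-- Gradients of test fields supported in `Ω`. -/
def testGradients (Ω : Set (Space n)) : Set (MatrixField Ω) :=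
  {V | ∃ ψ : Fin n → Space n → ℝ, ∃ hψ : ∀ i, IsTest (ψ i), (∀ i, tsupport (ψ i) ⊆ Ω) ∧
    V = MatrixField.mk (fun i j => partialD (ψ i) j) fun i j => ((hψ i).partialD j).memLp Ω}

/-- The closure of the gradients of test fields. -/
def potentials (Ω : Set (Space n)) : Submodule ℝ (MatrixField Ω) :=
  (Submodule.span ℝ (testGradients Ω)).topologicalClosure

theorem eq_zero_of_mem_potentials {ℓ : MatrixField Ω →L[ℝ] ℝ}
    (h : ∀ V ∈ testGradients Ω, ℓ V = 0) {V : MatrixField Ω} (hV : V ∈ potentials Ω) : ℓ V = 0 := by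
  have h1 : Submodule.span ℝ (testGradients Ω) ≤ LinearMap.ker (ℓ : MatrixField Ω →ₗ[ℝ] ℝ) :=
    Submodule.span_le.2 fun V hV => h V hV
  exact (Submodule.topologicalClosure_minimal _ h1 ℓ.isClosed_ker hV : _)

/-- The deviator-like combination `2 ε_ij(φ) - δ_ij div φ`. -/
def stressLike (φ : Fin n → Space n → ℝ) (i j : Fin n) (x : Space n) : ℝ :=
  (partialD (φ i) j x + partialD (φ j) i x) - if i = j then ∑ k, partialD (φ k) k x else 0

theorem memLp_stressLike {φ : Fin n → Space n → ℝ} (hφ : ∀ i, IsTest (φ i)) (i j : Fin n) :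
    MemLp (stressLike φ i j) 2 (volume.restrict Ω) := by
  refine ((((hφ i).partialD j).memLp Ω).add (((hφ j).partialD i).memLp Ω)).sub ?_
  by_cases hij : i = j
  · simp only [hij, if_true]
    exact memLp_finsetSum _ fun k _ => ((hφ k).partialD k).memLp Ω
  · simp [hij]

/-- Decomposition of the gradient of a test field into a limit of gradients of test fields
supported in `Ω`, bounded by the strain of the field, and a harmonic gradient. -/
theorem exists_helmholtz (φ : Fin n → Space n → ℝ) (hφ : ∀ i, IsTest (φ i)) :
    ∃ V W : Fin n → Fin n → L2 Ω,
      (∀ i j, partialD (φ i) j =ᵐ[volume.restrict Ω] fun x => V i j x + W i j x) ∧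
      (∀ i j, ‖V i j‖ₑ ≤ ∑ a, ∑ b, eLpNorm (stressLike φ a b) 2 (volume.restrict Ω)) ∧
      (∀ ψ, IsTest ψ → tsupport ψ ⊆ Ω → ∀ i j k,
        ∫ x in Ω, W i j x * partialD ψ k x = ∫ x in Ω, W i k x * partialD ψ j x) ∧
      (∀ ψ, IsTest ψ → tsupport ψ ⊆ Ω → ∀ i, ∑ j, ∫ x in Ω, W i j x * partialD ψ j x = 0) := by
  set hG := fun i j => ((hφ i).partialD j).memLp Ω
  set G : MatrixField Ω := MatrixField.mk (fun i j => partialD (φ i) j) hG with hGdef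
  have hcomplete : (potentials Ω).HasOrthogonalProjection := by
    have : CompleteSpace (potentials Ω) :=
      (Submodule.isClosed_topologicalClosure _).completeSpace_coe
    infer_instance
  -- V is the orthogonal projection of ∇φ onto the closure of gradients of test fields supported in
  -- Ω, and W is the remainder.
  obtain ⟨V, hV, W, hW, hVW⟩ := Submodule.exists_add_mem_mem_orthogonal (K := potentials Ω) G
  have hcomm : ∀ (f ψ : Space n → ℝ) (hf : IsTest f) (hψ : IsTest ψ), tsupport ψ ⊆ Ω →
      ∀ j k, ⟪((hψ.partialD k).memLp Ω).toLp, ((hf.partialD j).memLp Ω).toLp⟫ =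
        ⟪((hψ.partialD j).memLp Ω).toLp, ((hf.partialD k).memLp Ω).toLp⟫ := by
    intro f ψ hf hψ hs j k
    rw [real_inner_comm, inner_toLp_toLp, real_inner_comm, inner_toLp_toLp]
    exact setIntegral_partialD_mul_partialD_comm hf hψ hs j k
  set P : Fin n → Fin n → MatrixField Ω →L[ℝ] L2 Ω := fun i j =>
    PiLp.proj 2 (fun _ : Fin n × Fin n => L2 Ω) (i, j) with hP
  have hPa : ∀ i j (U : MatrixField Ω), P i j U = U (i, j) := fun i j U => rfl
  refine ⟨fun i j => V (i, j), fun i j => W (i, j), fun i j => ?_, fun i j => ?_, ?_, ?_⟩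
  · have e : (hG i j).toLp = V (i, j) + W (i, j) := congrArg (fun U : MatrixField Ω => U (i, j)) hVW
    filter_upwards [(hG i j).coeFn_toLp, Lp.coeFn_add (V (i, j)) (W (i, j))] with x h1 h2
    rw [← h1, e, h2, Pi.add_apply]
  · set g : Fin n → Fin n → L2 Ω := fun i j => (hG i j).toLp with hg
    set D : Fin n → Fin n → L2 Ω :=
      fun i j => (g i j + g j i) - if i = j then ∑ k, g k k else 0 with hD
    have hDs : ∀ i j, D i j = (memLp_stressLike (Ω := Ω) hφ i j).toLp := by
      intro i j
      have hsum : MemLp (fun x => ∑ k, partialD (φ k) k x) 2 (volume.restrict Ω) :=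
        memLp_finsetSum _ fun k _ => hG k k
      have es : ∑ k, g k k = hsum.toLp := by
        refine (Lp.ext ?_)
        have hc : ∀ᵐ x ∂(volume.restrict Ω), ∀ k, (g k k : Space n → ℝ) x = partialD (φ k) k x :=
          ae_all_iff.2 fun k => (hG k k).coeFn_toLp
        filter_upwards [hsum.coeFn_toLp, hc, Lp.coeFn_finsetSum Finset.univ fun k => g k k]
          with x h1 h2 h3
        rw [h1, h3]
        simp [h2]
      refine Lp.ext ?_
      by_cases hij : i = j
      · subst hij
        simp only [hD, if_true, es]
        filter_upwards [(memLp_stressLike (Ω := Ω) hφ i i).coeFn_toLp, hsum.coeFn_toLp,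
          Lp.coeFn_sub (g i i + g i i) hsum.toLp, Lp.coeFn_add (g i i) (g i i),
          (hG i i).coeFn_toLp] with x h1 h2 h3 h4 h5
        rw [h1, h3, Pi.sub_apply, h2, h4, Pi.add_apply, h5]
        simp [stressLike]
      · simp only [hD, hij, if_false, sub_zero]
        filter_upwards [(memLp_stressLike (Ω := Ω) hφ i j).coeFn_toLp,
          Lp.coeFn_add (g i j) (g j i), (hG i j).coeFn_toLp, (hG j i).coeFn_toLp]
          with x h1 h2 h3 h4
        rw [h1, h2, Pi.add_apply, h3, h4]
        simp [stressLike, hij]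
    -- For V = ∇ψ this is ∫ ∂_a φ_b ∂_b ψ_a = ∫ ∂_b φ_b ∂_a ψ_a, two integrations by parts that move
    -- no derivative onto the boundary. Both sides are continuous in V, so it passes to the closure.
    have horth : ∑ a, ∑ b, ⟪g b a, V (a, b)⟫ = ∑ a, ∑ k, ⟪g k k, V (a, a)⟫ := by
      have := eq_zero_of_mem_potentials
        (ℓ := (∑ a, ∑ b, (innerSL ℝ (g b a)).comp (P a b)) -
          ∑ a, ∑ k, (innerSL ℝ (g k k)).comp (P a a)) ?_ hV
      · simpa [sub_eq_zero, hPa] using this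
      · rintro _ ⟨ψ, hψ, hs, rfl⟩
        simp only [sub_apply, sum_apply, ContinuousLinearMap.comp_apply, hPa, innerSL_apply_apply]
        rw [sub_eq_zero]
        refine Finset.sum_congr rfl fun a _ => Finset.sum_congr rfl fun b _ => ?_
        rw [real_inner_comm, real_inner_comm _ (g b b)]
        exact hcomm (φ b) (ψ a) (hφ b) (hψ a) (hs a) a b
    -- Start from ‖V‖² = ⟪∇φ, V⟫. By `horth` the transposed gradient and the divergence terms have
    -- equal pairings with V, so one may be added and the other subtracted. This replaces ∇φ by the
    -- strain combination D.
    have hVV : ‖V‖ ^ 2 = ∑ a, ∑ b, ⟪D a b, V (a, b)⟫ := by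
      have h1 : ⟪G, V⟫ = ‖V‖ ^ 2 := by
        rw [hVW, inner_add_left, real_inner_self_eq_norm_sq,
          Submodule.inner_left_of_mem_orthogonal hV hW, add_zero]
      have hite : ∀ a b, ⟪(if a = b then ∑ k, g k k else 0 : L2 Ω), V (a, b)⟫ =
          if a = b then ∑ k, ⟪g k k, V (a, a)⟫ else 0 := by
        intro a b
        by_cases hab : a = b
        · subst hab
          simp [sum_inner]
        · simp [hab]
      rw [← h1, hGdef, MatrixField.inner_mk]
      simp only [hD, inner_sub_left, inner_add_left, hite, Finset.sum_sub_distrib,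
        Finset.sum_add_distrib, horth, Finset.sum_ite_eq, Finset.mem_univ, if_true]
      simp [hg]
    have hVle : ‖V‖ ≤ ∑ a, ∑ b, ‖D a b‖ := by
      have h1 : ‖V‖ ^ 2 ≤ (∑ a, ∑ b, ‖D a b‖) * ‖V‖ := by
        rw [hVV, Finset.sum_mul]
        refine Finset.sum_le_sum fun a _ => ?_
        rw [Finset.sum_mul]
        refine Finset.sum_le_sum fun b _ => (real_inner_le_norm _ _).trans ?_
        gcongr
        exact PiLp.norm_apply_le V (a, b)
      rcases (norm_nonneg V).eq_or_lt with h0 | h0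
      · rw [← h0]
        positivity
      · rw [sq] at h1
        exact le_of_mul_le_mul_right h1 h0
    calc ‖V (i, j)‖ₑ = ENNReal.ofReal ‖V (i, j)‖ := (ofReal_norm _).symm
      _ ≤ ENNReal.ofReal (∑ a, ∑ b, ‖D a b‖) :=
          ENNReal.ofReal_le_ofReal ((PiLp.norm_apply_le V (i, j)).trans hVle)
      _ = ∑ a, ∑ b, ‖D a b‖ₑ := by
          rw [ENNReal.ofReal_sum_of_nonneg fun a _ => by positivity]
          refine Finset.sum_congr rfl fun a _ => ?_
          rw [ENNReal.ofReal_sum_of_nonneg fun b _ => by positivity]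
          exact Finset.sum_congr rfl fun b _ => ofReal_norm _
      _ = _ := by
          refine Finset.sum_congr rfl fun a _ => Finset.sum_congr rfl fun b _ => ?_
          rw [hDs, Lp.enorm_toLp]
  · intro ψ hψ hs i j k
    rw [← inner_toLp_left ((hψ.partialD k).memLp Ω), ← inner_toLp_left ((hψ.partialD j).memLp Ω)]
    -- This functional tests the curl of row i. It vanishes on ∇φ and on every gradient of a test
    -- field, hence on V and on W = ∇φ - V.
    set ℓ : MatrixField Ω →L[ℝ] ℝ :=
      (innerSL ℝ ((hψ.partialD k).memLp Ω).toLp).comp (P i j) -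
        (innerSL ℝ ((hψ.partialD j).memLp Ω).toLp).comp (P i k) with hℓ
    have hℓV : ℓ V = 0 := by
      refine eq_zero_of_mem_potentials ?_ hV
      rintro _ ⟨χ, hχ, -, rfl⟩
      rw [hℓ, sub_apply, sub_eq_zero]
      exact hcomm (χ i) ψ (hχ i) hψ hs j k
    have hℓG : ℓ G = 0 := by
      rw [hℓ, sub_apply, sub_eq_zero]
      exact hcomm (φ i) ψ (hφ i) hψ hs j k
    rw [hVW, map_add, hℓV, zero_add, hℓ, sub_apply, sub_eq_zero] at hℓG
    exact hℓG
  · intro ψ hψ hs i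
    -- Orthogonality of W to the gradient of the field whose only nonzero component is ψ, in slot i,
    -- says that row i of W is divergence free.
    have hΨ : ∀ a, IsTest ((Pi.single i ψ : Fin n → Space n → ℝ) a) := by
      intro a
      by_cases ha : a = i
      · subst ha
        simpa using hψ
      · rw [Pi.single_eq_of_ne ha]
        exact ⟨contDiff_const, HasCompactSupport.zero⟩
    have hmem : MatrixField.mk (fun a j => partialD ((Pi.single i ψ : Fin n → Space n → ℝ) a) j)
        (fun a j => ((hΨ a).partialD j).memLp Ω) ∈ potentials Ω := by
      refine Submodule.le_topologicalClosure _ (Submodule.subset_span ⟨_, hΨ, fun a => ?_, rfl⟩)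
      by_cases ha : a = i
      · subst ha
        simpa using hs
      · rw [Pi.single_eq_of_ne ha]
        simp [tsupport]
    have h := Submodule.inner_right_of_mem_orthogonal hmem hW
    rw [MatrixField.inner_mk, Finset.sum_eq_single i] at h
    · rw [← h]
      refine Finset.sum_congr rfl fun j _ => ?_
      rw [inner_toLp_left]
      simp
    · intro a _ ha
      refine Finset.sum_eq_zero fun j _ => ?_
      rw [inner_toLp_left, Pi.single_eq_of_ne ha]
      have : partialD (0 : Space n → ℝ) j = 0 := by
        funext x
        simp [partialD]
      simp [this]
    · simp

end Helmholtz

/-! ### Korn's inequality modulo rigid motions -/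

section KornModuloRigid

variable {n : ℕ} {Ω : Set (Space n)}

theorem lintegral_ofReal_sq {α : Type*} [MeasurableSpace α] (μ : Measure α) (f : α → ℝ) :
    ∫⁻ x, ENNReal.ofReal (f x ^ 2) ∂μ = eLpNorm f 2 μ ^ 2 := by
  have h := eLpNorm_nnreal_pow_eq_lintegral (f := f) (μ := μ) (p := 2) (by norm_num)
  have h' : eLpNorm f 2 μ ^ 2 = ∫⁻ x, ‖f x‖ₑ ^ 2 ∂μ := by simpa using h
  rw [h']
  congr 1 with x
  rw [← ofReal_norm, ← ENNReal.ofReal_pow (norm_nonneg _), Real.norm_eq_abs, sq_abs]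

/-- The factor 1 + C replaces √C and avoids roots in `ℝ≥0∞`. -/
theorem le_mul_of_sq_le {a b C : ℝ≥0∞} (h : a ^ 2 ≤ C * b ^ 2) : a ≤ (1 + C) * b := by
  refine (ENNReal.pow_right_strictMono two_ne_zero).le_iff_le.1 (h.trans ?_)
  rw [mul_pow]
  gcongr
  calc C ≤ 1 + C := le_add_self
    _ = (1 + C) ^ 1 := (pow_one _).symm
    _ ≤ (1 + C) ^ 2 := pow_le_pow_right' le_self_add one_le_two

/-- The sum of the `L₂` norms of the strains of a smooth field. -/
def strainSum (Ω : Set (Space n)) (φ : Fin n → Space n → ℝ) : ℝ≥0∞ :=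
  ∑ i, ∑ j, eLpNorm (fun x => (partialD (φ i) j x + partialD (φ j) i x) / 2) 2 (volume.restrict Ω)

theorem eLpNorm_strain_le (φ : Fin n → Space n → ℝ) (i j : Fin n) :
    eLpNorm (fun x => (partialD (φ i) j x + partialD (φ j) i x) / 2) 2 (volume.restrict Ω) ≤
      strainSum Ω φ :=
  (Finset.single_le_sum (f := fun j => eLpNorm
    (fun x => (partialD (φ i) j x + partialD (φ j) i x) / 2) 2 (volume.restrict Ω))
    (fun _ _ => zero_le) (Finset.mem_univ j)).trans
  (Finset.single_le_sum (f := fun i => ∑ j, eLpNorm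
    (fun x => (partialD (φ i) j x + partialD (φ j) i x) / 2) 2 (volume.restrict Ω))
    (fun _ _ => zero_le) (Finset.mem_univ i))

theorem eLpNorm_stressLike_le {φ : Fin n → Space n → ℝ} (hφ : ∀ i, IsTest (φ i)) (a b : Fin n) :
    eLpNorm (stressLike φ a b) 2 (volume.restrict Ω) ≤ 3 * strainSum Ω φ := by
  set μ := volume.restrict Ω
  set ε : Fin n → Fin n → Space n → ℝ :=
    fun i j x => (partialD (φ i) j x + partialD (φ j) i x) / 2 with hε
  have hm : ∀ i j, AEStronglyMeasurable (ε i j) μ := fun i j =>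
    (((hφ i).partialD_continuous j).add ((hφ j).partialD_continuous i)).div_const 2
      |>.aestronglyMeasurable
  have e : stressLike φ a b = (2 : ℝ) • ε a b - (if a = b then ∑ k, ε k k else 0) := by
    funext x
    by_cases hab : a = b
    · simp [stressLike, hε, hab]
      ring
    · simp [stressLike, hε, hab]
      ring
  have h1 : eLpNorm (if a = b then ∑ k, ε k k else 0) 2 μ ≤ strainSum Ω φ := by
    by_cases hab : a = b
    · simp only [hab, if_true]
      refine (eLpNorm_sum_le (fun k _ => hm k k) (by norm_num)).trans ?_
      refine Finset.sum_le_sum fun k _ => ?_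
      exact Finset.single_le_sum (f := fun j => eLpNorm (ε k j) 2 μ) (fun _ _ => zero_le)
        (Finset.mem_univ k)
    · simp [hab]
  have hm' : AEStronglyMeasurable (if a = b then ∑ k, ε k k else 0) μ := by
    by_cases hab : a = b
    · simp only [hab, if_true]
      exact Finset.aestronglyMeasurable_sum _ fun k _ => hm k k
    · simp only [hab, if_false]
      exact aestronglyMeasurable_const
  rw [e]
  refine (eLpNorm_sub_le ((hm a b).const_smul 2) hm' (by norm_num)).trans ?_
  rw [eLpNorm_const_smul]
  calc _ ≤ 2 * strainSum Ω φ + strainSum Ω φ := by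
        gcongr
        · rw [← ofReal_norm]
          simp
        · exact eLpNorm_strain_le φ a b
    _ = _ := by ring

theorem IsLipschitzDomain.exists_infDist_le {Ω : Set (Space n)} (hΩ : IsLipschitzDomain Ω)
    (hn : 0 < n) : ∃ R, 0 ≤ R ∧ ∀ x ∈ Ω, Metric.infDist x Ωᶜ ≤ R := by
  obtain ⟨y, hy⟩ := hΩ.compl_nonempty hn
  obtain ⟨R, hR⟩ := hΩ.isBounded.subset_closedBall y
  exact ⟨max R 0, le_max_right _ _, fun x hx =>
    ((Metric.infDist_le_dist_of_mem hy).trans (hR hx)).trans (le_max_left _ _)⟩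

/-- The Poincaré inequality on a Lipschitz domain, for functions smooth up to the boundary. -/
theorem IsLipschitzDomain.exists_poincare (hΩ : IsLipschitzDomain Ω) (hn : 0 < n) :
    ∃ C : ℝ≥0∞, C ≠ ⊤ ∧ ∀ p : Space n → ℝ, ContDiff ℝ 1 p →
      ∃ b : ℝ, eLpNorm (fun x => p x - b) 2 (volume.restrict Ω) ≤
        C * ∑ k, eLpNorm (partialD p k) 2 (volume.restrict Ω) := by
  obtain ⟨C, hC, h⟩ := hΩ.exists_weighted_poincare hn
  obtain ⟨R, hR0, hR⟩ := hΩ.exists_infDist_le hn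
  refine ⟨1 + C * ENNReal.ofReal (R ^ 2), by finiteness, fun p hp => ?_⟩
  have hp1 : IsC1On Ω p := ⟨hp.continuous.measurable, fun x _ => hp.differentiable (by simp) x,
    (hp.continuous_fderiv (by simp)).continuousOn⟩
  obtain ⟨b, hb⟩ := h p hp1
  refine ⟨b, le_mul_of_sq_le ?_⟩
  rw [lintegral_ofReal_sq] at hb
  refine hb.trans ?_
  rw [mul_assoc]
  gcongr
  have h1 : weightedEnergy Ω p ≤ ENNReal.ofReal (R ^ 2) *
      ∫⁻ x in Ω, ENNReal.ofReal (‖fderiv ℝ p x‖ ^ 2) := by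
    unfold weightedEnergy
    rw [← lintegral_const_mul' _ _ ENNReal.ofReal_ne_top]
    refine setLIntegral_mono' hΩ.isOpen.measurableSet fun x hx => ?_
    rw [← ENNReal.ofReal_mul (by positivity)]
    refine ENNReal.ofReal_le_ofReal ?_
    have := hR x hx
    have : 0 ≤ Metric.infDist x Ωᶜ := Metric.infDist_nonneg
    gcongr
  refine h1.trans ?_
  gcongr
  rw [lintegral_ofReal_sq]
  gcongr
  have hcont : ∀ k, Continuous (partialD p k) := fun k =>
    (hp.continuous_fderiv (by simp)).clm_apply continuous_const
  calc eLpNorm (fun x => ‖fderiv ℝ p x‖) 2 (volume.restrict Ω)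
      ≤ eLpNorm (∑ k, fun x => |partialD p k x|) 2 (volume.restrict Ω) := by
        refine eLpNorm_mono_real fun x => ?_
        rw [norm_norm, Finset.sum_apply]
        exact norm_fderiv_le_sum p x
    _ ≤ ∑ k, eLpNorm (fun x => |partialD p k x|) 2 (volume.restrict Ω) :=
        eLpNorm_sum_le (fun k _ => (hcont k).abs.aestronglyMeasurable) (by norm_num)
    _ = _ := Finset.sum_congr rfl fun k _ => eLpNorm_norm (partialD p k)

/-- The skew part of a harmonic gradient is controlled, up to a constant, by its symmetric part. -/
theorem IsLipschitzDomain.exists_skew_le (hΩ : IsLipschitzDomain Ω) (hn : 0 < n) :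
    ∃ C : ℝ≥0∞, C ≠ ⊤ ∧ ∀ W : Fin n → Fin n → L2 Ω,
      (∀ ψ, IsTest ψ → tsupport ψ ⊆ Ω → ∀ i j k,
        ∫ x in Ω, W i j x * partialD ψ k x = ∫ x in Ω, W i k x * partialD ψ j x) →
      (∀ ψ, IsTest ψ → tsupport ψ ⊆ Ω → ∀ i, ∑ j, ∫ x in Ω, W i j x * partialD ψ j x = 0) →
      ∀ i j, ∃ b : ℝ, eLpNorm (fun x => (W i j x - W j i x) / 2 - b) 2 (volume.restrict Ω) ≤
        C * ∑ a, ∑ b, eLpNorm (fun x => (W a b x + W b a x) / 2) 2 (volume.restrict Ω) := by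
  obtain ⟨C, hC, hCP⟩ := hΩ.exists_weighted_poincare hn
  obtain ⟨D, hD, hDE⟩ := exists_weightedEnergy_le hn
  refine ⟨(1 + C * D) * 2, by finiteness, fun W hcurl hdiv i j => ?_⟩
  set μ := volume.restrict Ω with hμ
  have hvol : volume Ω ≠ ⊤ := hΩ.isBounded.measure_lt_top.ne
  have : IsFiniteMeasure μ := ⟨by simpa [hμ] using hvol.lt_top⟩
  set S : Fin n → Fin n → Space n → ℝ := fun a b x => (W a b x + W b a x) / 2 with hS
  -- The factor 2 accounts for the two entries of S that express each derivative of the skew part.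
  set T : Space n → ℝ := fun x => 2 * ∑ a, ∑ b, |S a b x| with hT
  have hWm : ∀ a b, Measurable (W a b : Space n → ℝ) := fun a b =>
    (Lp.stronglyMeasurable (W a b)).measurable
  have hSm : ∀ a b, Measurable (S a b) := fun a b => ((hWm a b).add (hWm b a)).div_const 2
  have hSL : ∀ a b, MemLp (S a b) 2 μ := fun a b => by
    have := ((Lp.memLp (W a b)).add (Lp.memLp (W b a))).const_mul (1 / 2)
    refine this.ae_eq (Eventually.of_forall fun x => ?_)
    simp [hS]
    ring
  have hTm : Measurable T := by
    refine Measurable.const_mul (Finset.measurable_sum _ fun a _ =>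
      Finset.measurable_sum _ fun b _ => ?_) 2
    exact (hSm a b).abs
  have hTL : MemLp T 2 μ :=
    (memLp_finsetSum _ fun a _ => memLp_finsetSum _ fun b _ => (hSL a b).abs).const_mul 2
  have hint : ∀ a b (ψ : Space n → ℝ), IsTest ψ → Integrable (fun x => W a b x * ψ x) μ :=
    fun a b ψ hψ => integrable_mul_test (W a b) hψ.1.continuous hψ.2
  -- Curl-free rows give ∂_k ∂_k W_ab = ∂_k ∂_b W_ak, and the sum over k is ∂_b of the divergence of
  -- row a, which is zero.
  have hharm : ∀ a b, WeaklyHarmonic Ω (W a b) := by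
    intro a b ψ hψ hs
    have hk : ∀ k, IsTest (partialD ψ k) := fun k => hψ.partialD k
    have hks : ∀ k, tsupport (partialD ψ k) ⊆ Ω := fun k => (tsupport_partialD_subset ψ k).trans hs
    simp_rw [Finset.mul_sum]
    rw [integral_finsetSum _ fun k _ => hint a b _ ((hk k).partialD k)]
    rw [← hdiv _ (hk b) (hks b) a]
    refine Finset.sum_congr rfl fun k _ => ?_
    rw [hcurl _ (hk k) (hks k) a b k, partialD_comm hψ k b]
  set w : Space n → ℝ := fun x => (W i j x - W j i x) / 2 with hw
  have hwL : MemLp w 2 μ := by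
    have := ((Lp.memLp (W i j)).sub (Lp.memLp (W j i))).const_mul (1 / 2)
    refine this.ae_eq (Eventually.of_forall fun x => ?_)
    simp [hw]
    ring
  have hsplit : ∀ g : Space n → ℝ, Integrable (fun x => W i j x * g x) μ →
      Integrable (fun x => W j i x * g x) μ →
      ∫ x, w x * g x ∂μ = ((∫ x, W i j x * g x ∂μ) - ∫ x, W j i x * g x ∂μ) / 2 := by
    intro g h1 h2
    rw [← integral_sub h1 h2, ← integral_div]
    congr 1 with x
    simp only [hw]
    ring
  have hwH : WeaklyHarmonic Ω w := by
    intro ψ hψ hs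
    have hi : ∀ a b, Integrable (fun x => W a b x * ∑ k, partialD (partialD ψ k) k x) μ := by
      intro a b
      simp_rw [Finset.mul_sum]
      exact integrable_finsetSum _ fun k _ => hint a b _ ((hψ.partialD k).partialD k)
    rw [hsplit _ (hi i j) (hi j i), hharm i j ψ hψ hs, hharm j i ψ hψ hs]
    simp
  have hbound : ∀ ψ k, IsTest ψ → tsupport ψ ⊆ Ω →
      |∫ x in Ω, w x * partialD ψ k x| ≤ ∫ x in Ω, |T x| * ∑ l, |partialD ψ l x| := by
    intro ψ k hψ hs
    have hi := fun a b l => hint a b _ (hψ.partialD l)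
    -- The weak form of ∂_k w_ij = ∂_j S_ik - ∂_i S_jk. The terms W_ki and W_kj cancel because row k
    -- is curl free.
    have e : ∫ x in Ω, w x * partialD ψ k x =
        ∫ x in Ω, (S i k x * partialD ψ j x - S j k x * partialD ψ i x) := by
      rw [hsplit _ (hi i j k) (hi j i k), hcurl ψ hψ hs i j k, hcurl ψ hψ hs j i k]
      have e1 : ∀ x, S i k x * partialD ψ j x - S j k x * partialD ψ i x =
          (W i k x * partialD ψ j x + W k i x * partialD ψ j x) / 2 -
          (W j k x * partialD ψ i x + W k j x * partialD ψ i x) / 2 := by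
        intro x
        simp only [hS]
        ring
      simp_rw [e1]
      rw [integral_sub, integral_div, integral_div, integral_add (hi i k j) (hi k i j),
        integral_add (hi j k i) (hi k j i), hcurl ψ hψ hs k i j]
      · ring
      · exact ((hi i k j).add (hi k i j)).div_const 2
      · exact ((hi j k i).add (hi k j i)).div_const 2
    rw [e]
    refine (abs_integral_le_integral_abs).trans (integral_mono_of_nonneg
      (Eventually.of_forall fun x => abs_nonneg _) ?_ (Eventually.of_forall fun x => ?_))
    · simp_rw [Finset.mul_sum]
      refine integrable_finsetSum _ fun l _ => ?_
      exact hTL.abs.integrable_mul ((hψ.partialD l).memLp Ω).abs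
    · simp only
      have hSle : ∀ a b, |S a b x| ≤ ∑ a, ∑ b, |S a b x| := fun a b =>
        (Finset.single_le_sum (f := fun b => |S a b x|) (fun _ _ => abs_nonneg _)
          (Finset.mem_univ b)).trans
        (Finset.single_le_sum (f := fun a => ∑ b, |S a b x|)
          (fun _ _ => Finset.sum_nonneg fun _ _ => abs_nonneg _) (Finset.mem_univ a))
      have hψle : ∀ l, |partialD ψ l x| ≤ ∑ l, |partialD ψ l x| := fun l =>
        Finset.single_le_sum (f := fun l => |partialD ψ l x|) (fun _ _ => abs_nonneg _)
          (Finset.mem_univ l)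
      have h0 : 0 ≤ ∑ a, ∑ b, |S a b x| := (abs_nonneg _).trans (hSle i j)
      have hTx : |T x| = 2 * ∑ a, ∑ b, |S a b x| := abs_of_nonneg (by positivity)
      rw [hTx]
      refine (abs_sub _ _).trans ?_
      rw [abs_mul, abs_mul]
      have h1 := mul_le_mul (hSle i k) (hψle j) (abs_nonneg _) h0
      have h2 := mul_le_mul (hSle j k) (hψle i) (abs_nonneg _) h0
      linarith
  obtain ⟨p, hp, hpw, hE⟩ := hDE Ω hΩ.isOpen (hΩ.compl_nonempty hn) hvol w T
    (hwL.integrable (by norm_num)) hwH hTm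
    ((memLp_two_iff_integrable_sq hTm.aestronglyMeasurable).1 hTL) hbound
  obtain ⟨b, hb⟩ := hCP p hp
  refine ⟨b, ?_⟩
  have hN : eLpNorm (fun x => w x - b) 2 μ ≤ (1 + C * D) * eLpNorm T 2 μ := by
    refine le_mul_of_sq_le ?_
    have e : eLpNorm (fun x => w x - b) 2 μ = eLpNorm (fun x => p x - b) 2 μ := by
      refine eLpNorm_congr_ae ?_
      filter_upwards [hpw] with x hx
      rw [hx]
    rw [e, ← lintegral_ofReal_sq, ← lintegral_ofReal_sq]
    refine hb.trans ?_
    rw [mul_assoc]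
    gcongr
  refine hN.trans ?_
  rw [mul_assoc]
  gcongr
  have e : T = (2 : ℝ) • ∑ a, ∑ b, fun x => |S a b x| := by
    funext x
    simp [hT, Finset.sum_apply]
  rw [e, eLpNorm_const_smul, ← ofReal_norm]
  have hm : ∀ a b, AEStronglyMeasurable (fun x => |S a b x|) μ := fun a b =>
    (hSm a b).abs.aestronglyMeasurable
  simp only [Real.norm_ofNat, ENNReal.ofReal_ofNat]
  gcongr
  refine (eLpNorm_sum_le (fun a _ => Finset.aestronglyMeasurable_sum _ fun b _ => hm a b)
    (by norm_num)).trans (Finset.sum_le_sum fun a _ => ?_)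
  refine (eLpNorm_sum_le (fun b _ => hm a b) (by norm_num)).trans
    (Finset.sum_le_sum fun b _ => ?_)
  exact le_of_eq (eLpNorm_norm (S a b))

/-- Korn's inequality on a Lipschitz domain: a smooth field is close to a rigid motion, in terms of
its strain. -/
theorem IsLipschitzDomain.exists_korn_rigid (hΩ : IsLipschitzDomain Ω) (hn : 0 < n) :
    ∃ C : ℝ≥0∞, C ≠ ⊤ ∧ ∀ φ : Fin n → Space n → ℝ, (∀ i, IsTest (φ i)) →
      ∃ (M : Fin n → Fin n → ℝ) (c : Fin n → ℝ), (∀ i j, M i j = -M j i) ∧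
        (∀ i j, eLpNorm (fun x => partialD (φ i) j x - M i j) 2 (volume.restrict Ω) ≤
          C * strainSum Ω φ) ∧
        ∀ i, eLpNorm (fun x => φ i x - (∑ j, M i j * x j + c i)) 2 (volume.restrict Ω) ≤
          C * strainSum Ω φ := by
  obtain ⟨C, hC, hskew⟩ := hΩ.exists_skew_le hn
  obtain ⟨D, hD, hpoin⟩ := hΩ.exists_poincare hn
  set N : ℝ≥0∞ := (n : ℝ≥0∞) * n with hN
  set CV : ℝ≥0∞ := N * 3 with hCV
  set CG : ℝ≥0∞ := CV + (1 + (CV + CV)) + (C * (N * (1 + (CV + CV))) + C * (N * (1 + (CV + CV))))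
    with hCG
  have hNt : N ≠ ⊤ := by finiteness
  have hCGt : CG ≠ ⊤ := by finiteness
  refine ⟨CG + D * (n * CG), by finiteness, fun φ hφ => ?_⟩
  set μ := volume.restrict Ω with hμ
  set e := strainSum Ω φ with he
  obtain ⟨V, W, hVW, hV, hcurl, hdiv⟩ := exists_helmholtz (Ω := Ω) φ hφ
  have hVe : ∀ i j, eLpNorm (V i j) 2 μ ≤ CV * e := by
    intro i j
    rw [← Lp.enorm_def]
    refine (hV i j).trans ((Finset.sum_le_sum fun a _ => Finset.sum_le_sum fun b _ =>
      eLpNorm_stressLike_le hφ a b).trans ?_)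
    simp only [Finset.sum_const, Finset.card_univ, Fintype.card_fin, nsmul_eq_mul, hCV, hN]
    exact le_of_eq (by ring)
  have hVm : ∀ i j, AEStronglyMeasurable (V i j : Space n → ℝ) μ := fun i j =>
    Lp.aestronglyMeasurable _
  have hWm : ∀ i j, Measurable (W i j : Space n → ℝ) := fun i j =>
    (Lp.stronglyMeasurable (W i j)).measurable
  have hS : ∀ i j, eLpNorm (fun x => (W i j x + W j i x) / 2) 2 μ ≤ (1 + (CV + CV)) * e := by
    intro i j
    -- The symmetric part of W is the strain of φ minus the symmetric part of V, and both are
    -- already controlled.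
    have e1 : (fun x => (W i j x + W j i x) / 2) =ᵐ[μ]
        (fun x => (partialD (φ i) j x + partialD (φ j) i x) / 2) -
          ((1 / 2 : ℝ) • (V i j : Space n → ℝ) + (1 / 2 : ℝ) • (V j i : Space n → ℝ)) := by
      filter_upwards [hVW i j, hVW j i] with x h1 h2
      simp only [Pi.sub_apply, Pi.add_apply, Pi.smul_apply, smul_eq_mul, h1, h2]
      ring
    have hhalf : ∀ f : Space n → ℝ, eLpNorm ((1 / 2 : ℝ) • f) 2 μ ≤ eLpNorm f 2 μ := by
      intro f
      rw [eLpNorm_const_smul]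
      refine mul_le_of_le_one_left zero_le ?_
      rw [← ofReal_norm]
      simp
    rw [eLpNorm_congr_ae e1, add_mul, one_mul, add_mul]
    refine (eLpNorm_sub_le ?_ (((hVm i j).const_smul _).add ((hVm j i).const_smul _))
      (by norm_num)).trans (add_le_add (eLpNorm_strain_le φ i j) ?_)
    · exact ((((hφ i).partialD_continuous j).add ((hφ j).partialD_continuous i)).div_const 2)
        |>.aestronglyMeasurable
    · exact (eLpNorm_add_le ((hVm i j).const_smul _) ((hVm j i).const_smul _)
        (by norm_num)).trans (add_le_add ((hhalf _).trans (hVe i j)) ((hhalf _).trans (hVe j i)))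
  have hSs : ∑ a, ∑ b, eLpNorm (fun x => (W a b x + W b a x) / 2) 2 μ ≤
      N * (1 + (CV + CV)) * e := by
    refine (Finset.sum_le_sum fun a _ => Finset.sum_le_sum fun b _ => hS a b).trans ?_
    simp only [Finset.sum_const, Finset.card_univ, Fintype.card_fin, nsmul_eq_mul, hN]
    exact le_of_eq (by ring)
  choose B hB using hskew W hcurl hdiv
  have hBe : ∀ i j, eLpNorm (fun x => (W i j x - W j i x) / 2 - B i j) 2 μ ≤
      C * (N * (1 + (CV + CV))) * e := by
    intro i j
    refine (hB i j).trans ?_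
    rw [mul_assoc C]
    gcongr
  -- The constants B i j were chosen separately for each pair. Antisymmetrising costs only a
  -- constant, since the function they approximate is itself skew.
  set M : Fin n → Fin n → ℝ := fun i j => (B i j - B j i) / 2 with hM
  have hMe : ∀ i j, eLpNorm (fun x => (W i j x - W j i x) / 2 - M i j) 2 μ ≤
      (C * (N * (1 + (CV + CV))) + C * (N * (1 + (CV + CV)))) * e := by
    intro i j
    have e1 : (fun x => (W i j x - W j i x) / 2 - M i j) =
        (1 / 2 : ℝ) • (fun x => (W i j x - W j i x) / 2 - B i j) -
        (1 / 2 : ℝ) • (fun x => (W j i x - W i j x) / 2 - B j i) := by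
      funext x
      simp only [hM, Pi.sub_apply, Pi.smul_apply, smul_eq_mul]
      ring
    have hhalf : ∀ f : Space n → ℝ, eLpNorm ((1 / 2 : ℝ) • f) 2 μ ≤ eLpNorm f 2 μ := by
      intro f
      rw [eLpNorm_const_smul]
      refine mul_le_of_le_one_left zero_le ?_
      rw [← ofReal_norm]
      simp
    have hm : ∀ i j, AEStronglyMeasurable (fun x => (W i j x - W j i x) / 2 - B i j) μ :=
      fun i j => ((((hWm i j).sub (hWm j i)).div_const 2).sub_const _).aestronglyMeasurable
    rw [e1, add_mul]
    exact (eLpNorm_sub_le ((hm i j).const_smul _) ((hm j i).const_smul _) (by norm_num)).trans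
      (add_le_add ((hhalf _).trans (hBe i j)) ((hhalf _).trans (hBe j i)))
  have hgrad : ∀ i j, eLpNorm (fun x => partialD (φ i) j x - M i j) 2 μ ≤ CG * e := by
    intro i j
    have e1 : (fun x => partialD (φ i) j x - M i j) =ᵐ[μ] (V i j : Space n → ℝ) +
        (fun x => (W i j x + W j i x) / 2) + (fun x => (W i j x - W j i x) / 2 - M i j) := by
      filter_upwards [hVW i j] with x h1
      simp only [Pi.add_apply, h1]
      ring
    have hm1 : AEStronglyMeasurable (fun x => (W i j x + W j i x) / 2) μ :=
      (((hWm i j).add (hWm j i)).div_const 2).aestronglyMeasurable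
    have hm2 : AEStronglyMeasurable (fun x => (W i j x - W j i x) / 2 - M i j) μ :=
      ((((hWm i j).sub (hWm j i)).div_const 2).sub_const _).aestronglyMeasurable
    rw [eLpNorm_congr_ae e1, hCG, add_mul, add_mul CV]
    exact (eLpNorm_add_le ((hVm i j).add hm1) hm2 (by norm_num)).trans
      (add_le_add ((eLpNorm_add_le (hVm i j) hm1 (by norm_num)).trans
        (add_le_add (hVe i j) (hS i j))) (hMe i j))
  have hlin : ∀ i, ContDiff ℝ ∞ fun x : Space n => ∑ j, M i j * x j := fun i => by fun_prop
  have hlinD : ∀ i k x, partialD (fun x : Space n => φ i x - ∑ j, M i j * x j) k x =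
      partialD (φ i) k x - M i k := by
    intro i k x
    unfold partialD
    have h1 : HasFDerivAt (fun x : Space n => ∑ j, M i j * x j)
        (∑ j, M i j • (EuclideanSpace.proj j : Space n →L[ℝ] ℝ)) x := by
      refine HasFDerivAt.fun_sum fun j _ => ?_
      exact (EuclideanSpace.proj j : Space n →L[ℝ] ℝ).hasFDerivAt.const_mul (M i j)
    rw [(((hφ i).1.differentiable (by simp) x).hasFDerivAt.fun_sub h1).fderiv]
    simp
  -- The field φ - Mx has gradient ∇φ - M, so Poincaré applied to each component supplies the
  -- translation c.
  have hc : ∀ i, ∃ c : ℝ, eLpNorm (fun x => φ i x - (∑ j, M i j * x j + c)) 2 μ ≤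
      D * (n * CG) * e := by
    intro i
    obtain ⟨c, hc⟩ := hpoin (fun x => φ i x - ∑ j, M i j * x j)
      (((hφ i).1.sub (hlin i)).of_le (by simp))
    refine ⟨c, ?_⟩
    simp_rw [← sub_sub]
    refine hc.trans ?_
    rw [mul_assoc]
    gcongr
    calc _ ≤ ∑ _k : Fin n, CG * e := by
          refine Finset.sum_le_sum fun k _ => ?_
          rw [show partialD (fun x : Space n => φ i x - ∑ j, M i j * x j) k =
            fun x => partialD (φ i) k x - M i k from funext (hlinD i k)]
          exact hgrad i k
      _ = _ := by simp [mul_assoc]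
  choose c hc using hc
  refine ⟨M, c, fun i j => by simp only [hM]; ring, fun i j => (hgrad i j).trans ?_,
    fun i => (hc i).trans ?_⟩
  · gcongr
    exact le_self_add
  · gcongr
    exact le_add_self

end KornModuloRigid

/-! ### Projection onto the graph and trace inequalities -/

section BoundaryTrace

variable {n : ℕ} {Ω : Set (Space n)} {x₀ : Space n} {δ : ℝ}

namespace Chart

variable (c : Chart Ω x₀ δ)

/-- The projection onto the graph, in the direction of the axis. -/
def foot (y : Space n) : Space n := y - c.height y • c.ν

theorem continuous_foot : Continuous c.foot := by
  have := c.continuous_height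
  unfold foot
  fun_prop

theorem foot_eq_add (y : Space n) : c.foot y = y + (-c.height y) • c.ν := by
  rw [foot, neg_smul, sub_eq_add_neg]

theorem foot_add (y : Space n) (s : ℝ) : c.foot (y + s • c.ν) = c.foot y := by
  rw [foot, c.height_add, foot]
  module

theorem height_foot (y : Space n) : c.height (c.foot y) = 0 := by
  rw [foot_eq_add, c.height_add]
  ring

theorem axisDist_foot (y : Space n) : c.axisDist (c.foot y) = c.axisDist y := by
  rw [foot_eq_add, c.axisDist_add]

theorem foot_mem_ball {y : Space n} (hy : c.axisDist y < c.a) : c.foot y ∈ Metric.ball x₀ δ := by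
  refine c.dist_lt _ ?_ ?_
  · exact (c.axisDist_foot y).trans_lt hy
  · show |c.height (c.foot y)| < c.a
    rw [c.height_foot, abs_zero]
    exact c.a_pos

theorem foot_mem_frontier (hΩ : IsOpen Ω) {y : Space n} (hy : c.axisDist y < c.a) :
    c.foot y ∈ frontier Ω := by
  have ha := (c.axisDist_foot y).trans_lt hy
  rw [hΩ.frontier_eq]
  refine ⟨?_, fun h => ?_⟩
  · have ht : Tendsto (fun s : ℝ => c.foot y + s • c.ν) (𝓝[>] 0) (𝓝 (c.foot y)) := by
      have : Continuous fun s : ℝ => c.foot y + s • c.ν := by fun_prop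
      simpa using (this.tendsto 0).mono_left nhdsWithin_le_nhds
    refine mem_closure_of_tendsto ht ?_
    filter_upwards [Ioo_mem_nhdsGT c.a_pos] with s hs
    refine c.upper_subset ⟨?_, ?_⟩
    · rwa [c.axisDist_add]
    · rw [c.height_add, c.height_foot, zero_add]
      exact hs
  · have h0 : c.height (c.foot y) = 0 := c.height_foot y
    have := (c.mem_iff _ ha (by
      show |c.height (c.foot y)| < c.a
      rw [h0, abs_zero]
      exact c.a_pos)).1 h
    exact this.ne' h0

/-- A line whose foot lies in s meets `upper` in length at most a, and meets the ball of radius 2r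
about p in length at least 2r. Hence the volume of the column is at most a/(2r) times that of the
ball, which is of order r^{n-1}. -/
theorem volume_upper_inter_foot_le (hn : 0 < n) {s : Set (Space n)} (hs : MeasurableSet s)
    {p : Space n} {r : ℝ} (hr : 0 < r) (hp : ∀ q ∈ s, dist q p ≤ r) :
    volume (c.upper ∩ c.foot ⁻¹' s) ≤
      ENNReal.ofReal (c.a * 2 ^ (n - 1)) * volume (Metric.ball (0 : Space n) 1) *
        ENNReal.ofReal r ^ (n - 1) := by
  have hm : MeasurableSet (c.upper ∩ c.foot ⁻¹' s) :=
    c.isOpen_upper.measurableSet.inter (c.continuous_foot.measurable hs)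
  have hb : MeasurableSet (Metric.closedBall p (2 * r)) := Metric.isClosed_closedBall.measurableSet
  have e1 : volume (c.upper ∩ c.foot ⁻¹' s) =
      ∫⁻ x, (c.upper ∩ c.foot ⁻¹' s).indicator (fun _ => (1 : ℝ≥0∞)) x := by
    rw [lintegral_indicator hm, setLIntegral_one]
  have e2 : ∫⁻ x, (Metric.closedBall p (2 * r)).indicator
        (fun _ => ENNReal.ofReal (c.a / (2 * r))) x =
      ENNReal.ofReal (c.a * 2 ^ (n - 1)) * volume (Metric.ball (0 : Space n) 1) *
        ENNReal.ofReal r ^ (n - 1) := by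
    rw [lintegral_indicator hb, setLIntegral_const, Measure.addHaar_closedBall _ _ (by positivity),
      finrank_euclideanSpace, Fintype.card_fin, ← ENNReal.ofReal_pow hr.le, mul_comm
      (ENNReal.ofReal (c.a * 2 ^ (n - 1))), mul_assoc (volume _), mul_left_comm,
      ← mul_assoc, mul_comm _ (volume _),
      ← ENNReal.ofReal_mul (by have := c.a_pos; positivity),
      ← ENNReal.ofReal_mul (by have := c.a_pos; positivity)]
    congr 2
    obtain ⟨m, rfl⟩ : ∃ m, n = m + 1 := ⟨n - 1, by omega⟩
    rw [add_tsub_cancel_right, mul_pow, pow_succ, pow_succ r]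
    field_simp
  rw [e1, ← e2]
  refine lintegral_le_of_line c.ν c.norm_ν (measurable_const.indicator hm)
    (measurable_const.indicator hb) fun x => ?_
  by_cases hx : c.foot x ∈ s
  · have h1 : ∫⁻ t : ℝ, (c.upper ∩ c.foot ⁻¹' s).indicator (fun _ => (1 : ℝ≥0∞)) (x + t • c.ν) ≤
        ENNReal.ofReal c.a := by
      calc _ ≤ ∫⁻ t : ℝ, c.upper.indicator (fun _ => (1 : ℝ≥0∞)) (x + t • c.ν) :=
            lintegral_mono fun t => indicator_le_indicator_of_subset inter_subset_left
              (fun _ => zero_le) _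
        _ ≤ ENNReal.ofReal c.a := by
            rw [c.lintegral_upper_line]
            split_ifs
            · simp
            · exact zero_le
    refine h1.trans ?_
    have h2 : ∀ t ∈ Icc (-c.height x - r) (-c.height x + r),
        x + t • c.ν ∈ Metric.closedBall p (2 * r) := by
      intro t ht
      have e3 : x + t • c.ν = c.foot x + (t + c.height x) • c.ν := by
        rw [foot]
        module
      rw [Metric.mem_closedBall]
      calc dist (x + t • c.ν) p ≤ dist (x + t • c.ν) (c.foot x) + dist (c.foot x) p :=
            dist_triangle _ _ _
        _ ≤ r + r := by
            refine add_le_add ?_ (hp _ hx)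
            rw [e3, dist_eq_norm, add_sub_cancel_left, norm_smul, c.norm_ν, mul_one,
              Real.norm_eq_abs, abs_le]
            constructor <;> linarith [ht.1, ht.2]
        _ = 2 * r := by ring
    calc ENNReal.ofReal c.a
        = ∫⁻ _ in Icc (-c.height x - r) (-c.height x + r), ENNReal.ofReal (c.a / (2 * r)) := by
          rw [setLIntegral_const, Real.volume_Icc, ← ENNReal.ofReal_mul
            (by have := c.a_pos; positivity)]
          congr 1
          field_simp
          ring
      _ = ∫⁻ t, (Icc (-c.height x - r) (-c.height x + r)).indicator
            (fun _ => ENNReal.ofReal (c.a / (2 * r))) t := by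
          rw [lintegral_indicator measurableSet_Icc]
      _ ≤ _ := by
          refine lintegral_mono fun t => ?_
          by_cases ht : t ∈ Icc (-c.height x - r) (-c.height x + r)
          · rw [indicator_of_mem ht, indicator_of_mem (h2 t ht)]
          · rw [indicator_of_notMem ht]
            exact zero_le
  · refine le_of_eq_of_le ?_ zero_le
    rw [lintegral_eq_zero_iff' (by
      exact ((measurable_const.indicator hm).comp
        (by fun_prop : Measurable fun t : ℝ => x + t • c.ν)).aemeasurable)]
    refine Eventually.of_forall fun t => ?_
    simp only [Pi.zero_apply]
    rw [indicator_of_notMem]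
    intro h
    have := h.2
    rw [mem_preimage, c.foot_add] at this
    exact hx this

/-- The projection onto the graph maps the volume to a multiple of the surface measure. -/
theorem exists_map_foot_le (hn : 0 < n) :
    ∃ C : ℝ≥0∞, C ≠ ⊤ ∧ Measure.map c.foot (volume.restrict c.upper) ≤
      C • Measure.hausdorffMeasure ((n : ℝ) - 1) := by
  set C : ℝ≥0∞ := ENNReal.ofReal (c.a * 2 ^ (n - 1)) * volume (Metric.ball (0 : Space n) 1) with hC
  have hCt : C ≠ ⊤ := ENNReal.mul_ne_top ENNReal.ofReal_ne_top Metric.isBounded_ball.measure_lt_top.ne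
  have hC0 : C ≠ 0 := by
    refine mul_ne_zero ?_ (Metric.measure_ball_pos _ _ one_pos).ne'
    have := c.a_pos
    simpa using (by positivity : 0 < c.a * 2 ^ (n - 1))
  refine ⟨C, hCt, ?_⟩
  have key : C⁻¹ • Measure.map c.foot (volume.restrict c.upper) ≤
      Measure.hausdorffMeasure ((n : ℝ) - 1) := by
    -- It suffices to bound the image measure of sets of diameter at most 1 by the diameter to the
    -- power n - 1.
    refine Measure.le_hausdorffMeasure _ _ 1 one_pos fun s hs => ?_
    rw [Measure.smul_apply, smul_eq_mul, ENNReal.inv_mul_le_iff hC0 hCt]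
    have hcast : (n : ℝ) - 1 = ((n - 1 : ℕ) : ℝ) := by
      rw [Nat.cast_sub hn]
      simp
    rw [hcast, ENNReal.rpow_natCast]
    rcases s.eq_empty_or_nonempty with rfl | ⟨p, hp⟩
    · simp
    have hd : Metric.ediam s ≠ ⊤ := ne_top_of_le_ne_top ENNReal.one_ne_top hs
    -- The slack ε provides a positive radius even when the diameter is zero. Passing to the closure
    -- gives measurability without changing the diameter.
    have hmain : ∀ ε : ℝ, 0 < ε → Measure.map c.foot (volume.restrict c.upper) s ≤
        C * ENNReal.ofReal ((Metric.ediam s).toReal + ε) ^ (n - 1) := by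
      intro ε hε
      refine (measure_mono subset_closure).trans ?_
      rw [Measure.map_apply c.continuous_foot.measurable isClosed_closure.measurableSet,
        Measure.restrict_apply (c.continuous_foot.measurable isClosed_closure.measurableSet),
        inter_comm]
      refine c.volume_upper_inter_foot_le hn isClosed_closure.measurableSet (p := p)
        (by positivity) fun q hq => ?_
      have h1 := Metric.edist_le_ediam_of_mem hq (subset_closure hp)
      rw [Metric.ediam_closure] at h1
      have h2 : dist q p ≤ (Metric.ediam s).toReal := by
        rw [dist_edist]
        exact ENNReal.toReal_mono hd h1
      linarith
    have hlim : Tendsto (fun ε : ℝ => C * ENNReal.ofReal ((Metric.ediam s).toReal + ε) ^ (n - 1))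
        (𝓝[>] 0) (𝓝 (C * Metric.ediam s ^ (n - 1))) := by
      have h1 : Continuous fun ε : ℝ =>
          ENNReal.ofReal ((Metric.ediam s).toReal + ε) ^ (n - 1) :=
        (ENNReal.continuous_pow _).comp (ENNReal.continuous_ofReal.comp (by fun_prop))
      have h2 := (h1.tendsto 0).mono_left (nhdsWithin_le_nhds (s := Ioi 0))
      rw [add_zero, ENNReal.ofReal_toReal hd] at h2
      exact ENNReal.Tendsto.const_mul h2 (Or.inr hCt)
    refine ge_of_tendsto hlim ?_
    filter_upwards [self_mem_nhdsWithin] with ε hε using hmain ε hε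
  intro s
  have := key s
  rw [Measure.smul_apply, smul_eq_mul, ENNReal.inv_mul_le_iff hC0 hCt] at this
  exact this

/-- Restriction to the boundary dominates restriction to the graph in `L₂`. -/
theorem exists_eLpNorm_foot_le (hΩ : IsOpen Ω) (hn : 0 < n) {O : Set (Space n)} (hO : IsOpen O)
    (hδ : Metric.ball x₀ δ ⊆ O) :
    ∃ C : ℝ≥0∞, C ≠ ⊤ ∧ ∀ g : Space n → ℝ, Continuous g →
      eLpNorm (fun x => g (c.foot x)) 2 (volume.restrict c.upper) ≤
        C * eLpNorm g 2 ((Measure.hausdorffMeasure ((n : ℝ) - 1)).restrict (frontier Ω ∩ O)) := by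
  obtain ⟨C, hC, hle⟩ := c.exists_map_foot_le hn
  refine ⟨C ^ (1 / 2 : ℝ≥0∞).toReal, ENNReal.rpow_ne_top_of_nonneg (by simp) hC, fun g hg => ?_⟩
  have hm : MeasurableSet (frontier Ω ∩ O) := isClosed_frontier.measurableSet.inter hO.measurableSet
  -- The projected measure is carried by the part of the boundary inside O, so the comparison with
  -- Hausdorff measure may be restricted to that part.
  have h1 : Measure.map c.foot (volume.restrict c.upper) =
      (Measure.map c.foot (volume.restrict c.upper)).restrict (frontier Ω ∩ O) := by
    rw [Measure.restrict_map c.continuous_foot.measurable hm, Measure.restrict_restrict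
      (c.continuous_foot.measurable hm)]
    congr 2
    refine (inter_eq_right.2 fun x hx => ?_).symm
    exact ⟨c.foot_mem_frontier hΩ hx.1, hδ (c.foot_mem_ball hx.1)⟩
  have h2 : Measure.map c.foot (volume.restrict c.upper) ≤
      C • (Measure.hausdorffMeasure ((n : ℝ) - 1)).restrict (frontier Ω ∩ O) := by
    rw [h1, ← Measure.restrict_smul]
    exact Measure.restrict_mono le_rfl hle
  have h3 := eLpNorm_map_measure (p := 2) (μ := volume.restrict c.upper) (f := c.foot) (g := g)
    hg.aestronglyMeasurable c.continuous_foot.aemeasurable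
  change eLpNorm (g ∘ c.foot) 2 _ ≤ _
  rw [← h3]
  refine (eLpNorm_mono_measure _ h2).trans ?_
  rw [eLpNorm_smul_measure_of_ne_top (by simp), smul_eq_mul]

end Chart

/-- Integrating ((t - a) f²)' over (0, a) expresses a f(0)² as ∫ f² + 2(t - a) f f', and 2(t - a) f
f' ≤ f² + (t - a)² f'². -/
theorem mul_sq_le_lintegral {f f' : ℝ → ℝ} {a : ℝ} (ha : 0 < a)
    (hf : ∀ t, HasDerivAt f (f' t) t) (hf' : Continuous f') :
    ENNReal.ofReal (a * f 0 ^ 2) ≤ 2 * (∫⁻ t in Ioo 0 a, ENNReal.ofReal (f t ^ 2)) +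
      ENNReal.ofReal (a ^ 2) * ∫⁻ t in Ioo 0 a, ENNReal.ofReal (f' t ^ 2) := by
  have hfc : Continuous f := continuous_iff_continuousAt.2 fun t => (hf t).continuousAt
  rw [setLIntegral_Ioo_ofReal_eq ha.le (by fun_prop) (fun t => sq_nonneg _),
    setLIntegral_Ioo_ofReal_eq ha.le (by fun_prop) (fun t => sq_nonneg _),
    ← ENNReal.ofReal_mul (sq_nonneg a), show (2 : ℝ≥0∞) = ENNReal.ofReal 2 by simp,
    ← ENNReal.ofReal_mul zero_le_two, ← ENNReal.ofReal_add]
  rotate_left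
  · exact mul_nonneg zero_le_two (intervalIntegral.integral_nonneg ha.le fun t _ => sq_nonneg _)
  · exact mul_nonneg (sq_nonneg a) (intervalIntegral.integral_nonneg ha.le fun t _ => sq_nonneg _)
  refine ENNReal.ofReal_le_ofReal ?_
  have hd : ∀ t ∈ uIcc 0 a, HasDerivAt (fun t => (t - a) * f t ^ 2)
      (f t ^ 2 + (t - a) * (2 * f t * f' t)) t := by
    intro t _
    exact (((hasDerivAt_id t).sub_const a).fun_mul ((hf t).fun_pow 2)).congr_deriv (by simp)
  have hftc := intervalIntegral.integral_eq_sub_of_hasDerivAt hd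
    (Continuous.intervalIntegrable (by fun_prop) _ _)
  rw [← intervalIntegral.integral_const_mul, ← intervalIntegral.integral_const_mul,
    ← intervalIntegral.integral_add (Continuous.intervalIntegrable (by fun_prop) _ _)
    (Continuous.intervalIntegrable (by fun_prop) _ _)]
  have : a * f 0 ^ 2 = ∫ t in (0 : ℝ)..a, (f t ^ 2 + (t - a) * (2 * f t * f' t)) := by
    rw [hftc]
    ring
  rw [this]
  refine intervalIntegral.integral_mono_on ha.le (Continuous.intervalIntegrable (by fun_prop) _ _)
    (Continuous.intervalIntegrable (by fun_prop) _ _) fun t ht => ?_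
  have h1 : (t - a) ^ 2 ≤ a ^ 2 := by nlinarith [ht.1, ht.2]
  have h2 : (t - a) ^ 2 * f' t ^ 2 ≤ a ^ 2 * f' t ^ 2 := by gcongr
  nlinarith [sq_nonneg (f t - (t - a) * f' t)]

/-- The trace inequality in a boundary chart. -/
theorem Chart.exists_eLpNorm_foot_le_upper (c : Chart Ω x₀ δ) :
    ∃ C : ℝ≥0∞, C ≠ ⊤ ∧ ∀ g : Space n → ℝ, ContDiff ℝ 1 g →
      eLpNorm (fun x => g (c.foot x)) 2 (volume.restrict c.upper) ≤
        C * (eLpNorm g 2 (volume.restrict c.upper) +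
          ∑ k, eLpNorm (partialD g k) 2 (volume.restrict c.upper)) := by
  refine ⟨1 + (2 + ENNReal.ofReal (c.a ^ 2)), by finiteness, fun g hg => le_mul_of_sq_le ?_⟩
  have hgc := hg.continuous
  have hdc : Continuous fun x => fderiv ℝ g x c.ν :=
    (hg.continuous_fderiv (by simp)).clm_apply continuous_const
  have hm := c.isOpen_upper.measurableSet
  have hfoot := c.continuous_foot
  have hpart : eLpNorm (fun x => fderiv ℝ g x c.ν) 2 (volume.restrict c.upper) ≤
      ∑ k, eLpNorm (partialD g k) 2 (volume.restrict c.upper) := by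
    have hcont : ∀ k, Continuous (partialD g k) := fun k =>
      (hg.continuous_fderiv (by simp)).clm_apply continuous_const
    calc _ ≤ eLpNorm (∑ k, fun x => |partialD g k x|) 2 (volume.restrict c.upper) := by
          refine eLpNorm_mono_real fun x => ?_
          rw [Finset.sum_apply]
          refine le_trans ?_ (norm_fderiv_le_sum g x)
          simpa [c.norm_ν] using (fderiv ℝ g x).le_opNorm c.ν
      _ ≤ ∑ k, eLpNorm (fun x => |partialD g k x|) 2 (volume.restrict c.upper) :=
          eLpNorm_sum_le (fun k _ => (hcont k).abs.aestronglyMeasurable) (by norm_num)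
      _ = _ := Finset.sum_congr rfl fun k _ => eLpNorm_norm (partialD g k)
  have hmain : ∫⁻ x in c.upper, ENNReal.ofReal (g (c.foot x) ^ 2) ≤
      2 * (∫⁻ x in c.upper, ENNReal.ofReal (g x ^ 2)) +
        ENNReal.ofReal (c.a ^ 2) * ∫⁻ x in c.upper, ENNReal.ofReal (fderiv ℝ g x c.ν ^ 2) := by
    have m1 : Measurable (c.upper.indicator fun x => ENNReal.ofReal (g (c.foot x) ^ 2)) :=
      measurable_indicator_ofReal hm (by fun_prop)
    have m2 : Measurable (c.upper.indicator fun x => ENNReal.ofReal (g x ^ 2)) :=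
      measurable_indicator_ofReal hm (by fun_prop)
    have m3 : Measurable (c.upper.indicator fun x => ENNReal.ofReal (fderiv ℝ g x c.ν ^ 2)) :=
      measurable_indicator_ofReal hm (by fun_prop)
    rw [← lintegral_indicator hm, ← lintegral_indicator hm, ← lintegral_indicator hm,
      ← lintegral_const_mul _ m2, ← lintegral_const_mul _ m3,
      ← lintegral_add_left (m2.const_mul _)]
    refine lintegral_le_of_line c.ν c.norm_ν m1 ((m2.const_mul _).add (m3.const_mul _))
      fun x => ?_
    have mline : Measurable fun s : ℝ => x + s • c.ν := by fun_prop
    have m2' := m2.comp mline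
    have m3' := m3.comp mline
    simp only [Function.comp_def] at m2' m3'
    rw [lintegral_add_left (m2'.const_mul _), lintegral_const_mul _ m2', lintegral_const_mul _ m3',
      c.lintegral_upper_line, c.lintegral_upper_line, c.lintegral_upper_line]
    split_ifs with hx
    swap
    · simp
    have hd : ∀ t, HasDerivAt (fun t : ℝ => g (x + (t - c.height x) • c.ν))
        (fderiv ℝ g (x + (t - c.height x) • c.ν) c.ν) t := by
      intro t
      have h1 : HasDerivAt (fun t : ℝ => x + (t - c.height x) • c.ν) c.ν t := by
        simpa using (((hasDerivAt_id t).sub_const (c.height x)).smul_const c.ν).const_add x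
      exact (hg.differentiable (by simp) _).hasFDerivAt.comp_hasDerivAt t h1
    refine le_trans (le_of_eq ?_) (mul_sq_le_lintegral c.a_pos hd (hdc.comp (by fun_prop)))
    -- The foot is constant along the line, so the left side is a times the square of the value at
    -- height zero.
    simp_rw [c.foot_add]
    rw [setLIntegral_const, Real.volume_Ioo, sub_zero, mul_comm, ← ENNReal.ofReal_mul c.a_pos.le,
      zero_sub, ← c.foot_eq_add]
  rw [lintegral_ofReal_sq, lintegral_ofReal_sq, lintegral_ofReal_sq] at hmain
  refine hmain.trans ?_
  rw [add_mul]
  refine add_le_add ?_ ?_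
  · gcongr
    exact le_self_add
  · gcongr
    exact hpart.trans le_add_self

end BoundaryTrace

/-! ### Rigid motions on the boundary and Korn's inequality for smooth fields -/

section Korn

variable {n : ℕ} {Ω : Set (Space n)} {x₀ : Space n} {δ : ℝ}

theorem Chart.upper_nonempty (c : Chart Ω x₀ δ) : c.upper.Nonempty := by
  have ha := c.a_pos
  refine ⟨x₀ + (c.a / 2) • c.ν, ?_, ?_⟩
  · rw [c.axisDist_add]
    simpa [axisDist] using ha
  · have h0 : c.height x₀ = 0 := by simp [height, c.γ_center]
    rw [c.height_add, h0]
    constructor <;> linarith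

/-- An infinitesimal rigid motion vanishing on a piece of a Lipschitz graph is trivial. -/
theorem Chart.rigid_eq_zero (c : Chart Ω x₀ δ) {M : Fin n → Fin n → ℝ} {b : Fin n → ℝ}
    (hM : ∀ i j, M i j = -M j i)
    (h : ∀ x ∈ c.upper, ∀ i, ∑ j, M i j * c.foot x j + b i = 0) : M = 0 ∧ b = 0 := by
  obtain ⟨x₁, hx₁⟩ := c.upper_nonempty
  obtain ⟨r, hr, hball⟩ := Metric.isOpen_iff.1 c.isOpen_upper x₁ hx₁
  -- Moving the base point by v moves the foot by v - s ν, and the affine field vanishes at both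
  -- feet. Hence M v = s M ν, and M has rank at most one.
  have hloc : ∀ v : Space n, ‖v‖ < r → ∃ s : ℝ, ∀ i, ∑ j, M i j * v j = s * ∑ j, M i j * c.ν j := by
    intro v hv
    refine ⟨c.height (x₁ + v) - c.height x₁, fun i => ?_⟩
    have h1 := h _ (hball (show x₁ + v ∈ Metric.ball x₁ r by simpa using hv)) i
    have h2 := h _ hx₁ i
    have e : ∀ j, c.foot (x₁ + v) j - c.foot x₁ j =
        v j - (c.height (x₁ + v) - c.height x₁) * c.ν j := by
      intro j
      simp only [foot, PiLp.sub_apply, PiLp.add_apply, PiLp.smul_apply, smul_eq_mul]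
      ring
    have h3 : ∑ j, M i j * (c.foot (x₁ + v) j - c.foot x₁ j) = 0 := by
      simp only [mul_sub, Finset.sum_sub_distrib]
      linarith
    simp only [e, mul_sub, Finset.sum_sub_distrib] at h3
    rw [Finset.mul_sum, sub_eq_zero.1 h3]
    exact Finset.sum_congr rfl fun j _ => by ring
  set w : Space n := WithLp.toLp 2 fun i => ∑ j, M i j * c.ν j with hw
  have hscale : ∀ v : Space n, ∃ s : ℝ, ∀ i, ∑ j, M i j * v j = s * w i := by
    intro v
    obtain ⟨s, hs⟩ := hloc ((r / (2 * (1 + ‖v‖))) • v) (by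
      rw [norm_smul, Real.norm_of_nonneg (by positivity), div_mul_eq_mul_div,
        div_lt_iff₀ (by positivity)]
      nlinarith [norm_nonneg v])
    have hpos : 0 < r / (2 * (1 + ‖v‖)) := by positivity
    refine ⟨s / (r / (2 * (1 + ‖v‖))), fun i => ?_⟩
    have h1 := hs i
    have e : ∑ j, M i j * ((r / (2 * (1 + ‖v‖))) • v : Space n) j =
        (r / (2 * (1 + ‖v‖))) * ∑ j, M i j * v j := by
      rw [Finset.mul_sum]
      refine Finset.sum_congr rfl fun j _ => ?_
      simp only [PiLp.smul_apply, smul_eq_mul]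
      ring
    rw [e] at h1
    rw [div_mul_eq_mul_div, eq_div_iff hpos.ne', mul_comm, h1]
  -- With w = Mν this is ν · Mν = 0, by skewness.
  have hwν : ∑ i, c.ν i * w i = 0 := by
    have e1 : ∑ i, c.ν i * w i = ∑ i, ∑ j, c.ν i * (M i j * c.ν j) := by
      simp only [hw, Finset.mul_sum]
    have e2 : ∑ i, ∑ j, c.ν i * (M i j * c.ν j) = -∑ i, ∑ j, c.ν i * (M i j * c.ν j) := by
      conv_lhs => rw [Finset.sum_comm]
      rw [← Finset.sum_neg_distrib]
      refine Finset.sum_congr rfl fun i _ => ?_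
      rw [← Finset.sum_neg_distrib]
      refine Finset.sum_congr rfl fun j _ => ?_
      rw [hM j i]
      ring
    linarith
  -- Skewness gives ν · Mw = -|w|², whereas Mw is a multiple of w, which is orthogonal to ν.
  have hw0 : ∀ i, w i = 0 := by
    obtain ⟨s, hs⟩ := hscale w
    have e1 : ∑ i, c.ν i * ∑ j, M i j * w j = -∑ j, w j ^ 2 := by
      simp only [Finset.mul_sum]
      rw [Finset.sum_comm, ← Finset.sum_neg_distrib]
      refine Finset.sum_congr rfl fun j _ => ?_
      have : w j ^ 2 = w j * ∑ i, M j i * c.ν i := by rw [sq]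
      rw [this, Finset.mul_sum, ← Finset.sum_neg_distrib]
      refine Finset.sum_congr rfl fun i _ => ?_
      rw [hM i j]
      ring
    have e2 : ∑ i, c.ν i * ∑ j, M i j * w j = 0 := by
      simp only [hs]
      rw [← mul_zero s, ← hwν, Finset.mul_sum]
      exact Finset.sum_congr rfl fun i _ => by ring
    have e3 : ∑ j, w j ^ 2 = 0 := by linarith
    intro i
    have := (Finset.sum_eq_zero_iff_of_nonneg fun j _ => sq_nonneg (w j)).1 e3 i (Finset.mem_univ i)
    exact pow_eq_zero_iff two_ne_zero |>.1 this
  have hM0 : M = 0 := by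
    funext i k
    obtain ⟨s, hs⟩ := hscale (EuclideanSpace.single k 1)
    have := hs i
    rw [hw0 i, mul_zero] at this
    simpa [Pi.single_apply] using this
  refine ⟨hM0, funext fun i => ?_⟩
  have := h x₁ hx₁ i
  simpa [hM0] using this

/-- The coefficients of a rigid motion are controlled by its trace on a boundary chart. -/
theorem Chart.exists_rigid_le (c : Chart Ω x₀ δ) (hb : Bornology.IsBounded Ω) :
    ∃ C : ℝ≥0∞, C ≠ ⊤ ∧ ∀ (M : Fin n → Fin n → ℝ) (b : Fin n → ℝ), (∀ i j, M i j = -M j i) →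
      (∀ i j, ‖M i j‖ₑ ≤ C * ∑ k, eLpNorm (fun x => ∑ j, M k j * c.foot x j + b k) 2
        (volume.restrict c.upper)) ∧
      ∀ i, ‖b i‖ₑ ≤ C * ∑ k, eLpNorm (fun x => ∑ j, M k j * c.foot x j + b k) 2
        (volume.restrict c.upper) := by
  set μ := volume.restrict c.upper with hμ
  have hfoot := c.continuous_foot
  have hvol : volume c.upper < ⊤ := (hb.subset c.upper_subset).measure_lt_top
  have : IsFiniteMeasure μ := ⟨by simpa [hμ] using hvol⟩
  -- Injectivity below depends on restricting to skew M: a general affine field can vanish on a flat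
  -- graph.
  let S : Submodule ℝ ((Fin n → Fin n → ℝ) × (Fin n → ℝ)) :=
    { carrier := {p | ∀ i j, p.1 i j = -p.1 j i}
      zero_mem' := fun i j => by simp
      add_mem' := fun {p q} hp hq i j => by
        simp only [Prod.fst_add, Pi.add_apply, hp i j, hq i j]
        ring
      smul_mem' := fun t p hp i j => by
        simp only [Prod.smul_fst, Pi.smul_apply, smul_eq_mul, hp i j]
        ring }
  have hcont : ∀ (p : S) (k : Fin n), Continuous fun x => ∑ j, p.1.1 k j * c.foot x j + p.1.2 k := by
    intro p k
    fun_prop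
  have hmem : ∀ (p : S) (k : Fin n), MemLp (fun x => ∑ j, p.1.1 k j * c.foot x j + p.1.2 k) 2 μ := by
    intro p k
    obtain ⟨R, hR⟩ := (hb.subset c.upper_subset).isCompact_closure.exists_bound_of_continuousOn
      (hcont p k).continuousOn
    refine MemLp.of_bound (hcont p k).aestronglyMeasurable R ?_
    filter_upwards [ae_restrict_mem c.isOpen_upper.measurableSet] with x hx
    exact hR x (subset_closure hx)
  let Φ : S →ₗ[ℝ] (Fin n → Lp ℝ 2 μ) :=
    { toFun := fun p k => (hmem p k).toLp _
      map_add' := fun p q => by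
        funext k
        rw [Pi.add_apply, ← MemLp.toLp_add]
        congr 1
        funext x
        simp only [Submodule.coe_add, Prod.fst_add, Prod.snd_add, Pi.add_apply, add_mul,
          Finset.sum_add_distrib]
        ring
      map_smul' := fun t p => by
        funext k
        rw [RingHom.id_apply, Pi.smul_apply, ← MemLp.toLp_const_smul]
        congr 1
        funext x
        simp only [Submodule.coe_smul, Prod.smul_fst, Prod.smul_snd, Pi.smul_apply, smul_eq_mul,
          mul_add, Finset.mul_sum, mul_assoc] }
  have hker : Φ.ker = ⊥ := by
    rw [LinearMap.ker_eq_bot']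
    intro p hp
    have h0 : ∀ x ∈ c.upper, ∀ k, ∑ j, p.1.1 k j * c.foot x j + p.1.2 k = 0 := by
      intro x hx k
      have h1 : (hmem p k).toLp _ = 0 := congrFun hp k
      have h2 := (hmem p k).coeFn_toLp
      rw [h1] at h2
      exact Measure.eqOn_open_of_ae_eq (h2.symm.trans (Lp.coeFn_zero ℝ 2 μ)) c.isOpen_upper (hcont p k).continuousOn
        continuousOn_const hx
    obtain ⟨h1, h2⟩ := c.rigid_eq_zero p.2 h0
    exact Subtype.ext (Prod.ext h1 h2)
  -- An injective linear map on a finite-dimensional space is bounded below; this turns uniqueness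
  -- into an estimate.
  obtain ⟨K, -, hK⟩ := Φ.exists_antilipschitzWith hker
  have hbound : ∀ p : S, ‖p‖ₑ ≤ K * ∑ k, eLpNorm (fun x => ∑ j, p.1.1 k j * c.foot x j + p.1.2 k)
      2 μ := by
    intro p
    have h1 := hK p 0
    rw [map_zero, edist_zero_right, edist_zero_right] at h1
    refine h1.trans ?_
    gcongr
    have e : ∀ k, ‖Φ p k‖ₑ = eLpNorm (fun x => ∑ j, p.1.1 k j * c.foot x j + p.1.2 k) 2 μ :=
      fun k => Lp.enorm_toLp (hmem p k)
    simp_rw [← e]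
    rw [← edist_zero_right, edist_pi_le_iff]
    intro k
    rw [Pi.zero_apply, edist_zero_right]
    exact Finset.single_le_sum (f := fun k => ‖Φ p k‖ₑ) (fun _ _ => zero_le) (Finset.mem_univ k)
  refine ⟨K, ENNReal.coe_ne_top, fun M b hM => ?_⟩
  have h1 := hbound ⟨(M, b), hM⟩
  refine ⟨fun i j => le_trans ?_ h1, fun i => le_trans ?_ h1⟩
  · rw [← ofReal_norm, ← ofReal_norm]
    refine ENNReal.ofReal_le_ofReal ?_
    exact (norm_le_pi_norm (M i) j).trans ((norm_le_pi_norm M i).trans (norm_fst_le (M, b)))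
  · rw [← ofReal_norm, ← ofReal_norm]
    refine ENNReal.ofReal_le_ofReal ?_
    exact (norm_le_pi_norm b i).trans (norm_snd_le (M, b))

/-- Korn's inequality for smooth fields, with the boundary values on an open part of the boundary. -/
theorem IsLipschitzDomain.exists_korn_test (hΩ : IsLipschitzDomain Ω) (hn : 0 < n)
    {S₁ : Set (Space n)} (hS₁ : IsOpenBoundaryPart Ω S₁) :
    ∃ C : ℝ≥0∞, C ≠ ⊤ ∧ ∀ φ : Fin n → Space n → ℝ, (∀ i, IsTest (φ i)) →
      (∀ i j, eLpNorm (partialD (φ i) j) 2 (volume.restrict Ω) ≤ C * (strainSum Ω φ +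
        ∑ k, eLpNorm (φ k) 2 ((Measure.hausdorffMeasure ((n : ℝ) - 1)).restrict S₁))) ∧
      ∀ i, eLpNorm (φ i) 2 (volume.restrict Ω) ≤ C * (strainSum Ω φ +
        ∑ k, eLpNorm (φ k) 2 ((Measure.hausdorffMeasure ((n : ℝ) - 1)).restrict S₁)) := by
  obtain ⟨⟨x₀, hx₀⟩, O, hO, rfl⟩ := hS₁
  obtain ⟨δ, hδ, hball⟩ := Metric.isOpen_iff.1 hO x₀ hx₀.2
  obtain ⟨c⟩ := hΩ.nonempty_chart hx₀.1 hδ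
  obtain ⟨C₁, hC₁, h₁⟩ := hΩ.exists_korn_rigid hn
  obtain ⟨C₂, hC₂, h₂⟩ := c.exists_eLpNorm_foot_le hΩ.isOpen hn hO hball
  obtain ⟨C₃, hC₃, h₃⟩ := c.exists_eLpNorm_foot_le_upper
  obtain ⟨C₄, hC₄, h₄⟩ := c.exists_rigid_le hΩ.isBounded
  obtain ⟨R, hR⟩ := hΩ.isBounded.exists_norm_le
  set μ := volume.restrict Ω with hμ
  set σ := (Measure.hausdorffMeasure ((n : ℝ) - 1)).restrict (frontier Ω ∩ O) with hσ
  set v : ℝ≥0∞ := eLpNorm (fun _ : Space n => (1 : ℝ)) 2 μ with hv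
  have hvt : v ≠ ⊤ := by
    have : IsFiniteMeasure μ := ⟨by simpa [hμ] using hΩ.isBounded.measure_lt_top⟩
    exact (memLp_const (1 : ℝ)).2.ne
  set C₅ : ℝ≥0∞ := n * (C₂ + C₃ * (C₁ + n * C₁)) with hC₅
  set C₆ : ℝ≥0∞ := C₄ * C₅ with hC₆
  have hC₆t : C₆ ≠ ⊤ := by finiteness
  refine ⟨C₁ + C₆ * v + (n * ENNReal.ofReal R + 1) * C₆ * v, by finiteness, fun φ hφ => ?_⟩
  obtain ⟨M, b, hM, hgrad, hval⟩ := h₁ φ hφ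
  set e := strainSum Ω φ + ∑ k, eLpNorm (φ k) 2 σ with he
  have hse : strainSum Ω φ ≤ e := le_self_add
  have hlin : ∀ i, ContDiff ℝ ∞ fun x : Space n => ∑ j, M i j * x j + b i := fun i => by fun_prop
  have hlinD : ∀ i k x, partialD (fun x : Space n => φ i x - (∑ j, M i j * x j + b i)) k x =
      partialD (φ i) k x - M i k := by
    intro i k x
    unfold partialD
    have h1 : HasFDerivAt (fun x : Space n => ∑ j, M i j * x j + b i)
        (∑ j, M i j • (EuclideanSpace.proj j : Space n →L[ℝ] ℝ)) x := by
      refine (HasFDerivAt.fun_sum fun j _ => ?_).add_const _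
      exact (EuclideanSpace.proj j : Space n →L[ℝ] ℝ).hasFDerivAt.const_mul (M i j)
    rw [(((hφ i).1.differentiable (by simp) x).hasFDerivAt.fun_sub h1).fderiv]
    simp
  have hμle : volume.restrict c.upper ≤ μ := Measure.restrict_mono c.upper_subset le_rfl
  -- On the graph, rigid motion = φ - (φ - rigid motion). The first term is bounded by the boundary
  -- norm on S₁, the second by the trace inequality applied to a difference that is already small in
  -- terms of the strain.
  have htrace : ∀ i, eLpNorm (fun x => ∑ j, M i j * c.foot x j + b i) 2 (volume.restrict c.upper) ≤
      (C₂ + C₃ * (C₁ + n * C₁)) * e := by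
    intro i
    have hsm : ContDiff ℝ 1 fun x : Space n => φ i x - (∑ j, M i j * x j + b i) :=
      ((hφ i).1.sub (hlin i)).of_le (by simp)
    have h5 := h₃ _ hsm
    have h6 := h₂ (φ i) (hφ i).1.continuous
    have hfoot := c.continuous_foot
    have hφc := (hφ i).1.continuous
    have e1 : (fun x => ∑ j, M i j * c.foot x j + b i) = (fun x => φ i (c.foot x)) -
        fun x => φ i (c.foot x) - (∑ j, M i j * c.foot x j + b i) := by
      funext x
      simp
    rw [e1]
    refine (eLpNorm_sub_le ?_ ?_ (by norm_num)).trans ?_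
    · exact (hφc.comp hfoot).aestronglyMeasurable
    · exact (hsm.continuous.comp hfoot).aestronglyMeasurable
    rw [add_mul, mul_assoc C₃]
    refine add_le_add (h6.trans ?_) (h5.trans ?_)
    · gcongr
      exact (Finset.single_le_sum (f := fun k => eLpNorm (φ k) 2 σ) (fun _ _ => zero_le)
        (Finset.mem_univ i)).trans le_add_self
    · gcongr
      rw [add_mul]
      refine add_le_add ?_ ?_
      · exact (eLpNorm_mono_measure _ hμle).trans ((hval i).trans (by gcongr))
      · calc _ ≤ ∑ _k : Fin n, C₁ * e := by
              refine Finset.sum_le_sum fun k _ => ?_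
              rw [show partialD (fun x : Space n => φ i x - (∑ j, M i j * x j + b i)) k =
                fun x => partialD (φ i) k x - M i k from funext (hlinD i k)]
              exact (eLpNorm_mono_measure _ hμle).trans ((hgrad i k).trans (by gcongr))
          _ = _ := by simp [mul_assoc]
  have hsum : ∑ k, eLpNorm (fun x => ∑ j, M k j * c.foot x j + b k) 2 (volume.restrict c.upper) ≤
      C₅ * e := by
    refine (Finset.sum_le_sum fun k _ => htrace k).trans ?_
    simp [hC₅, mul_assoc]
  obtain ⟨hMc, hbc⟩ := h₄ M b hM
  have hMe : ∀ i j, ‖M i j‖ₑ ≤ C₆ * e := fun i j => (hMc i j).trans (by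
    rw [hC₆, mul_assoc]
    gcongr)
  have hbe : ∀ i, ‖b i‖ₑ ≤ C₆ * e := fun i => (hbc i).trans (by
    rw [hC₆, mul_assoc]
    gcongr)
  have hconst : ∀ t : ℝ, eLpNorm (fun _ : Space n => t) 2 μ = ‖t‖ₑ * v := by
    intro t
    have : (fun _ : Space n => t) = t • fun _ : Space n => (1 : ℝ) := by
      funext x
      simp
    rw [this, eLpNorm_const_smul]
  refine ⟨fun i j => ?_, fun i => ?_⟩
  · have e1 : partialD (φ i) j = (fun x => partialD (φ i) j x - M i j) + fun _ => M i j := by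
      funext x
      simp
    rw [e1]
    refine (eLpNorm_add_le ?_ aestronglyMeasurable_const (by norm_num)).trans ?_
    · exact (((hφ i).partialD_continuous j).sub continuous_const).aestronglyMeasurable
    rw [hconst, add_mul]
    refine le_trans ?_ le_self_add
    rw [add_mul]
    refine add_le_add ((hgrad i j).trans (by gcongr)) ?_
    rw [mul_right_comm]
    gcongr
    exact hMe i j
  · have e1 : φ i = (fun x => φ i x - (∑ j, M i j * x j + b i)) +
        fun x => ∑ j, M i j * x j + b i := by
      funext x
      simp
    have hc1 := (hφ i).1.continuous
    have hc2 := (hlin i).continuous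
    rw [e1]
    refine (eLpNorm_add_le ?_ hc2.aestronglyMeasurable (by norm_num)).trans ?_
    · exact (hc1.sub hc2).aestronglyMeasurable
    rw [add_mul, add_mul, add_right_comm]
    refine le_trans ?_ le_self_add
    refine add_le_add ((hval i).trans (by gcongr)) ?_
    have e2 : (fun x : Space n => ∑ j, M i j * x j + b i) =
        (∑ j, fun x : Space n => M i j * x j) + fun _ => b i := by
      funext x
      simp
    rw [e2]
    refine (eLpNorm_add_le (Finset.aestronglyMeasurable_sum _ fun j _ =>
      (by fun_prop : Continuous fun x : Space n => M i j * x j).aestronglyMeasurable)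
      aestronglyMeasurable_const (by norm_num)).trans ?_
    rw [hconst, add_mul, one_mul, add_mul, add_mul]
    refine add_le_add ?_ ?_
    · refine (eLpNorm_sum_le (fun j _ =>
        (by fun_prop : Continuous fun x : Space n => M i j * x j).aestronglyMeasurable)
        (by norm_num)).trans ?_
      calc _ ≤ ∑ _j : Fin n, ENNReal.ofReal R * C₆ * v * e := by
            refine Finset.sum_le_sum fun j _ => ?_
            have h7 : eLpNorm (fun x : Space n => M i j * x j) 2 μ ≤
                eLpNorm (fun _ : Space n => M i j * R) 2 μ := by
              refine eLpNorm_mono_ae ?_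
              filter_upwards [ae_restrict_mem hΩ.isOpen.measurableSet] with x hx
              rw [norm_mul, norm_mul]
              gcongr
              exact (PiLp.norm_apply_le x j).trans ((hR x hx).trans (le_abs_self R))
            have hR0 : 0 ≤ R := by
              obtain ⟨x, hx⟩ := hΩ.isConnected.nonempty
              exact (norm_nonneg x).trans (hR x hx)
            rw [hconst, enorm_mul, Real.enorm_of_nonneg hR0] at h7
            refine h7.trans ?_
            calc _ ≤ (C₆ * e) * ENNReal.ofReal R * v := by
                  gcongr
                  exact hMe i j
              _ = _ := by ring
        _ = _ := by simp [mul_assoc]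
    · rw [mul_right_comm]
      gcongr
      exact hbe i

end Korn

/-! ### Korn's inequality on X and completeness of X -/

section SolutionSpace

variable {n : ℕ} {Ω S₁ : Set (Space n)}

/-- The rate of strain as an element of `L₂(Ω)`. -/
def strainLp (u : H1 Ω) (i j : Fin n) : L2 Ω := (1 / 2 : ℝ) • (u.1.2 i j + u.1.2 j i)

theorem strain_ae_eq (u : H1 Ω) (i j : Fin n) :
    strain u i j =ᵐ[volume.restrict Ω] strainLp u i j := by
  filter_upwards [Lp.coeFn_smul (1 / 2 : ℝ) (u.1.2 i j + u.1.2 j i),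
    Lp.coeFn_add (u.1.2 i j) (u.1.2 j i)] with x h1 h2
  rw [strainLp, h1, Pi.smul_apply, h2, Pi.add_apply, strain, grad, grad, smul_eq_mul]
  ring

theorem strainLp_add (u v : H1 Ω) (i j : Fin n) :
    strainLp (u + v) i j = strainLp u i j + strainLp v i j := by
  have h : ∀ i j, (u + v).1.2 i j = u.1.2 i j + v.1.2 i j := fun _ _ => rfl
  simp only [strainLp, h]
  module

theorem strainLp_sub (u v : H1 Ω) (i j : Fin n) :
    strainLp (u - v) i j = strainLp u i j - strainLp v i j := by
  have h : ∀ i j, (u - v).1.2 i j = u.1.2 i j - v.1.2 i j := fun _ _ => rfl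
  simp only [strainLp, h]
  module

theorem strainLp_smul (c : ℝ) (u : H1 Ω) (i j : Fin n) :
    strainLp (c • u) i j = c • strainLp u i j := by
  have h : ∀ i j, (c • u).1.2 i j = c • u.1.2 i j := fun _ _ => rfl
  simp only [strainLp, h]
  module

theorem memLp_strain (u : H1 Ω) (i j : Fin n) : MemLp (strain u i j) 2 (volume.restrict Ω) :=
  (memLp_congr_ae (strain_ae_eq u i j)).2 (Lp.memLp _)

theorem integral_strain_mul (u h : H1 Ω) (i j : Fin n) :
    ∫ x in Ω, strain u i j x * strain h i j x = ⟪strainLp u i j, strainLp h i j⟫ := by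
  rw [L2.inner_def]
  refine integral_congr_ae ?_
  filter_upwards [strain_ae_eq u i j, strain_ae_eq h i j] with x h1 h2
  rw [h1, h2]
  exact mul_comm _ _

theorem integrable_inv2 (u : H1 Ω) : Integrable (inv2 u) (volume.restrict Ω) :=
  integrable_finsetSum _ fun i _ => integrable_finsetSum _ fun j _ =>
    (memLp_strain u i j).integrable_sq

theorem inv2_nonneg (u : H1 Ω) (x : Space n) : 0 ≤ inv2 u x :=
  Finset.sum_nonneg fun i _ => Finset.sum_nonneg fun j _ => sq_nonneg (strain u i j x)

theorem integral_inv2 (u : H1 Ω) : ∫ x in Ω, inv2 u x = ∑ i, ∑ j, ‖strainLp u i j‖ ^ 2 := by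
  have h : ∀ i j, ∫ x in Ω, strain u i j x ^ 2 = ‖strainLp u i j‖ ^ 2 := by
    intro i j
    rw [← real_inner_self_eq_norm_sq, ← integral_strain_mul]
    simp only [sq]
  simp only [← h]
  unfold inv2
  rw [integral_finsetSum _ fun i _ => integrable_finsetSum _ fun j _ =>
    (memLp_strain u i j).integrable_sq]
  refine Finset.sum_congr rfl fun i _ => ?_
  exact integral_finsetSum _ fun j _ => (memLp_strain u i j).integrable_sq

theorem normX_nonneg (u : X Ω S₁) : 0 ≤ normX u := Real.sqrt_nonneg _

theorem norm_strainLp_le (u : H1 Ω) (i j : Fin n) : ‖strainLp u i j‖ ≤ √(∫ x in Ω, inv2 u x) := by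
  refine Real.le_sqrt_of_sq_le ?_
  rw [integral_inv2]
  exact (Finset.single_le_sum (f := fun j => ‖strainLp u i j‖ ^ 2) (fun _ _ => sq_nonneg _)
    (Finset.mem_univ j)).trans (Finset.single_le_sum (f := fun i => ∑ j, ‖strainLp u i j‖ ^ 2)
    (fun _ _ => Finset.sum_nonneg fun _ _ => sq_nonneg _) (Finset.mem_univ i))

theorem eLpNorm_strain_le_sqrt (u : H1 Ω) (i j : Fin n) :
    eLpNorm (strain u i j) 2 (volume.restrict Ω) ≤ ENNReal.ofReal √(∫ x in Ω, inv2 u x) := by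
  rw [eLpNorm_congr_ae (strain_ae_eq u i j), ← Lp.enorm_def, ← ofReal_norm]
  exact ENNReal.ofReal_le_ofReal (norm_strainLp_le u i j)

/-- Compares the strain of a smooth approximation with that of its limit, with an error that
vanishes under H¹ convergence. -/
theorem strainSum_le_add (u : H1 Ω) {φ : Fin n → Space n → ℝ} (hφ : ∀ i, IsTest (φ i)) :
    strainSum Ω φ ≤ ∑ i, ∑ j, eLpNorm (strain u i j) 2 (volume.restrict Ω) + ∑ i, ∑ j,
      (eLpNorm (fun x => partialD (φ i) j x - grad u i j x) 2 (volume.restrict Ω) +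
        eLpNorm (fun x => partialD (φ j) i x - grad u j i x) 2 (volume.restrict Ω)) := by
  rw [strainSum, ← Finset.sum_add_distrib]
  refine Finset.sum_le_sum fun i _ => ?_
  rw [← Finset.sum_add_distrib]
  refine Finset.sum_le_sum fun j _ => ?_
  have hm : ∀ i j, AEStronglyMeasurable (fun x => partialD (φ i) j x - grad u i j x)
      (volume.restrict Ω) := fun i j => ((hφ i).partialD_continuous j).aestronglyMeasurable.sub
        (Lp.aestronglyMeasurable (u.1.2 i j))
  have hhalf : ∀ f : Space n → ℝ, eLpNorm ((1 / 2 : ℝ) • f) 2 (volume.restrict Ω) ≤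
      eLpNorm f 2 (volume.restrict Ω) := by
    intro f
    rw [eLpNorm_const_smul]
    refine mul_le_of_le_one_left zero_le ?_
    rw [← ofReal_norm]
    simp
  have e : (fun x => (partialD (φ i) j x + partialD (φ j) i x) / 2) = strain u i j +
      ((1 / 2 : ℝ) • (fun x => partialD (φ i) j x - grad u i j x) +
        (1 / 2 : ℝ) • fun x => partialD (φ j) i x - grad u j i x) := by
    funext x
    simp only [strain, Pi.add_apply, Pi.smul_apply, smul_eq_mul]
    ring
  rw [e]
  refine (eLpNorm_add_le (memLp_strain _ _ _).1 (((hm i j).const_smul _).add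
    ((hm j i).const_smul _)) (by norm_num)).trans (add_le_add le_rfl ?_)
  exact (eLpNorm_add_le ((hm i j).const_smul _) ((hm j i).const_smul _) (by norm_num)).trans
    (add_le_add (hhalf _) (hhalf _))

/-- Korn's inequality for fields in `H¹(Ω)ⁿ` with vanishing trace. -/
theorem IsLipschitzDomain.exists_korn_hasTrace (hΩ : IsLipschitzDomain Ω) (hn : 0 < n)
    (hS₁ : IsOpenBoundaryPart Ω S₁) :
    ∃ K : ℝ, 0 ≤ K ∧ ∀ u : H1 Ω, HasTrace S₁ u 0 →
      (∀ i j, ‖u.1.2 i j‖ ≤ K * √(∫ x in Ω, inv2 u x)) ∧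
      ∀ i, ‖u.1.1 i‖ ≤ K * √(∫ x in Ω, inv2 u x) := by
  obtain ⟨C, hC, hkorn⟩ := hΩ.exists_korn_test hn hS₁
  set μ := volume.restrict Ω with hμ
  set σ := (Measure.hausdorffMeasure ((n : ℝ) - 1)).restrict S₁ with hσ
  refine ⟨(C * (n * n)).toReal, ENNReal.toReal_nonneg, fun u htr => ?_⟩
  obtain ⟨φ, hφ, h1, h2, h3⟩ := htr
  set N := √(∫ x in Ω, inv2 u x) with hN
  set s := ∑ i, ∑ j, eLpNorm (strain u i j) 2 μ with hs
  have hsle : s ≤ n * n * ENNReal.ofReal N := by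
    refine (Finset.sum_le_sum fun i _ => Finset.sum_le_sum fun j _ =>
      eLpNorm_strain_le_sqrt u i j).trans ?_
    simp [mul_assoc, hN]
  have hstrain : ∀ m, strainSum Ω (φ m) ≤ s + ∑ i, ∑ j,
      (eLpNorm (fun x => partialD (φ m i) j x - grad u i j x) 2 μ +
        eLpNorm (fun x => partialD (φ m j) i x - grad u j i x) 2 μ) :=
    fun m => strainSum_le_add u (hφ m)
  -- For the smooth fields approximating u, the boundary term and the gradient errors tend to zero,
  -- which leaves only the strain of u.
  have hlimS : Tendsto (fun m => C * (s + ∑ i, ∑ j,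
      (eLpNorm (fun x => partialD (φ m i) j x - grad u i j x) 2 μ +
        eLpNorm (fun x => partialD (φ m j) i x - grad u j i x) 2 μ) +
        ∑ k, eLpNorm (φ m k) 2 σ)) atTop (𝓝 (C * s)) := by
    refine ENNReal.Tendsto.const_mul ?_ (Or.inr hC)
    have t1 : Tendsto (fun m => ∑ i, ∑ j,
        (eLpNorm (fun x => partialD (φ m i) j x - grad u i j x) 2 μ +
          eLpNorm (fun x => partialD (φ m j) i x - grad u j i x) 2 μ)) atTop (𝓝 0) := by
      have : (0 : ℝ≥0∞) = ∑ _i : Fin n, ∑ _j : Fin n, (0 + 0) := by simp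
      rw [this]
      exact tendsto_finsetSum _ fun i _ => tendsto_finsetSum _ fun j _ => (h2 i j).add (h2 j i)
    have t2 : Tendsto (fun m => ∑ k, eLpNorm (φ m k) 2 σ) atTop (𝓝 0) := by
      have : (0 : ℝ≥0∞) = ∑ _i : Fin n, 0 := by simp
      rw [this]
      refine tendsto_finsetSum _ fun k _ => ?_
      simpa using h3 k
    simpa using (tendsto_const_nhds (x := s)).add t1 |>.add t2
  have hfin : C * s ≤ ENNReal.ofReal ((C * (n * n)).toReal * N) := by
    rw [ENNReal.ofReal_mul ENNReal.toReal_nonneg, ENNReal.ofReal_toReal (by finiteness), mul_assoc]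
    gcongr
  have hgen : ∀ (v : L2 Ω) (ψ : ℕ → Space n → ℝ), (∀ m, Continuous (ψ m)) →
      Tendsto (fun m => eLpNorm (fun x => ψ m x - v x) 2 μ) atTop (𝓝 0) →
      (∀ m, eLpNorm (ψ m) 2 μ ≤ C * (strainSum Ω (φ m) + ∑ k, eLpNorm (φ m k) 2 σ)) →
      ‖v‖ ≤ (C * (n * n)).toReal * N := by
    intro v ψ hψ hlim hle
    have hmain : ‖v‖ₑ ≤ C * s := by
      have ht := hlim.add hlimS
      rw [zero_add] at ht
      refine ge_of_tendsto' ht fun m => ?_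
      rw [Lp.enorm_def]
      have e : (v : Space n → ℝ) = ψ m - fun x => ψ m x - v x := by
        funext x
        simp
      conv_lhs => rw [e]
      refine (eLpNorm_sub_le (hψ m).aestronglyMeasurable
        ((hψ m).aestronglyMeasurable.sub (Lp.aestronglyMeasurable v)) (by norm_num)).trans ?_
      rw [add_comm]
      refine add_le_add le_rfl ((hle m).trans ?_)
      gcongr
      exact hstrain m
    have := hmain.trans hfin
    rw [← ofReal_norm] at this
    exact (ENNReal.ofReal_le_ofReal_iff (mul_nonneg ENNReal.toReal_nonneg (Real.sqrt_nonneg _))).1 this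
  exact ⟨fun i j => hgen _ _ (fun m => (hφ m i).partialD_continuous j) (h2 i j)
      fun m => (hkorn (φ m) (hφ m)).1 i j,
    fun i => hgen _ _ (fun m => (hφ m i).1.continuous) (h1 i) fun m => (hkorn (φ m) (hφ m)).2 i⟩

/-- Korn's inequality on `X`. -/
theorem IsLipschitzDomain.exists_korn (hΩ : IsLipschitzDomain Ω) (hn : 0 < n)
    (hS₁ : IsOpenBoundaryPart Ω S₁) :
    ∃ K : ℝ, 0 ≤ K ∧ ∀ u : X Ω S₁, (∀ i j, ‖u.1.1.2 i j‖ ≤ K * normX u) ∧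
      ∀ i, ‖u.1.1.1 i‖ ≤ K * normX u := by
  obtain ⟨K, hK, h⟩ := hΩ.exists_korn_hasTrace hn hS₁
  exact ⟨K, hK, fun u => h u.1 u.2⟩

theorem IsWeakDeriv.of_tendsto {j : Fin n} {u g : ℕ → L2 Ω} {u' g' : L2 Ω}
    (h : ∀ m, IsWeakDeriv j (u m) (g m)) (hu : Tendsto u atTop (𝓝 u'))
    (hg : Tendsto g atTop (𝓝 g')) : IsWeakDeriv j u' g' := by
  intro φ hφ hs
  have h1 := (hφ.partialD j).memLp Ω
  have h2 := hφ.memLp Ω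
  rw [← inner_toLp_left h1, ← inner_toLp_left h2]
  have t1 := (tendsto_const_nhds (x := h1.toLp _)).inner (𝕜 := ℝ) hu
  have t2 := ((tendsto_const_nhds (x := h2.toLp _)).inner (𝕜 := ℝ) hg).neg
  refine tendsto_nhds_unique t1 (t2.congr fun m => ?_)
  rw [inner_toLp_left, inner_toLp_left, h m φ hφ hs]

/-- A diagonal choice: for each m take a smooth field within 1/m of u m in all the norms at once.
The tolerance is infinite at m = 0, which is harmless. -/
theorem HasTrace.of_tendsto {u : ℕ → H1 Ω} {v : H1 Ω} (h : ∀ m, HasTrace S₁ (u m) 0)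
    (hu : ∀ i, Tendsto (fun m => (u m).1.1 i) atTop (𝓝 (v.1.1 i)))
    (hg : ∀ i j, Tendsto (fun m => (u m).1.2 i j) atTop (𝓝 (v.1.2 i j))) : HasTrace S₁ v 0 := by
  have hex : ∀ m : ℕ, ∃ φ : Fin n → Space n → ℝ, (∀ i, IsTest (φ i)) ∧
      (∀ i, eLpNorm (fun x => φ i x - comp (u m) i x) 2 (volume.restrict Ω) < (m : ℝ≥0∞)⁻¹) ∧
      (∀ i j, eLpNorm (fun x => partialD (φ i) j x - grad (u m) i j x) 2 (volume.restrict Ω) <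
        (m : ℝ≥0∞)⁻¹) ∧
      (∀ i, eLpNorm (fun x => φ i x - (0 : Space n → Fin n → ℝ) x i) 2
        ((Measure.hausdorffMeasure ((n : ℝ) - 1)).restrict S₁) < (m : ℝ≥0∞)⁻¹) := by
    intro m
    obtain ⟨φ, hφ, h1, h2, h3⟩ := h m
    have hpos : (0 : ℝ≥0∞) < (m : ℝ≥0∞)⁻¹ := by simp
    obtain ⟨k, hk⟩ := ((eventually_all.2 fun i => (h1 i).eventually_lt_const hpos).and
      ((eventually_all.2 fun i => eventually_all.2 fun j => (h2 i j).eventually_lt_const hpos).and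
        (eventually_all.2 fun i => (h3 i).eventually_lt_const hpos))).exists
    exact ⟨φ k, hφ k, hk⟩
  choose φ hφ h1 h2 h3 using hex
  have hinv := ENNReal.tendsto_inv_nat_nhds_zero
  have hsq : ∀ {a : ℕ → ℝ≥0∞}, (∀ m : ℕ, a m < (m : ℝ≥0∞)⁻¹) → Tendsto a atTop (𝓝 0) := fun ha =>
    tendsto_of_tendsto_of_tendsto_of_le_of_le tendsto_const_nhds hinv (fun _ => zero_le)
      fun m => (ha m).le
  refine ⟨φ, hφ, fun i => ?_, fun i j => ?_, fun i => hsq fun m => h3 m i⟩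
  · refine tendsto_eLpNorm_add (b := fun m x => comp (u m) i x - comp v i x) (fun m => ?_)
      (fun m => ?_) (fun m => ?_) (hsq fun m => h1 m i)
      ((Lp.tendsto_Lp_iff_tendsto_eLpNorm' _ _).1 (hu i))
    · exact (hφ m i).1.continuous.aestronglyMeasurable.sub
        (Lp.aestronglyMeasurable ((u m).1.1 i))
    · exact (Lp.aestronglyMeasurable ((u m).1.1 i)).sub (Lp.aestronglyMeasurable (v.1.1 i))
    · exact Eventually.of_forall fun x => by simp
  · refine tendsto_eLpNorm_add (b := fun m x => grad (u m) i j x - grad v i j x) (fun m => ?_)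
      (fun m => ?_) (fun m => ?_) (hsq fun m => h2 m i j)
      ((Lp.tendsto_Lp_iff_tendsto_eLpNorm' _ _).1 (hg i j))
    · exact ((hφ m i).partialD_continuous j).aestronglyMeasurable.sub
        (Lp.aestronglyMeasurable ((u m).1.2 i j))
    · exact (Lp.aestronglyMeasurable ((u m).1.2 i j)).sub (Lp.aestronglyMeasurable (v.1.2 i j))
    · exact Eventually.of_forall fun x => by simp

theorem H1.sub_val (u v : H1 Ω) (i : Fin n) : (u - v).1.1 i = u.1.1 i - v.1.1 i := rfl

theorem H1.sub_grad (u v : H1 Ω) (i j : Fin n) : (u - v).1.2 i j = u.1.2 i j - v.1.2 i j := rfl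

/-- Korn's inequality applied to the differences makes all components and derivatives Cauchy in L₂,
and weak derivatives pass to the limit. -/
theorem IsLipschitzDomain.exists_tendsto_of_hasTrace (hΩ : IsLipschitzDomain Ω) (hn : 0 < n)
    (hS₁ : IsOpenBoundaryPart Ω S₁) (u : ℕ → H1 Ω) (htr : ∀ m k, HasTrace S₁ (u m - u k) 0)
    (hu : ∀ ε > 0, ∃ N, ∀ m ≥ N, ∀ k ≥ N, √(∫ x in Ω, inv2 (u m - u k) x) < ε) :
    ∃ v : H1 Ω, (∀ i, Tendsto (fun m => (u m).1.1 i) atTop (𝓝 (v.1.1 i))) ∧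
      ∀ i j, Tendsto (fun m => (u m).1.2 i j) atTop (𝓝 (v.1.2 i j)) := by
  obtain ⟨K, hK, hkorn⟩ := hΩ.exists_korn_hasTrace hn hS₁
  have hcau : ∀ w : ℕ → L2 Ω, (∀ m k, ‖w m - w k‖ ≤ K * √(∫ x in Ω, inv2 (u m - u k) x)) →
      ∃ w', Tendsto w atTop (𝓝 w') := by
    intro w hw
    refine cauchySeq_tendsto_of_complete (Metric.cauchySeq_iff.2 fun ε hε => ?_)
    obtain ⟨N, hN⟩ := hu (ε / (K + 1)) (by positivity)
    refine ⟨N, fun m hm k hk => ?_⟩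
    rw [dist_eq_norm]
    have h1 := hN m hm k hk
    rw [lt_div_iff₀ (by positivity)] at h1
    have h2 := Real.sqrt_nonneg (∫ x in Ω, inv2 (u m - u k) x)
    linarith [hw m k]
  have hw : ∀ i, ∃ w', Tendsto (fun m => (u m).1.1 i) atTop (𝓝 w') := by
    refine fun i => hcau _ fun m k => ?_
    rw [← H1.sub_val]
    exact (hkorn _ (htr m k)).2 i
  have hg : ∀ i j, ∃ g', Tendsto (fun m => (u m).1.2 i j) atTop (𝓝 g') := by
    refine fun i j => hcau _ fun m k => ?_
    rw [← H1.sub_grad]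
    exact (hkorn _ (htr m k)).1 i j
  choose w hw using hw
  choose g hg using hg
  exact ⟨⟨(w, g), fun i j => IsWeakDeriv.of_tendsto (fun m => (u m).2 i j) (hw i) (hg i j)⟩, hw, hg⟩

theorem tendsto_sqrt_integral_inv2 {u : ℕ → H1 Ω} {v : H1 Ω}
    (h : ∀ i j, Tendsto (fun m => (u m).1.2 i j) atTop (𝓝 (v.1.2 i j))) :
    Tendsto (fun m => √(∫ x in Ω, inv2 (u m - v) x)) atTop (𝓝 0) := by
  rw [← Real.sqrt_zero]
  refine Tendsto.sqrt ?_
  simp_rw [integral_inv2]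
  have : (0 : ℝ) = ∑ _i : Fin n, ∑ _j : Fin n, 0 ^ 2 := by simp
  rw [this]
  refine tendsto_finsetSum _ fun i _ => tendsto_finsetSum _ fun j _ => Tendsto.pow ?_ 2
  simp_rw [strainLp, H1.sub_grad]
  have h3 := (((h i j).sub_const (v.1.2 i j)).add ((h j i).sub_const (v.1.2 j i))).const_smul
    (1 / 2 : ℝ) |>.norm
  simpa using h3

/-- `X` is complete. -/
theorem IsLipschitzDomain.exists_tendsto_normX (hΩ : IsLipschitzDomain Ω) (hn : 0 < n)
    (hS₁ : IsOpenBoundaryPart Ω S₁) (u : ℕ → X Ω S₁)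
    (hu : ∀ ε > 0, ∃ N, ∀ m ≥ N, ∀ k ≥ N, normX (u m - u k) < ε) :
    ∃ v : X Ω S₁, Tendsto (fun m => normX (u m - v)) atTop (𝓝 0) := by
  have hsub : ∀ m k, HasTrace S₁ ((u m).1 - (u k).1) 0 := fun m k =>
    (X Ω S₁).sub_mem (u m).2 (u k).2
  have hu' : ∀ ε > 0, ∃ N, ∀ m ≥ N, ∀ k ≥ N, √(∫ x in Ω, inv2 ((u m).1 - (u k).1) x) < ε := hu
  have h := hΩ.exists_tendsto_of_hasTrace hn hS₁ (fun m => (u m).1) hsub hu'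
  obtain ⟨v, hv1, hv2⟩ := h
  have hv : HasTrace S₁ v 0 := HasTrace.of_tendsto (fun m => (u m).2) hv1 hv2
  have : Tendsto (fun m => √(∫ x in Ω, inv2 ((u m).1 - v) x)) atTop (𝓝 0) :=
    tendsto_sqrt_integral_inv2 hv2
  exact ⟨⟨v, hv⟩, this⟩

/-- A smooth field as an element of `H¹(Ω)ⁿ`. -/
def H1.ofTest (φ : Fin n → Space n → ℝ) (hφ : ∀ i, IsTest (φ i)) : H1 Ω :=
  ⟨(fun i => ((hφ i).memLp Ω).toLp _, fun i j => (((hφ i).partialD j).memLp Ω).toLp _), by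
    intro i j ψ hψ hs
    have e1 : ∫ x in Ω, ((hφ i).memLp Ω).toLp _ x * partialD ψ j x =
        ∫ x in Ω, φ i x * partialD ψ j x := by
      refine integral_congr_ae ?_
      filter_upwards [((hφ i).memLp Ω).coeFn_toLp] with x hx
      rw [hx]
    have e2 : ∫ x in Ω, (((hφ i).partialD j).memLp Ω).toLp _ x * ψ x =
        ∫ x in Ω, partialD (φ i) j x * ψ x := by
      refine integral_congr_ae ?_
      filter_upwards [(((hφ i).partialD j).memLp Ω).coeFn_toLp] with x hx
      rw [hx]
    rw [e1, e2, setIntegral_mul_of_tsupport ((tsupport_partialD_subset _ _).trans hs),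
      setIntegral_mul_of_tsupport hs]
    exact integral_mul_partialD (hφ i) hψ j⟩

/-- Supplies the nonzero vector on which q₁ ≤ q₃ is tested: a bump function supported in Ω, repeated
in each component. -/
theorem IsLipschitzDomain.nontrivial_X (hΩ : IsLipschitzDomain Ω) (hn : 0 < n)
    (hS₁ : IsOpenBoundaryPart Ω S₁) : Nontrivial (X Ω S₁) := by
  obtain ⟨x, hx⟩ := hΩ.isConnected.nonempty
  obtain ⟨ψ, hψs, hψc, hψ, -, hψx⟩ := exists_contDiff_tsupport_subset (n := ⊤)
    (hΩ.isOpen.mem_nhds hx)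
  have hφ : ∀ _i : Fin n, IsTest ψ := fun _ => ⟨hψ, hψc⟩
  have hψ0 : ∀ y ∈ S₁, ψ y = 0 := by
    obtain ⟨-, O, -, rfl⟩ := hS₁
    intro y hy
    by_contra hne
    have h1 : y ∈ Ω := hψs (subset_tsupport ψ hne)
    have h2 := hΩ.isOpen.inter_frontier_eq
    exact (h2 ▸ (⟨h1, hy.1⟩ : y ∈ Ω ∩ frontier Ω) : y ∈ (∅ : Set _))
  have hS₁m : MeasurableSet S₁ := by
    obtain ⟨-, O, hO, rfl⟩ := hS₁
    exact isClosed_frontier.measurableSet.inter hO.measurableSet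
  let v₀ : H1 Ω := H1.ofTest (fun _ => ψ) hφ
  have htr : HasTrace S₁ v₀ 0 := by
    refine ⟨fun _ _ => ψ, fun _ => hφ, fun i => ?_, fun i j => ?_, fun i => ?_⟩
    · have e : (fun x => ψ x - comp v₀ i x) =ᵐ[volume.restrict Ω] 0 := by
        filter_upwards [((hφ i).memLp Ω).coeFn_toLp] with x hx
        have : comp v₀ i x = ψ x := hx
        simp [this]
      simp [eLpNorm_congr_ae e]
    · have e : (fun x => partialD ψ j x - grad v₀ i j x) =ᵐ[volume.restrict Ω] 0 := by
        filter_upwards [(((hφ i).partialD j).memLp Ω).coeFn_toLp] with x hx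
        have : grad v₀ i j x = partialD ψ j x := hx
        simp [this]
      simp [eLpNorm_congr_ae e]
    · have e : (fun x => ψ x - (0 : Space n → Fin n → ℝ) x i)
          =ᵐ[(Measure.hausdorffMeasure ((n : ℝ) - 1)).restrict S₁] 0 := by
        filter_upwards [ae_restrict_mem hS₁m] with y hy
        simp [hψ0 y hy]
      simp only [eLpNorm_congr_ae e, eLpNorm_zero]
      exact tendsto_const_nhds
  refine ⟨⟨⟨v₀, htr⟩, 0, fun h => ?_⟩⟩
  have h1 : ((hφ ⟨0, hn⟩).memLp Ω).toLp ψ = 0 :=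
    congrArg (fun w : X Ω S₁ => w.1.1.1 ⟨0, hn⟩) h
  have h2 := ((hφ ⟨0, hn⟩).memLp Ω).coeFn_toLp
  rw [h1] at h2
  have h3 := Measure.eqOn_open_of_ae_eq (h2.symm.trans (Lp.coeFn_zero ℝ 2 _)) hΩ.isOpen
    hψ.continuous.continuousOn continuousOn_const hx
  rw [hψx] at h3
  exact one_ne_zero h3

end SolutionSpace

/-! ### The abstract contraction argument -/

section Iteration

/-- The quadratic is (1 - q₁s)² + (q₃² - q₁²)s². -/
theorem one_sub_add_nonneg {q₁ q₃ : ℝ} (h₁ : 0 < q₁) (h₃ : q₁ ≤ q₃) (s : ℝ) :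
    0 ≤ 1 - 2 * q₁ * s + q₃ ^ 2 * s ^ 2 := by
  have h : q₁ ^ 2 * s ^ 2 ≤ q₃ ^ 2 * s ^ 2 := by gcongr
  nlinarith [sq_nonneg (1 - q₁ * s)]

theorem rate_lt_one {q₁ q₃ t : ℝ} (h₁ : 0 < q₁) (h₃ : q₁ ≤ q₃)
    (ht : t ∈ Ioo 0 (2 * q₁ * (q₃ ^ 2)⁻¹)) : rate q₁ q₃ t < 1 := by
  have hq : 0 < q₃ ^ 2 := by have := h₁.trans_le h₃; positivity
  have h2 : q₃ ^ 2 * t < 2 * q₁ := by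
    have := mul_lt_mul_of_pos_left ht.2 hq
    rwa [mul_comm (2 * q₁), mul_inv_cancel_left₀ hq.ne'] at this
  rw [rate, Real.sqrt_lt' one_pos]
  nlinarith [ht.1]

theorem argmin_rate_mem {q₁ q₃ : ℝ} (h₁ : 0 < q₁) (h₃ : q₁ ≤ q₃) :
    q₁ * (q₃ ^ 2)⁻¹ ∈ Ioo 0 (2 * q₁ * (q₃ ^ 2)⁻¹) := by
  have h3 := h₁.trans_le h₃
  have : 0 < q₁ * (q₃ ^ 2)⁻¹ := by positivity
  exact ⟨this, by rw [mul_assoc]; linarith⟩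

theorem rate_argmin {q₁ q₃ : ℝ} (h₁ : 0 < q₁) (h₃ : q₁ ≤ q₃) :
    rate q₁ q₃ (q₁ * (q₃ ^ 2)⁻¹) = √(1 - q₁ ^ 2 * (q₃ ^ 2)⁻¹) := by
  have h3 := h₁.trans_le h₃
  rw [rate]
  congr 1
  field_simp
  ring

/-- Completing the square: the radicands differ by (q₃s - q₁/q₃)². -/
theorem rate_argmin_le {q₁ q₃ : ℝ} (h₁ : 0 < q₁) (h₃ : q₁ ≤ q₃) (s : ℝ) :
    rate q₁ q₃ (q₁ * (q₃ ^ 2)⁻¹) ≤ rate q₁ q₃ s := by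
  have h3 := h₁.trans_le h₃
  rw [rate_argmin h₁ h₃, rate]
  refine Real.sqrt_le_sqrt ?_
  have e : 1 - 2 * q₁ * s + q₃ ^ 2 * s ^ 2 - (1 - q₁ ^ 2 * (q₃ ^ 2)⁻¹) =
      (q₃ * s - q₁ * q₃⁻¹) ^ 2 := by
    field_simp
    ring
  nlinarith [sq_nonneg (q₃ * s - q₁ * q₃⁻¹)]

section Hilbert

variable {H : Type*} [NormedAddCommGroup H] [InnerProductSpace ℝ H]

/-- Expand the square of (u - v) - t(G u - G v): strong monotonicity handles the cross term, the
Lipschitz bound the quadratic one. -/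
theorem norm_step_sub_le {q₁ q₃ t : ℝ} {G : H → H} (ht : 0 ≤ t)
    (hmono : ∀ u v, q₁ * ‖u - v‖ ^ 2 ≤ ⟪G u - G v, u - v⟫)
    (hlip : ∀ u v, ‖G u - G v‖ ≤ q₃ * ‖u - v‖) (u v : H) :
    ‖(u - t • G u) - (v - t • G v)‖ ≤ rate q₁ q₃ t * ‖u - v‖ := by
  have e : (u - t • G u) - (v - t • G v) = (u - v) - t • (G u - G v) := by module
  have h1 : ‖(u - t • G u) - (v - t • G v)‖ ^ 2 ≤
      (1 - 2 * q₁ * t + q₃ ^ 2 * t ^ 2) * ‖u - v‖ ^ 2 := by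
    rw [e, norm_sub_sq_real, inner_smul_right, norm_smul, Real.norm_of_nonneg ht, real_inner_comm]
    have h2 : ‖G u - G v‖ ^ 2 ≤ (q₃ * ‖u - v‖) ^ 2 :=
      pow_le_pow_left₀ (norm_nonneg _) (hlip u v) 2
    have h3 := mul_le_mul_of_nonneg_left (hmono u v) ht
    have h4 := mul_le_mul_of_nonneg_left h2 (sq_nonneg t)
    nlinarith
  rw [rate, ← Real.sqrt_sq (norm_nonneg (u - v)), ← Real.sqrt_mul' _ (sq_nonneg _)]
  exact Real.le_sqrt_of_sq_le h1

/-- Test both bounds with h = u - v for one pair u ≠ v. This is why the radicand of the rate is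
nonnegative. -/
theorem le_of_strongly_monotone_of_lipschitz [Nontrivial H] {q₁ q₃ : ℝ} {F : H → H →ₗ[ℝ] ℝ}
    (hmono : ∀ u v, q₁ * ‖u - v‖ ^ 2 ≤ F u (u - v) - F v (u - v))
    (hlip : ∀ u v h, |F u h - F v h| ≤ q₃ * ‖u - v‖ * ‖h‖) : q₁ ≤ q₃ := by
  obtain ⟨u, v, huv⟩ := exists_pair_ne H
  have h0 : 0 < ‖u - v‖ := norm_pos_iff.2 (sub_ne_zero.2 huv)
  have h1 := (hmono u v).trans ((le_abs_self _).trans (hlip u v (u - v)))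
  rw [mul_assoc, ← sq] at h1
  exact le_of_mul_le_mul_right h1 (by positivity)

/-- The preconditioned gradient iteration for a strongly monotone Lipschitz operator in a Hilbert
space. -/
theorem exists_iteration_hilbert [CompleteSpace H] [Nontrivial H] {q₁ q₃ : ℝ} (hq₁ : 0 < q₁)
    (F : H → H →ₗ[ℝ] ℝ) (hF : ∀ u, ∃ C : ℝ, ∀ h, |F u h| ≤ C * ‖h‖)
    (hmono : ∀ u v, q₁ * ‖u - v‖ ^ 2 ≤ F u (u - v) - F v (u - v))
    (hlip : ∀ u v h, |F u h - F v h| ≤ q₃ * ‖u - v‖ * ‖h‖) :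
    ∃ u, (∀ h, F u h = 0) ∧ (∀ v, (∀ h, F v h = 0) → v = u) ∧
      ∀ t ∈ Ioo 0 (2 * q₁ * (q₃ ^ 2)⁻¹),
        (∀ v, ∃! w, ∀ h, ⟪w, h⟫ = ⟪v, h⟫ - t * F v h) ∧
        (∀ v v' w w', (∀ h, ⟪w, h⟫ = ⟪v, h⟫ - t * F v h) →
          (∀ h, ⟪w', h⟫ = ⟪v', h⟫ - t * F v' h) → ‖w - w'‖ ≤ rate q₁ q₃ t * ‖v - v'‖) ∧
        (∀ useq : ℕ → H, (∀ m h, ⟪useq (m + 1), h⟫ = ⟪useq m, h⟫ - t * F (useq m) h) →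
          Tendsto (fun m => ‖useq m - u‖) atTop (𝓝 0) ∧
          ∀ m, ‖useq m - u‖ ≤ rate q₁ q₃ t ^ m / (1 - rate q₁ q₃ t) *
            (t * sInf {C : ℝ | 0 ≤ C ∧ ∀ h, |F (useq 0) h| ≤ C * ‖h‖})) := by
  have hq₃ : q₁ ≤ q₃ := le_of_strongly_monotone_of_lipschitz hmono hlip
  choose C hC using hF
  -- The Riesz representer of F u, which turns the weak form of a step into w = v - t G v.
  set G : H → H := fun u => (InnerProductSpace.toDual ℝ H).symm ((F u).mkContinuous (C u) (hC u))
    with hG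
  have hGF : ∀ u h, ⟪G u, h⟫ = F u h := fun u h => by
    rw [hG, InnerProductSpace.toDual_symm_apply]
    rfl
  have hGmono : ∀ u v, q₁ * ‖u - v‖ ^ 2 ≤ ⟪G u - G v, u - v⟫ := fun u v => by
    rw [inner_sub_left, hGF, hGF]
    exact hmono u v
  have hGlip : ∀ u v, ‖G u - G v‖ ≤ q₃ * ‖u - v‖ := fun u v => by
    by_contra hlt
    push Not at hlt
    have h1 := (le_abs_self _).trans (hlip u v (G u - G v))
    rw [← hGF, ← hGF, ← inner_sub_left, real_inner_self_eq_norm_sq, sq] at h1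
    have h2 : 0 < ‖G u - G v‖ := lt_of_le_of_lt
      (mul_nonneg (hq₁.trans_le hq₃).le (norm_nonneg _)) hlt
    exact absurd (le_of_mul_le_mul_right h1 h2) (not_le.2 hlt)
  have hstep : ∀ t v w, (∀ h, ⟪w, h⟫ = ⟪v, h⟫ - t * F v h) ↔ w = v - t • G v := by
    intro t v w
    constructor
    · intro h
      refine ext_inner_right ℝ fun k => ?_
      rw [h k, inner_sub_left, real_inner_smul_left, hGF]
    · rintro rfl h
      rw [inner_sub_left, real_inner_smul_left, hGF]
  have hcontr : ∀ t ∈ Ioo 0 (2 * q₁ * (q₃ ^ 2)⁻¹),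
      ContractingWith ⟨rate q₁ q₃ t, Real.sqrt_nonneg _⟩ fun v => v - t • G v := by
    intro t ht
    refine ⟨rate_lt_one hq₁ hq₃ ht, LipschitzWith.of_dist_le_mul fun u v => ?_⟩
    rw [dist_eq_norm, dist_eq_norm]
    exact norm_step_sub_le ht.1.le hGmono hGlip u v
  have ht₀ := argmin_rate_mem hq₁ hq₃
  -- Any admissible step size would do, since a fixed point of v ↦ v - t G v with t ≠ 0 is a zero of
  -- G. The optimal t₀ is one that is already known to be admissible.
  obtain ⟨u, hu⟩ : ∃ u, G u = 0 := by
    refine ⟨(hcontr _ ht₀).fixedPoint, ?_⟩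
    have h1 : _ - _ • G _ = _ := (hcontr _ ht₀).fixedPoint_isFixedPt
    rw [sub_eq_self, smul_eq_zero] at h1
    exact h1.resolve_left ht₀.1.ne'
  have huniq : ∀ v, (∀ h, F v h = 0) → v = u := by
    intro v hv
    have h1 := hGmono v u
    rw [inner_sub_left, hGF, hv, hu, inner_zero_left, sub_zero] at h1
    have h2 : ‖v - u‖ ^ 2 ≤ 0 := by
      by_contra hpos
      push Not at hpos
      exact absurd h1 (not_le.2 (mul_pos hq₁ hpos))
    have h3 : ‖v - u‖ = 0 := pow_eq_zero_iff two_ne_zero |>.1 (le_antisymm h2 (sq_nonneg _))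
    exact sub_eq_zero.1 (norm_eq_zero.1 h3)
  refine ⟨u, fun h => by rw [← hGF, hu, inner_zero_left], huniq, fun t ht => ⟨fun v => ?_, ?_, ?_⟩⟩
  · exact ⟨v - t • G v, (hstep t v _).2 rfl, fun w hw => (hstep t v w).1 hw⟩
  · intro v v' w w' hw hw'
    rw [(hstep t v w).1 hw, (hstep t v' w').1 hw']
    exact norm_step_sub_le ht.1.le hGmono hGlip v v'
  · intro useq hseq
    have hk := rate_lt_one hq₁ hq₃ ht
    have hk0 : 0 ≤ rate q₁ q₃ t := Real.sqrt_nonneg _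
    -- The zero of G is a fixed point for every t, so all step sizes share the same limit.
    have hfix : u = (hcontr t ht).fixedPoint :=
      (hcontr t ht).fixedPoint_unique (by simp [Function.IsFixedPt, hu])
    have hiter : ∀ m, useq m = (fun v => v - t • G v)^[m] (useq 0) := by
      intro m
      induction m with
      | zero => rfl
      | succ m ih => rw [Function.iterate_succ_apply', ← ih, ← hstep t]; exact hseq m
    have hbound : ∀ m, ‖useq m - u‖ ≤ rate q₁ q₃ t ^ m / (1 - rate q₁ q₃ t) *
        (t * ‖G (useq 0)‖) := by
      intro m
      have h1 := (hcontr t ht).apriori_dist_iterate_fixedPoint_le (useq 0) m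
      rw [← hiter, ← hfix, dist_eq_norm, dist_eq_norm, sub_sub_cancel, norm_smul,
        Real.norm_of_nonneg ht.1.le] at h1
      refine h1.trans (le_of_eq ?_)
      change t * ‖G (useq 0)‖ * rate q₁ q₃ t ^ m / (1 - rate q₁ q₃ t) = _
      ring
    -- Testing with h = G (useq 0) shows that every admissible constant is at least ‖G (useq 0)‖;
    -- the first summand shows that the set is nonempty. Only this direction of the equality of
    -- norms is needed.
    have hdual : ‖G (useq 0)‖ ≤ sInf {C : ℝ | 0 ≤ C ∧ ∀ h, |F (useq 0) h| ≤ C * ‖h‖} := by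
      refine le_csInf ⟨‖G (useq 0)‖, norm_nonneg _, fun h => ?_⟩ ?_
      · rw [← hGF]
        exact abs_real_inner_le_norm _ _
      · rintro c ⟨hc0, hc⟩
        by_contra hlt
        push Not at hlt
        have h1 := (le_abs_self _).trans (hc (G (useq 0)))
        rw [← hGF, real_inner_self_eq_norm_sq, sq] at h1
        exact absurd (le_of_mul_le_mul_right h1 (hc0.trans_lt hlt)) (not_le.2 hlt)
    refine ⟨?_, fun m => (hbound m).trans ?_⟩
    · refine squeeze_zero (fun _ => norm_nonneg _) hbound ?_
      have h1 := ((tendsto_pow_atTop_nhds_zero_of_lt_one hk0 hk).div_const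
        (1 - rate q₁ q₃ t)).mul_const (t * ‖G (useq 0)‖)
      simpa using h1
    · have := ht.1.le
      have := sub_pos.2 hk
      gcongr

end Hilbert

/-- The iteration preconditioned by a symmetric positive definite form `A`, for a strongly monotone
and Lipschitz residual `F`. -/
theorem exists_iteration {V : Type*} [AddCommGroup V] [Module ℝ V] [Nontrivial V]
    (A : V →ₗ[ℝ] V →ₗ[ℝ] ℝ) (hsymm : ∀ u v, A u v = A v u) (hnonneg : ∀ u, 0 ≤ A u u)
    (hdef : ∀ u, A u u = 0 → u = 0)
    (hcomplete : ∀ u : ℕ → V,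
      (∀ ε > 0, ∃ N, ∀ m ≥ N, ∀ k ≥ N, √(A (u m - u k) (u m - u k)) < ε) →
      ∃ v, Tendsto (fun m => √(A (u m - v) (u m - v))) atTop (𝓝 0))
    {q₁ q₃ : ℝ} (hq₁ : 0 < q₁) (F : V → V →ₗ[ℝ] ℝ)
    (hF : ∀ u, ∃ C : ℝ, ∀ h, |F u h| ≤ C * √(A h h))
    (hmono : ∀ u v, q₁ * A (u - v) (u - v) ≤ F u (u - v) - F v (u - v))
    (hlip : ∀ u v h, |F u h - F v h| ≤ q₃ * √(A (u - v) (u - v)) * √(A h h)) :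
    q₁ ≤ q₃ ∧ ∃ u, (∀ h, F u h = 0) ∧ (∀ v, (∀ h, F v h = 0) → v = u) ∧
      ∀ t ∈ Ioo 0 (2 * q₁ * (q₃ ^ 2)⁻¹),
        (∀ v, ∃! w, ∀ h, A w h = A v h - t * F v h) ∧
        (∀ v v' w w', (∀ h, A w h = A v h - t * F v h) →
          (∀ h, A w' h = A v' h - t * F v' h) →
          √(A (w - w') (w - w')) ≤ rate q₁ q₃ t * √(A (v - v') (v - v'))) ∧
        (∀ useq : ℕ → V, (∀ m h, A (useq (m + 1)) h = A (useq m) h - t * F (useq m) h) →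
          Tendsto (fun m => √(A (useq m - u) (useq m - u))) atTop (𝓝 0) ∧
          ∀ m, √(A (useq m - u) (useq m - u)) ≤ rate q₁ q₃ t ^ m / (1 - rate q₁ q₃ t) *
            (t * sInf {C : ℝ | 0 ≤ C ∧ ∀ h, |F (useq 0) h| ≤ C * √(A h h)})) := by
  -- The form A becomes the inner product of V, so that √(A u u) is definitionally the norm and
  -- Cauchy sequences are those of the hypothesis `hcomplete`.
  let core : InnerProductSpace.Core ℝ V :=
    { inner := fun u v => A u v
      conj_inner_symm := fun u v => hsymm v u
      re_inner_nonneg := hnonneg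
      add_left := fun u v w => by simp
      smul_left := fun u v c => by simp
      definite := hdef }
  let _ : NormedAddCommGroup V := core.toNormedAddCommGroup
  let _ : InnerProductSpace ℝ V := InnerProductSpace.ofCore core.toCore
  have hnorm : ∀ u : V, √(A u u) = ‖u‖ := fun u => rfl
  have : CompleteSpace V := by
    refine Metric.complete_of_cauchySeq_tendsto fun u hu => ?_
    obtain ⟨v, hv⟩ := hcomplete u (by
      simp_rw [hnorm, ← dist_eq_norm]
      exact Metric.cauchySeq_iff.1 hu)
    exact ⟨v, tendsto_iff_norm_sub_tendsto_zero.2 hv⟩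
  have hmono' : ∀ u v, q₁ * ‖u - v‖ ^ 2 ≤ F u (u - v) - F v (u - v) := by
    intro u v
    rw [← hnorm, Real.sq_sqrt (hnonneg _)]
    exact hmono u v
  exact ⟨le_of_strongly_monotone_of_lipschitz hmono' hlip,
    exists_iteration_hilbert hq₁ F hF hmono' hlip⟩

end Iteration

/-! ### Pointwise estimates for the nonlinear stress -/

section Viscosity

/-- Superposition with a Carathéodory function preserves measurability. -/
theorem aemeasurable_caratheodory {α Y : Type*} [MeasurableSpace α] {μ : Measure α}
    [PseudoEMetricSpace Y] [MeasurableSpace Y] [OpensMeasurableSpace Y] {s : Set Y}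
    [TopologicalSpace.SeparableSpace s] {f : Y → α → ℝ}
    (hf : ∀ᵐ x ∂μ, ContinuousOn (fun y => f y x) s) (hm : ∀ y ∈ s, AEMeasurable (f y) μ)
    {g : α → Y} (hg : AEMeasurable g μ) (hgs : ∀ x, g x ∈ s) :
    AEMeasurable (fun x => f (g x) x) μ := by
  classical
  rcases isEmpty_or_nonempty α with hα | ⟨⟨x₀⟩⟩
  · exact (measurable_of_empty _).aemeasurable
  -- Approximate g by simple functions with values in s. For each of them the superposition is
  -- measurable piece by piece, and continuity on s gives the limit almost everywhere.
  let S : ℕ → SimpleFunc α Y :=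
    SimpleFunc.approxOn (hg.mk g) hg.measurable_mk s (g x₀) (hgs x₀)
  have hS : ∀ k x, S k x ∈ s := fun k x => SimpleFunc.approxOn_mem _ _ k x
  refine aemeasurable_of_tendsto_metrizable_ae atTop (f := fun k x => f (S k x) x) (fun k => ?_) ?_
  · have e : (fun x => f (S k x) x) = fun x => ∑ y ∈ (S k).range, (S k ⁻¹' {y}).indicator (f y) x := by
      funext x
      rw [Finset.sum_eq_single (S k x)]
      · exact (indicator_of_mem (show x ∈ S k ⁻¹' {S k x} from rfl) _).symm
      · intro y _ hy
        have hx : x ∉ S k ⁻¹' {y} := fun h => hy (mem_singleton_iff.1 h).symm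
        exact indicator_of_notMem hx _
      · exact fun h => absurd ((S k).mem_range_self x) h
    rw [e]
    refine Finset.aemeasurable_fun_sum _ fun y hy => ?_
    obtain ⟨x, rfl⟩ := SimpleFunc.mem_range.1 hy
    exact (hm _ (hS k x)).indicator ((S k).measurableSet_fiber _)
  · filter_upwards [hf, hg.ae_eq_mk] with x hx hgx
    have h1 : Tendsto (fun k => S k x) atTop (𝓝 (hg.mk g x)) :=
      SimpleFunc.tendsto_approxOn _ _ (subset_closure (hgx ▸ hgs x))
    rw [← hgx] at h1
    exact (hx (g x) (hgs x)).tendsto.comp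
      (tendsto_nhdsWithin_iff.2 ⟨h1, Eventually.of_forall fun k => hS k x⟩)

section Pointwise

variable {W : Type*} [NormedAddCommGroup W] [InnerProductSpace ℝ W]

/-- Testing against a fixed ζ makes θ(|p|²)⟪p, ζ⟫ scalar along the segment p from η to ξ, so the
mean value theorem gives an exact identity at one point z. A one-sided derivative of θ at 0 suffices
because |p|² never leaves [0, ∞). -/
theorem exists_mean_value_radial {θ θ' : ℝ → ℝ}
    (hθ : ∀ y, 0 ≤ y → HasDerivWithinAt θ (θ' y) (Ici 0) y) (ξ η ζ : W) :
    ∃ z : W, θ (‖ξ‖ ^ 2) * ⟪ξ, ζ⟫ - θ (‖η‖ ^ 2) * ⟪η, ζ⟫ =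
      θ (‖z‖ ^ 2) * ⟪ξ - η, ζ⟫ + 2 * θ' (‖z‖ ^ 2) * ⟪z, ξ - η⟫ * ⟪z, ζ⟫ := by
  set p : ℝ → W := fun s => η + s • (ξ - η) with hp
  have hd : ∀ s, HasDerivAt p (ξ - η) s := fun s => by
    exact (((hasDerivAt_id s).smul_const (ξ - η)).const_add η).congr_deriv (one_smul _ _)
  have hf : ∀ s, HasDerivAt (fun s => θ (‖p s‖ ^ 2) * ⟪p s, ζ⟫)
      (θ (‖p s‖ ^ 2) * ⟪ξ - η, ζ⟫ + 2 * θ' (‖p s‖ ^ 2) * ⟪p s, ξ - η⟫ * ⟪p s, ζ⟫) s := by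
    intro s
    have h1 : HasDerivAt (fun s => ‖p s‖ ^ 2) (2 * ⟪p s, ξ - η⟫) s := (hd s).norm_sq
    have h2 : HasDerivAt (fun s => θ (‖p s‖ ^ 2)) (θ' (‖p s‖ ^ 2) * (2 * ⟪p s, ξ - η⟫)) s :=
      HasDerivWithinAt.comp_hasDerivAt (h := fun s => ‖p s‖ ^ 2) s (hθ _ (sq_nonneg ‖p s‖)) h1
        (Eventually.of_forall fun s => sq_nonneg ‖p s‖)
    have h3 : HasDerivAt (fun s => ⟪p s, ζ⟫) ⟪ξ - η, ζ⟫ s := by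
      simpa using (hd s).inner ℝ (hasDerivAt_const s ζ)
    exact (h2.fun_mul h3).congr_deriv (by ring)
  obtain ⟨s, -, hs⟩ := exists_hasDerivAt_eq_slope _ _ one_pos
    (fun s _ => (hf s).continuousAt.continuousWithinAt) fun s _ => hf s
  refine ⟨p s, ?_⟩
  rw [hs]
  simp [hp]

/-- With ζ = ξ - η the mean value is θ|ζ|² + 2θ'⟪z, ζ⟫². If θ' ≥ 0, the first term alone suffices;
if θ' ≤ 0, Cauchy–Schwarz bounds it below by (θ + 2θ'|z|²)|ζ|². Hence both hypotheses are needed. -/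
theorem radial_strongly_monotone {θ θ' : ℝ → ℝ} {m : ℝ}
    (hθ : ∀ y, 0 ≤ y → HasDerivWithinAt θ (θ' y) (Ici 0) y) (h₁ : ∀ y, 0 ≤ y → m ≤ θ y)
    (h₂ : ∀ y, 0 ≤ y → m ≤ θ y + 2 * θ' y * y) (ξ η : W) :
    m * ‖ξ - η‖ ^ 2 ≤ θ (‖ξ‖ ^ 2) * ⟪ξ, ξ - η⟫ - θ (‖η‖ ^ 2) * ⟪η, ξ - η⟫ := by
  obtain ⟨z, hz⟩ := exists_mean_value_radial hθ ξ η (ξ - η)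
  rw [hz, real_inner_self_eq_norm_sq]
  have hc : ⟪z, ξ - η⟫ ^ 2 ≤ ‖z‖ ^ 2 * ‖ξ - η‖ ^ 2 := by
    rw [← mul_pow, ← sq_abs]
    exact pow_le_pow_left₀ (abs_nonneg _) (abs_real_inner_le_norm _ _) 2
  have h0 := sq_nonneg ‖ξ - η‖
  have k1 := mul_le_mul_of_nonneg_right (h₁ _ (sq_nonneg ‖z‖)) h0
  have k2 := mul_le_mul_of_nonneg_right (h₂ _ (sq_nonneg ‖z‖)) h0
  rcases le_total 0 (θ' (‖z‖ ^ 2)) with h | h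
  · have := mul_nonneg h (sq_nonneg ⟪z, ξ - η⟫)
    nlinarith
  · have := mul_le_mul_of_nonpos_left hc h
    nlinarith

theorem abs_radial_sub_le {θ θ' : ℝ → ℝ} {M : ℝ}
    (hθ : ∀ y, 0 ≤ y → HasDerivWithinAt θ (θ' y) (Ici 0) y) (h₁ : ∀ y, 0 ≤ y → 0 ≤ θ y)
    (h₂ : ∀ y, 0 ≤ y → θ y + 2 * |θ' y| * y ≤ M) (ξ η ζ : W) :
    |θ (‖ξ‖ ^ 2) * ⟪ξ, ζ⟫ - θ (‖η‖ ^ 2) * ⟪η, ζ⟫| ≤ M * (‖ξ - η‖ * ‖ζ‖) := by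
  obtain ⟨z, hz⟩ := exists_mean_value_radial hθ ξ η ζ
  rw [hz]
  calc _ ≤ |θ (‖z‖ ^ 2) * ⟪ξ - η, ζ⟫| + |2 * θ' (‖z‖ ^ 2) * ⟪z, ξ - η⟫ * ⟪z, ζ⟫| :=
        abs_add_le _ _
    _ ≤ θ (‖z‖ ^ 2) * (‖ξ - η‖ * ‖ζ‖) +
        2 * |θ' (‖z‖ ^ 2)| * (‖z‖ * ‖ξ - η‖) * (‖z‖ * ‖ζ‖) := by
        simp only [abs_mul, abs_two, abs_of_nonneg (h₁ _ (sq_nonneg ‖z‖))]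
        have := h₁ _ (sq_nonneg ‖z‖)
        gcongr <;> exact abs_real_inner_le_norm _ _
    _ = (θ (‖z‖ ^ 2) + 2 * |θ' (‖z‖ ^ 2)| * ‖z‖ ^ 2) * (‖ξ - η‖ * ‖ζ‖) := by ring
    _ ≤ _ := by
        gcongr
        exact h₂ _ (sq_nonneg ‖z‖)

/-- The viscosity `y ↦ κ (λ + y)^{-1/2} + ψ(y)`. -/
def viscosity (lam κ : ℝ) (ψ : ℝ → ℝ) (y : ℝ) : ℝ := κ * (√(lam + y))⁻¹ + ψ y

variable {lam κ a₁ a₂ a₃ a₄ a₅ : ℝ} {ψ : ℝ → ℝ}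

/-- The derivative of the viscosity. -/
def viscosityDeriv (lam κ : ℝ) (ψ : ℝ → ℝ) (y : ℝ) : ℝ :=
  -(κ / (2 * √(lam + y) ^ 3)) + derivWithin ψ (Ici 0) y

theorem hasDerivWithinAt_viscosity (hlam : 0 < lam) (hψ : ContDiffOn ℝ 1 ψ (Ici 0)) {y : ℝ}
    (hy : 0 ≤ y) :
    HasDerivWithinAt (viscosity lam κ ψ) (viscosityDeriv lam κ ψ y) (Ici 0) y := by
  have hpos : 0 < lam + y := by positivity
  have hs : 0 < √(lam + y) := Real.sqrt_pos.2 hpos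
  have h1 : HasDerivAt (fun y => κ * (√(lam + y))⁻¹) (-(κ / (2 * √(lam + y) ^ 3))) y := by
    have h2 : HasDerivAt (fun y => √(lam + y)) (1 / (2 * √(lam + y))) y :=
      ((hasDerivAt_id y).const_add lam).sqrt hpos.ne'
    refine ((h2.fun_inv hs.ne').const_mul κ).congr_deriv ?_
    field_simp
  exact h1.hasDerivWithinAt.add
    ((hψ.differentiableOn (by simp) y hy).hasDerivWithinAt)

theorem le_viscosity (hκ : 0 ≤ κ) {y : ℝ} (h : a₁ ≤ ψ y) : a₁ ≤ viscosity lam κ ψ y :=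
  h.trans (le_add_of_nonneg_left (mul_nonneg hκ (inv_nonneg.2 (Real.sqrt_nonneg _))))

theorem mul_inv_sqrt_le (hlam : 0 < lam) (hκ : 0 ≤ κ) (hκ' : κ ≤ a₅) {y : ℝ} (hy : 0 ≤ y) :
    κ * (√(lam + y))⁻¹ ≤ a₅ * (√lam)⁻¹ := by
  have : 0 < √lam := Real.sqrt_pos.2 hlam
  have : √lam ≤ √(lam + y) := Real.sqrt_le_sqrt (by linarith)
  have : 0 ≤ a₅ := hκ.trans hκ'
  gcongr

theorem viscosity_le (hlam : 0 < lam) (hκ : 0 ≤ κ) (hκ' : κ ≤ a₅) {y : ℝ} (hy : 0 ≤ y)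
    (h : ψ y ≤ a₂) : viscosity lam κ ψ y ≤ a₅ * (√lam)⁻¹ + a₂ :=
  add_le_add (mul_inv_sqrt_le hlam hκ hκ' hy) h

/-- The term κ(λ + y)^{-1/2} contributes κλ(λ + y)^{-3/2} ≥ 0 and so does not spoil the bound on ψ.
-/
theorem le_viscosity_add (hlam : 0 < lam) (hκ : 0 ≤ κ) {y : ℝ} (hy : 0 ≤ y)
    (h : a₃ ≤ ψ y + 2 * derivWithin ψ (Ici 0) y * y) :
    a₃ ≤ viscosity lam κ ψ y + 2 * viscosityDeriv lam κ ψ y * y := by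
  have hpos : 0 < lam + y := by positivity
  have hs : 0 < √(lam + y) := Real.sqrt_pos.2 hpos
  have hsq : √(lam + y) ^ 2 = lam + y := Real.sq_sqrt hpos.le
  have e : κ * (√(lam + y))⁻¹ + 2 * -(κ / (2 * √(lam + y) ^ 3)) * y =
      κ * lam / √(lam + y) ^ 3 := by
    field_simp
    rw [hsq]
    ring
  have : 0 ≤ κ * lam / √(lam + y) ^ 3 := by positivity
  simp only [viscosity, viscosityDeriv]
  linarith

/-- The term κ(λ + y)^{-1/2} is counted twice, once for itself and once for its derivative, since 2y
times the modulus of that derivative is at most the term itself. This accounts for 2a₅λ^{-1/2}. -/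
theorem viscosity_add_le (hlam : 0 < lam) (hκ : 0 ≤ κ) (hκ' : κ ≤ a₅) {y : ℝ} (hy : 0 ≤ y)
    (h : ψ y ≤ a₂) (h' : |derivWithin ψ (Ici 0) y| * y ≤ a₄) :
    viscosity lam κ ψ y + 2 * |viscosityDeriv lam κ ψ y| * y ≤
      a₂ + 2 * a₄ + 2 * a₅ * (√lam)⁻¹ := by
  have hpos : 0 < lam + y := by positivity
  have hs : 0 < √(lam + y) := Real.sqrt_pos.2 hpos
  have hsq : √(lam + y) ^ 2 = lam + y := Real.sq_sqrt hpos.le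
  have h1 : |viscosityDeriv lam κ ψ y| ≤ κ / (2 * √(lam + y) ^ 3) + |derivWithin ψ (Ici 0) y| := by
    refine (abs_add_le _ _).trans (add_le_add ?_ le_rfl)
    rw [abs_neg, abs_of_nonneg (by positivity)]
  have h2 : 2 * (κ / (2 * √(lam + y) ^ 3)) * y ≤ κ * (√(lam + y))⁻¹ := by
    have : κ * (√(lam + y))⁻¹ - 2 * (κ / (2 * √(lam + y) ^ 3)) * y =
        κ * lam / √(lam + y) ^ 3 := by
      field_simp
      rw [hsq]
      ring
    have : 0 ≤ κ * lam / √(lam + y) ^ 3 := by positivity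
    linarith
  have h3 := mul_inv_sqrt_le hlam hκ hκ' hy
  have h4 := mul_le_mul_of_nonneg_right h1 hy
  rw [viscosity]
  linarith

end Pointwise

end Viscosity

/-! ### The energy norm and the divergence form -/

section Energy

variable {n : ℕ} {Ω S₁ : Set (Space n)}

/-- The rate of strain tensor at a point, as a vector with `n²` components. -/
def strainVec (u : H1 Ω) (x : Space n) : EuclideanSpace ℝ (Fin n × Fin n) :=
  WithLp.toLp 2 fun p => strain u p.1 p.2 x

/-- `‖u‖_X`, for any field in `H¹(Ω)ⁿ`. -/
def energyNorm (u : H1 Ω) : ℝ := √(∫ x in Ω, inv2 u x)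

theorem energyNorm_nonneg (u : H1 Ω) : 0 ≤ energyNorm u := Real.sqrt_nonneg _

theorem norm_strainVec_sq (u : H1 Ω) (x : Space n) : ‖strainVec u x‖ ^ 2 = inv2 u x := by
  rw [EuclideanSpace.norm_sq_eq, Fintype.sum_prod_type]
  simp [strainVec, inv2]

theorem inner_strainVec (u h : H1 Ω) (x : Space n) :
    ⟪strainVec u x, strainVec h x⟫ = strainDot u h x := by
  rw [PiLp.inner_apply, Fintype.sum_prod_type]
  simp only [strainVec, strainDot, RCLike.inner_apply, conj_trivial]
  exact Finset.sum_congr rfl fun i _ => Finset.sum_congr rfl fun j _ => mul_comm _ _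

/-- `strain` is computed from chosen representatives, so linear identities between strains hold only
almost everywhere. They are proved for the L₂ classes and transferred by this lemma. -/
theorem ae_strain {P : (Fin n → Fin n → ℝ) → (Fin n → Fin n → ℝ) → (Fin n → Fin n → ℝ) → Prop}
    (u v w : H1 Ω)
    (h : ∀ᵐ x ∂volume.restrict Ω, P (fun i j => strainLp u i j x) (fun i j => strainLp v i j x)
      (fun i j => strainLp w i j x)) :
    ∀ᵐ x ∂volume.restrict Ω, P (fun i j => strain u i j x) (fun i j => strain v i j x)
      (fun i j => strain w i j x) := by
  have hs : ∀ u : H1 Ω, ∀ᵐ x ∂volume.restrict Ω,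
      (fun i j => strain u i j x) = fun i j => strainLp u i j x := by
    intro u
    filter_upwards [ae_all_iff.2 fun i => ae_all_iff.2 fun j => strain_ae_eq u i j] with x hx
    funext i j
    exact hx i j
  filter_upwards [h, hs u, hs v, hs w] with x h1 h2 h3 h4
  rwa [h2, h3, h4]

theorem strainVec_add_ae (u v : H1 Ω) : ∀ᵐ x ∂volume.restrict Ω,
    strainVec (u + v) x = strainVec u x + strainVec v x := by
  have h := ae_strain (P := fun a b c => ∀ i j, a i j = b i j + c i j) (u + v) u v (by
    filter_upwards [ae_all_iff.2 fun i => ae_all_iff.2 fun j =>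
      Lp.coeFn_add (strainLp u i j) (strainLp v i j)] with x hx i j
    rw [strainLp_add, hx i j, Pi.add_apply])
  filter_upwards [h] with x hx
  ext p
  exact hx p.1 p.2

theorem strainVec_sub_ae (u v : H1 Ω) : ∀ᵐ x ∂volume.restrict Ω,
    strainVec (u - v) x = strainVec u x - strainVec v x := by
  have h := ae_strain (P := fun a b c => ∀ i j, a i j = b i j - c i j) (u - v) u v (by
    filter_upwards [ae_all_iff.2 fun i => ae_all_iff.2 fun j =>
      Lp.coeFn_sub (strainLp u i j) (strainLp v i j)] with x hx i j
    rw [strainLp_sub, hx i j, Pi.sub_apply])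
  filter_upwards [h] with x hx
  ext p
  exact hx p.1 p.2

theorem strainVec_smul_ae (c : ℝ) (u : H1 Ω) : ∀ᵐ x ∂volume.restrict Ω,
    strainVec (c • u) x = c • strainVec u x := by
  have h := ae_strain (P := fun a b _ => ∀ i j, a i j = c * b i j) (c • u) u u (by
    filter_upwards [ae_all_iff.2 fun i => ae_all_iff.2 fun j =>
      Lp.coeFn_smul c (strainLp u i j)] with x hx i j
    rw [strainLp_smul, hx i j, Pi.smul_apply, smul_eq_mul])
  filter_upwards [h] with x hx
  ext p
  exact hx p.1 p.2

theorem memLp_norm_strainVec (u : H1 Ω) :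
    MemLp (fun x => ‖strainVec u x‖) 2 (volume.restrict Ω) := by
  have hm : AEStronglyMeasurable (fun x => ‖strainVec u x‖) (volume.restrict Ω) := by
    have e : (fun x => ‖strainVec u x‖) = fun x => √(inv2 u x) := by
      funext x
      rw [← norm_strainVec_sq, Real.sqrt_sq (norm_nonneg _)]
    rw [e]
    exact Real.continuous_sqrt.comp_aestronglyMeasurable (integrable_inv2 u).1
  rw [memLp_two_iff_integrable_sq hm]
  simp_rw [norm_strainVec_sq]
  exact integrable_inv2 u

theorem integral_norm_strainVec_mul_le (u h : H1 Ω) :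
    ∫ x in Ω, ‖strainVec u x‖ * ‖strainVec h x‖ ≤ energyNorm u * energyNorm h := by
  have hn : ∀ u : H1 Ω, ‖(memLp_norm_strainVec u).toLp _‖ = energyNorm u := by
    intro u
    rw [energyNorm, ← Real.sqrt_sq (norm_nonneg ((memLp_norm_strainVec u).toLp _)),
      ← real_inner_self_eq_norm_sq, inner_toLp_left]
    congr 1
    refine integral_congr_ae ?_
    filter_upwards [(memLp_norm_strainVec u).coeFn_toLp] with x hx
    rw [hx, ← norm_strainVec_sq, sq]
  have h1 := real_inner_le_norm ((memLp_norm_strainVec u).toLp _) ((memLp_norm_strainVec h).toLp _)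
  rw [hn, hn, inner_toLp_left] at h1
  refine le_of_eq_of_le (integral_congr_ae ?_) h1
  filter_upwards [(memLp_norm_strainVec h).coeFn_toLp] with x hx
  rw [hx, mul_comm]

theorem abs_integral_le_energyNorm {g : Space n → ℝ} {C : ℝ} (hC : 0 ≤ C) (u h : H1 Ω)
    (hg : ∀ᵐ x ∂volume.restrict Ω, |g x| ≤ C * (‖strainVec u x‖ * ‖strainVec h x‖)) :
    |∫ x in Ω, g x| ≤ C * (energyNorm u * energyNorm h) := by
  have hi := ((memLp_norm_strainVec u).integrable_mul (memLp_norm_strainVec h)).const_mul C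
  refine (norm_integral_le_of_norm_le (f := g) hi hg).trans ?_
  rw [integral_const_mul]
  exact mul_le_mul_of_nonneg_left (integral_norm_strainVec_mul_le u h) hC

theorem divg_eq_sum_strain (u : H1 Ω) (x : Space n) : divg u x = ∑ i, strain u i i x :=
  Finset.sum_congr rfl fun i _ => by rw [strain]; ring

theorem memLp_divg (u : H1 Ω) : MemLp (divg u) 2 (volume.restrict Ω) := by
  rw [show divg u = fun x => ∑ i, strain u i i x from funext (divg_eq_sum_strain u)]
  exact memLp_finsetSum _ fun i _ => memLp_strain u i i

theorem abs_divg_le (u : H1 Ω) (x : Space n) : |divg u x| ≤ n * ‖strainVec u x‖ := by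
  rw [divg_eq_sum_strain]
  refine (Finset.abs_sum_le_sum_abs _ _).trans ?_
  calc _ ≤ ∑ _i : Fin n, ‖strainVec u x‖ := Finset.sum_le_sum fun i _ => by
        simpa [strainVec] using PiLp.norm_apply_le (strainVec u x) (i, i)
    _ = _ := by simp

/-- `∫_Ω div u div h dx`. -/
def divInt (u h : H1 Ω) : ℝ := ∫ x in Ω, divg u x * divg h x

theorem divInt_comm (u h : H1 Ω) : divInt u h = divInt h u := by
  simp only [divInt, mul_comm]

theorem divInt_self_nonneg (u : H1 Ω) : 0 ≤ divInt u u :=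
  integral_nonneg fun _ => mul_self_nonneg _

/-- The divergence is the trace of the strain, so it inherits linear relations between strains. -/
theorem divg_of_strainVec {u v w : H1 Ω} {x : Space n} {c d : ℝ}
    (h : strainVec u x = c • strainVec v x + d • strainVec w x) :
    divg u x = c * divg v x + d * divg w x := by
  simp only [divg_eq_sum_strain, Finset.mul_sum, ← Finset.sum_add_distrib]
  refine Finset.sum_congr rfl fun i _ => ?_
  have := congrArg (fun z : EuclideanSpace ℝ (Fin n × Fin n) => z (i, i)) h
  simpa [strainVec] using this

theorem integrable_divg_mul (u h : H1 Ω) :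
    Integrable (fun x => divg u x * divg h x) (volume.restrict Ω) :=
  (memLp_divg u).integrable_mul (memLp_divg h)

theorem divInt_add_right (u h k : H1 Ω) : divInt u (h + k) = divInt u h + divInt u k := by
  rw [divInt, divInt, divInt, ← integral_add (integrable_divg_mul u h)
    (integrable_divg_mul u k)]
  refine integral_congr_ae ?_
  filter_upwards [strainVec_add_ae h k] with x hx
  rw [divg_of_strainVec (u := h + k) (v := h) (w := k) (c := 1) (d := 1) (by rw [hx, one_smul, one_smul])]
  ring

theorem divInt_sub_right (u h k : H1 Ω) : divInt u (h - k) = divInt u h - divInt u k := by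
  rw [divInt, divInt, divInt, ← integral_sub (integrable_divg_mul u h)
    (integrable_divg_mul u k)]
  refine integral_congr_ae ?_
  filter_upwards [strainVec_sub_ae h k] with x hx
  rw [divg_of_strainVec (u := h - k) (v := h) (w := k) (c := 1) (d := -1) (by rw [hx]; module)]
  ring

theorem divInt_smul_right (c : ℝ) (u h : H1 Ω) : divInt u (c • h) = c * divInt u h := by
  rw [divInt, divInt, ← integral_const_mul]
  refine integral_congr_ae ?_
  filter_upwards [strainVec_smul_ae c h] with x hx
  rw [divg_of_strainVec (u := c • h) (v := h) (w := h) (c := c) (d := 0) (by rw [hx]; module)]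
  ring

theorem divInt_sub_left (u v h : H1 Ω) : divInt (u - v) h = divInt u h - divInt v h := by
  rw [divInt_comm, divInt_sub_right, divInt_comm h, divInt_comm h]

/-- The crude constant n² only establishes boundedness; q₃ involves the actual operator norm. -/
theorem abs_divInt_le (u h : H1 Ω) :
    |divInt u h| ≤ (n * n : ℝ) * (energyNorm u * energyNorm h) := by
  refine abs_integral_le_energyNorm (by positivity) u h (Eventually.of_forall fun x => ?_)
  rw [abs_mul]
  calc _ ≤ (n * ‖strainVec u x‖) * (n * ‖strainVec h x‖) :=
        mul_le_mul (abs_divg_le u x) (abs_divg_le h x) (abs_nonneg _) (by positivity)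
    _ = _ := by ring

end Energy

/-! ### Integrated monotonicity and Lipschitz bounds for the stress -/

section Stress

variable {n : ℕ} {Ω S₁ : Set (Space n)} {lam : ℝ} {e : ℝ → Space n → ℝ}
  {ψ₁ : ℝ → ℝ → Space n → ℝ} {E : Space n → Space n} {a₁ a₂ a₃ a₄ a₅ : ℝ}

/-- The density of the work of the viscous stress of the flow `w` on the rate of strain of `h`. -/
def stressDot (lam : ℝ) (e : ℝ → Space n → ℝ) (ψ₁ : ℝ → ℝ → Space n → ℝ) (E : Space n → Space n)
    (w h : H1 Ω) (x : Space n) : ℝ :=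
  (e ‖E x‖ x * (√(lam + inv2 w x))⁻¹ + ψ₁ (inv2 w x) ‖E x‖ x) * strainDot w h x

/-- Puts the density in the form θ(|ξ|²)⟪ξ, ζ⟫, to which the pointwise estimates apply. -/
theorem stressDot_eq (w h : H1 Ω) (x : Space n) : stressDot lam e ψ₁ E w h x =
    viscosity lam (e ‖E x‖ x) (fun y => ψ₁ y ‖E x‖ x) (‖strainVec w x‖ ^ 2) *
      ⟪strainVec w x, strainVec h x⟫ := by
  rw [norm_strainVec_sq, inner_strainVec]
  rfl

theorem aestronglyMeasurable_stressDot (hE : AEMeasurable E (volume.restrict Ω))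
    (hC0 : CondC0 Ω ψ₁) (hC4a : CondC4a Ω e a₅) (w h : H1 Ω) :
    AEStronglyMeasurable (stressDot lam e ψ₁ E w h) (volume.restrict Ω) := by
  have hI : AEMeasurable (inv2 w) (volume.restrict Ω) := (integrable_inv2 w).1.aemeasurable
  have h1 : AEMeasurable (fun x => e ‖E x‖ x) (volume.restrict Ω) :=
    aemeasurable_caratheodory (s := Ici 0) (f := fun y x => e y x) (hC4a.1.mono fun x hx => hx.1)
      (fun y hy => hC4a.2 y hy) hE.norm fun x => norm_nonneg _
  have h2 : AEMeasurable (fun x => ψ₁ (inv2 w x) ‖E x‖ x) (volume.restrict Ω) :=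
    aemeasurable_caratheodory (s := Ici (0 : ℝ) ×ˢ Ici (0 : ℝ))
      (f := fun (y : ℝ × ℝ) x => ψ₁ y.1 y.2 x) hC0.1 (fun y hy => hC0.2 y.1 y.2 hy.1 hy.2)
      (hI.prodMk hE.norm) fun x => ⟨inv2_nonneg w x, norm_nonneg _⟩
  have h3 : AEMeasurable (fun x => strainDot w h x) (volume.restrict Ω) :=
    Finset.aemeasurable_fun_sum _ fun i _ => Finset.aemeasurable_fun_sum _ fun j _ =>
      (memLp_strain w i j).1.aemeasurable.mul (memLp_strain h i j).1.aemeasurable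
  have h4 : AEMeasurable (fun x => (√(lam + inv2 w x))⁻¹) (volume.restrict Ω) :=
    (Real.continuous_sqrt.measurable.comp_aemeasurable (hI.const_add lam)).inv
  exact (((h1.mul h4).add h2).mul h3).aestronglyMeasurable

theorem abs_stressDot_le (hlam : 0 < lam) (ha₁ : 0 < a₁)
    (hC1a : CondC1a Ω ψ₁ a₁ a₂ a₃ a₄) (hC4a : CondC4a Ω e a₅) (w h : H1 Ω) :
    ∀ᵐ x ∂volume.restrict Ω, |stressDot lam e ψ₁ E w h x| ≤
      (a₅ * (√lam)⁻¹ + a₂) * (‖strainVec w x‖ * ‖strainVec h x‖) := by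
  filter_upwards [hC1a, hC4a.1] with x h1 h2
  obtain ⟨-, h1⟩ := h1 ‖E x‖ (norm_nonneg _)
  obtain ⟨hκ, hκ'⟩ := h2.2 ‖E x‖ (norm_nonneg _)
  have hb := (h1 (‖strainVec w x‖ ^ 2) (sq_nonneg _)).1
  have h3 : a₁ ≤ viscosity lam (e ‖E x‖ x) (fun y => ψ₁ y ‖E x‖ x) (‖strainVec w x‖ ^ 2) :=
    le_viscosity hκ hb.1
  have h4 := viscosity_le (ψ := fun y => ψ₁ y ‖E x‖ x) hlam hκ hκ' (sq_nonneg ‖strainVec w x‖) hb.2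
  rw [stressDot_eq, abs_mul, abs_of_nonneg (ha₁.le.trans h3)]
  exact mul_le_mul h4 (abs_real_inner_le_norm _ _) (abs_nonneg _) (ha₁.le.trans (h3.trans h4))

theorem integrable_stressDot (hE : AEMeasurable E (volume.restrict Ω)) (hlam : 0 < lam)
    (ha₁ : 0 < a₁) (hC0 : CondC0 Ω ψ₁) (hC1a : CondC1a Ω ψ₁ a₁ a₂ a₃ a₄) (hC4a : CondC4a Ω e a₅)
    (w h : H1 Ω) : Integrable (stressDot lam e ψ₁ E w h) (volume.restrict Ω) :=
  (((memLp_norm_strainVec w).integrable_mul (memLp_norm_strainVec h)).const_mul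
    (a₅ * (√lam)⁻¹ + a₂)).mono' (aestronglyMeasurable_stressDot hE hC0 hC4a w h)
    (abs_stressDot_le hlam ha₁ hC1a hC4a w h)

theorem abs_integral_stressDot_le (hlam : 0 < lam) (ha₁ : 0 < a₁) (ha₂ : 0 < a₂) (ha₅ : 0 < a₅)
    (hC1a : CondC1a Ω ψ₁ a₁ a₂ a₃ a₄) (hC4a : CondC4a Ω e a₅) (w h : H1 Ω) :
    |∫ x in Ω, stressDot lam e ψ₁ E w h x| ≤
      (a₅ * (√lam)⁻¹ + a₂) * (energyNorm w * energyNorm h) :=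
  abs_integral_le_energyNorm (by positivity) w h (abs_stressDot_le hlam ha₁ hC1a hC4a w h)

theorem integral_stressDot_add (hE : AEMeasurable E (volume.restrict Ω)) (hlam : 0 < lam)
    (ha₁ : 0 < a₁) (hC0 : CondC0 Ω ψ₁) (hC1a : CondC1a Ω ψ₁ a₁ a₂ a₃ a₄) (hC4a : CondC4a Ω e a₅)
    (w h k : H1 Ω) : ∫ x in Ω, stressDot lam e ψ₁ E w (h + k) x =
      (∫ x in Ω, stressDot lam e ψ₁ E w h x) + ∫ x in Ω, stressDot lam e ψ₁ E w k x := by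
  rw [← integral_add (integrable_stressDot hE hlam ha₁ hC0 hC1a hC4a w h)
    (integrable_stressDot hE hlam ha₁ hC0 hC1a hC4a w k)]
  refine integral_congr_ae ?_
  filter_upwards [strainVec_add_ae h k] with x hx
  rw [stressDot_eq, stressDot_eq, stressDot_eq, hx, inner_add_right, mul_add]

theorem integral_stressDot_smul (c : ℝ) (w h : H1 Ω) :
    ∫ x in Ω, stressDot lam e ψ₁ E w (c • h) x = c * ∫ x in Ω, stressDot lam e ψ₁ E w h x := by
  rw [← integral_const_mul]
  refine integral_congr_ae ?_
  filter_upwards [strainVec_smul_ae c h] with x hx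
  rw [stressDot_eq, stressDot_eq, hx, real_inner_smul_right]
  ring

/-- The viscous stress is Lipschitz continuous. -/
theorem abs_integral_stressDot_sub_le (hE : AEMeasurable E (volume.restrict Ω)) (hlam : 0 < lam)
    (ha₁ : 0 < a₁) (ha₂ : 0 < a₂) (ha₄ : 0 < a₄) (ha₅ : 0 < a₅) (hC0 : CondC0 Ω ψ₁)
    (hC1a : CondC1a Ω ψ₁ a₁ a₂ a₃ a₄) (hC4a : CondC4a Ω e a₅) {w z d : H1 Ω}
    (hwz : ∀ᵐ x ∂volume.restrict Ω, strainVec d x = strainVec w x - strainVec z x) (h : H1 Ω) :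
    |(∫ x in Ω, stressDot lam e ψ₁ E w h x) - ∫ x in Ω, stressDot lam e ψ₁ E z h x| ≤
      (a₂ + 2 * a₄ + 2 * a₅ * (√lam)⁻¹) * (energyNorm d * energyNorm h) := by
  rw [← integral_sub (integrable_stressDot hE hlam ha₁ hC0 hC1a hC4a w h)
    (integrable_stressDot hE hlam ha₁ hC0 hC1a hC4a z h)]
  refine abs_integral_le_energyNorm (by positivity) _ _ ?_
  filter_upwards [hC1a, hC4a.1, hwz] with x h1 h2 h3
  obtain ⟨hd, h1⟩ := h1 ‖E x‖ (norm_nonneg _)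
  obtain ⟨hκ, hκ'⟩ := h2.2 ‖E x‖ (norm_nonneg _)
  rw [stressDot_eq, stressDot_eq, h3]
  exact abs_radial_sub_le (fun y hy => hasDerivWithinAt_viscosity hlam hd hy)
    (fun y hy => ha₁.le.trans (le_viscosity hκ (h1 y hy).1.1))
    (fun y hy => viscosity_add_le hlam hκ hκ' hy (h1 y hy).1.2 (h1 y hy).2.2) _ _ _

theorem le_stressDot_sub_ae (hlam : 0 < lam) (hC1a : CondC1a Ω ψ₁ a₁ a₂ a₃ a₄)
    (hC4a : CondC4a Ω e a₅) {w z d : H1 Ω}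
    (hwz : ∀ᵐ x ∂volume.restrict Ω, strainVec d x = strainVec w x - strainVec z x) : ∀ᵐ x ∂volume.restrict Ω,
    min a₁ a₃ * inv2 d x ≤
      stressDot lam e ψ₁ E w d x - stressDot lam e ψ₁ E z d x := by
  filter_upwards [hC1a, hC4a.1, hwz] with x h1 h2 h3
  obtain ⟨hd, h1⟩ := h1 ‖E x‖ (norm_nonneg _)
  obtain ⟨hκ, -⟩ := h2.2 ‖E x‖ (norm_nonneg _)
  have h := radial_strongly_monotone (fun y hy => hasDerivWithinAt_viscosity hlam hd hy)
    (fun y hy => (min_le_left _ _).trans (le_viscosity hκ (h1 y hy).1.1))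
    (fun y hy => (min_le_right _ _).trans (le_viscosity_add hlam hκ hy (h1 y hy).2.1))
    (strainVec w x) (strainVec z x)
  rw [← h3, norm_strainVec_sq d x, ← stressDot_eq w d x,
    ← stressDot_eq z d x] at h
  exact h

theorem energyNorm_sq (u : H1 Ω) : energyNorm u ^ 2 = ∫ x in Ω, inv2 u x :=
  Real.sq_sqrt (integral_nonneg (inv2_nonneg u))

/-- The viscous stress is strongly monotone. -/
theorem le_integral_stressDot_sub (hE : AEMeasurable E (volume.restrict Ω)) (hlam : 0 < lam)
    (ha₁ : 0 < a₁) (hC0 : CondC0 Ω ψ₁) (hC1a : CondC1a Ω ψ₁ a₁ a₂ a₃ a₄) (hC4a : CondC4a Ω e a₅)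
    {w z d : H1 Ω}
    (hwz : ∀ᵐ x ∂volume.restrict Ω, strainVec d x = strainVec w x - strainVec z x) :
    min a₁ a₃ * energyNorm d ^ 2 ≤ (∫ x in Ω, stressDot lam e ψ₁ E w d x) -
      ∫ x in Ω, stressDot lam e ψ₁ E z d x := by
  have i1 := integrable_stressDot hE hlam ha₁ hC0 hC1a hC4a w d
  have i2 := integrable_stressDot hE hlam ha₁ hC0 hC1a hC4a z d
  have h := integral_mono_ae ((integrable_inv2 d).const_mul (min a₁ a₃)) (i1.sub i2)
    (le_stressDot_sub_ae hlam hC1a hC4a hwz)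
  rw [integral_const_mul, ← energyNorm_sq] at h
  exact h.trans_eq (integral_sub i1 i2)

/-- The shift ũ cancels in differences, so it does not enter the monotonicity and Lipschitz
constants. -/
theorem strainVec_add_sub_add_ae (ut u v : H1 Ω) : ∀ᵐ x ∂volume.restrict Ω,
    strainVec (u - v) x = strainVec (ut + u) x - strainVec (ut + v) x := by
  filter_upwards [strainVec_sub_ae u v, strainVec_add_ae ut u, strainVec_add_ae ut v] with x h1 h2 h3
  exact h1.trans (by rw [h2, h3, add_sub_add_left_eq_sub])

end Stress

/-! ### From the norm of X to the norm of X₁ -/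

section Preconditioned

/-- Used to show that an operator norm defined as an infimum is itself an admissible constant; p = 0
is separate because one cannot divide. -/
theorem le_csInf_mul {S : Set ℝ} (hS : S.Nonempty) {b p : ℝ} (hp : 0 ≤ p)
    (h : ∀ C ∈ S, b ≤ C * p) : b ≤ sInf S * p := by
  rcases hp.eq_or_lt with rfl | hp
  · obtain ⟨C, hC⟩ := hS
    simpa using h C hC
  · rw [← div_le_iff₀ hp]
    exact le_csInf hS fun C hC => (div_le_iff₀ hp).2 (h C hC)

variable {V : Type*} [AddCommGroup V] [Module ℝ V]

/-- The preconditioned iteration for the equation `L(u) + r D(u) = f`, where `L` is strongly monotone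
and Lipschitz and `D` is linear and monotone, with respect to a norm `N`. -/
theorem exists_preconditioned_iteration [Nontrivial V] {N : V → ℝ} (hN : ∀ u, 0 ≤ N u)
    (hNdef : ∀ u, N u = 0 → u = 0)
    (hNcomplete : ∀ u : ℕ → V, (∀ ε > 0, ∃ K, ∀ m ≥ K, ∀ k ≥ K, N (u m - u k) < ε) →
      ∃ v, Tendsto (fun m => N (u m - v)) atTop (𝓝 0))
    {A : V →ₗ[ℝ] V →ₗ[ℝ] ℝ} {b₁ b₂ : ℝ} (hb₁ : 0 < b₁) (hb₂ : 0 < b₂)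
    (hsymm : ∀ u h, A u h = A h u) (hbdd : ∀ u h, |A u h| ≤ b₁ * N u * N h)
    (hcoer : ∀ u, b₂ * N u ^ 2 ≤ A u u)
    {D : V → V → ℝ} (hDadd : ∀ u h k, D u (h + k) = D u h + D u k)
    (hDsmul : ∀ u (c : ℝ) h, D u (c • h) = c * D u h)
    (hDsub : ∀ u v h, D (u - v) h = D u h - D v h) (hD0 : ∀ u, 0 ≤ D u u)
    {cD : ℝ} (hcD : 0 ≤ cD) (hDbdd : ∀ u h, |D u h| ≤ cD * (N u * N h))
    {L : V → V → ℝ} (hLadd : ∀ u h k, L u (h + k) = L u h + L u k)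
    (hLsmul : ∀ u (c : ℝ) h, L u (c • h) = c * L u h)
    (hLbdd : ∀ u, ∃ C, 0 ≤ C ∧ ∀ h, |L u h| ≤ C * N h) {α M : ℝ} (hα : 0 < α) (hM : 0 ≤ M)
    (hLmono : ∀ u v, α * N (u - v) ^ 2 ≤ L u (u - v) - L v (u - v))
    (hLlip : ∀ u v h, |L u h - L v h| ≤ M * (N (u - v) * N h))
    {f : V →ₗ[ℝ] ℝ} (hf : ∃ C : ℝ, ∀ h, |f h| ≤ C * N h) {r : ℝ} (hr : 0 < r)
    {q₁ q₃ : ℝ} (hq₁ : q₁ = α * b₁⁻¹)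
    (hq₃ : q₃ = M * b₂⁻¹ +
      r * sInf {C : ℝ | 0 ≤ C ∧ ∀ u h, |D u h| ≤ C * √(A u u) * √(A h h)}) :
    (0 < q₁ ∧ q₁ ≤ q₃) ∧ ∃ u, (∀ h, L u h + r * D u h = f h) ∧
      (∀ v, (∀ h, L v h + r * D v h = f h) → v = u) ∧
      ∀ t ∈ Ioo 0 (2 * q₁ * (q₃ ^ 2)⁻¹),
        (∀ v, ∃! w, ∀ h, A w h = A v h - t * (L v h + r * D v h - f h)) ∧
        (∀ v v' w w', (∀ h, A w h = A v h - t * (L v h + r * D v h - f h)) →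
          (∀ h, A w' h = A v' h - t * (L v' h + r * D v' h - f h)) →
          √(A (w - w') (w - w')) ≤ rate q₁ q₃ t * √(A (v - v') (v - v'))) ∧
        (∀ useq : ℕ → V, (∀ m h, A (useq (m + 1)) h = A (useq m) h -
            t * (L (useq m) h + r * D (useq m) h - f h)) →
          Tendsto (fun m => √(A (useq m - u) (useq m - u))) atTop (𝓝 0) ∧
          ∀ m, √(A (useq m - u) (useq m - u)) ≤ rate q₁ q₃ t ^ m / (1 - rate q₁ q₃ t) *
            (t * sInf {C : ℝ | 0 ≤ C ∧ ∀ h, |L (useq 0) h + r * D (useq 0) h - f h| ≤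
              C * √(A h h)})) := by
  have hnonneg : ∀ u, 0 ≤ A u u := fun u =>
    (mul_nonneg hb₂.le (sq_nonneg _)).trans (hcoer u)
  have hsb₂ : 0 < √b₂ := Real.sqrt_pos.2 hb₂
  have hupper : ∀ u, √(A u u) ≤ √b₁ * N u := by
    intro u
    refine Real.sqrt_le_iff.2 ⟨mul_nonneg (Real.sqrt_nonneg _) (hN u), ?_⟩
    rw [mul_pow, Real.sq_sqrt hb₁.le]
    have := (le_abs_self _).trans (hbdd u u)
    linarith
  have hlower : ∀ u, √b₂ * N u ≤ √(A u u) := by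
    intro u
    refine Real.le_sqrt_of_sq_le ?_
    rw [mul_pow, Real.sq_sqrt hb₂.le]
    exact hcoer u
  have hlower' : ∀ u, N u ≤ (√b₂)⁻¹ * √(A u u) := fun u => by
    rw [← div_eq_inv_mul, le_div_iff₀' hsb₂]
    exact hlower u
  have hNN : ∀ u h, N u * N h ≤ b₂⁻¹ * (√(A u u) * √(A h h)) := by
    intro u h
    rw [← div_eq_inv_mul, le_div_iff₀ hb₂]
    calc N u * N h * b₂ = (√b₂ * √b₂) * (N u * N h) := by
          rw [Real.mul_self_sqrt hb₂.le]
          ring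
      _ = (√b₂ * N u) * (√b₂ * N h) := by ring
      _ ≤ _ := mul_le_mul (hlower u) (hlower h)
          (mul_nonneg (Real.sqrt_nonneg _) (hN h)) (Real.sqrt_nonneg _)
  set d := sInf {C : ℝ | 0 ≤ C ∧ ∀ u h, |D u h| ≤ C * √(A u u) * √(A h h)} with hd
  have hne : {C : ℝ | 0 ≤ C ∧ ∀ u h, |D u h| ≤ C * √(A u u) * √(A h h)}.Nonempty := by
    refine ⟨cD * b₂⁻¹, by positivity, fun u h => (hDbdd u h).trans ?_⟩
    rw [mul_assoc, mul_assoc]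
    exact mul_le_mul_of_nonneg_left (hNN u h) hcD
  have hDd : ∀ u h, |D u h| ≤ d * (√(A u u) * √(A h h)) := by
    intro u h
    refine le_csInf_mul hne (by positivity) fun C hC => ?_
    rw [← mul_assoc]
    exact hC.2 u h
  have hdef : ∀ u, A u u = 0 → u = 0 := by
    intro u hu
    have h1 := hlower u
    rw [hu, Real.sqrt_zero] at h1
    exact hNdef u (le_antisymm (nonpos_of_mul_nonpos_right h1 hsb₂) (hN u))
  let F : V → V →ₗ[ℝ] ℝ := fun u =>
    { toFun := fun h => L u h + r * D u h - f h
      map_add' := fun h k => by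
        rw [hLadd, hDadd, map_add]
        ring
      map_smul' := fun c h => by
        rw [hLsmul, hDsmul, map_smul, RingHom.id_apply, smul_eq_mul, smul_eq_mul]
        ring }
  have hFapply : ∀ u h, F u h = L u h + r * D u h - f h := fun _ _ => rfl
  have hq₁0 : 0 < q₁ := by rw [hq₁]; positivity
  have hFbdd : ∀ u, ∃ C : ℝ, ∀ h, |F u h| ≤ C * √(A h h) := by
    intro u
    obtain ⟨C₁, hC₁, h₁⟩ := hLbdd u
    obtain ⟨C₂, h₂⟩ := hf
    refine ⟨(C₁ + r * (cD * N u) + |C₂|) * (√b₂)⁻¹, fun h => ?_⟩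
    have k1 : |L u h + r * D u h - f h| ≤ |L u h| + r * |D u h| + |f h| := by
      have e1 := abs_sub (L u h + r * D u h) (f h)
      have e2 := abs_add_le (L u h) (r * D u h)
      rw [abs_mul, abs_of_pos hr] at e2
      linarith
    have k2 := mul_le_mul_of_nonneg_left (hDbdd u h) hr.le
    have k3 := (h₂ h).trans (mul_le_mul_of_nonneg_right (le_abs_self C₂) (hN h))
    have k4 : 0 ≤ C₁ + r * (cD * N u) + |C₂| := by
      have := hN u
      positivity
    rw [hFapply, mul_assoc]
    refine le_trans ?_ (mul_le_mul_of_nonneg_left (hlower' h) k4)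
    have := h₁ h
    linarith
  -- The linear part D is nonnegative on u - v and is dropped. The constant b₁ bounds A(u - v, u -
  -- v) above by the square of N(u - v).
  have hFmono : ∀ u v, q₁ * A (u - v) (u - v) ≤ F u (u - v) - F v (u - v) := by
    intro u v
    have h1 := hLmono u v
    have h2 : 0 ≤ D u (u - v) - D v (u - v) := by
      rw [← hDsub]
      exact hD0 _
    have h3 := (le_abs_self _).trans (hbdd (u - v) (u - v))
    have h4 : q₁ * A (u - v) (u - v) ≤ α * N (u - v) ^ 2 := by
      calc _ ≤ q₁ * (b₁ * N (u - v) * N (u - v)) := mul_le_mul_of_nonneg_left h3 hq₁0.le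
        _ = _ := by
          rw [hq₁]
          field_simp
    have h5 := mul_nonneg hr.le h2
    rw [hFapply, hFapply]
    linarith
  -- Two applications of coercivity, one per argument, produce b₂⁻¹ in front of M, whereas D is
  -- measured directly in the norm of A.
  have hFlip : ∀ u v h, |F u h - F v h| ≤ q₃ * √(A (u - v) (u - v)) * √(A h h) := by
    intro u v h
    have h1 := (hLlip u v h).trans (mul_le_mul_of_nonneg_left (hNN (u - v) h) hM)
    have h2 := mul_le_mul_of_nonneg_left (hDd (u - v) h) hr.le
    rw [hDsub] at h2
    have e1 : F u h - F v h = (L u h - L v h) + r * (D u h - D v h) := by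
      rw [hFapply, hFapply]
      ring
    have h3 := abs_add_le (L u h - L v h) (r * (D u h - D v h))
    rw [abs_mul, abs_of_pos hr] at h3
    rw [e1, hq₃]
    linarith
  -- Completeness transfers because the norm of A lies between √b₂ N and √b₁ N: the lower bound
  -- carries Cauchy sequences over, the upper bound the limits.
  obtain ⟨hle, u, hu, huniq, hiter⟩ := exists_iteration A hsymm hnonneg hdef (fun u hu => by
    have h := hNcomplete u (fun ε hε => by
      obtain ⟨K, hK⟩ := hu (√b₂ * ε) (by positivity)
      exact ⟨K, fun m hm k hk => lt_of_mul_lt_mul_left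
        ((hlower (u m - u k)).trans_lt (hK m hm k hk)) hsb₂.le⟩)
    obtain ⟨v, hv⟩ := h
    refine ⟨v, squeeze_zero (fun m => Real.sqrt_nonneg _) (fun m => hupper (u m - v)) ?_⟩
    simpa using hv.const_mul (√b₁)) hq₁0 F hFbdd hFmono hFlip
  exact ⟨⟨hq₁0, hle⟩, u, fun h => sub_eq_zero.1 (hu h),
    fun v hv => huniq v fun h => sub_eq_zero.2 (hv h), hiter⟩

end Preconditioned

/-! ### The viscous operator with its final constants -/

section ViscousOperator

variable {n : ℕ} {Ω S₁ : Set (Space n)} {lam : ℝ} {e : ℝ → Space n → ℝ}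
  {ψ₁ : ℝ → ℝ → Space n → ℝ} {E : Space n → Space n} {a₁ a₂ a₃ a₄ a₅ : ℝ}

/-- The operator `L₃` on `H¹(Ω)ⁿ`. -/
def stressInt (lam : ℝ) (e : ℝ → Space n → ℝ) (ψ₁ : ℝ → ℝ → Space n → ℝ) (E : Space n → Space n)
    (ut u h : H1 Ω) : ℝ := 2 * ∫ x in Ω, stressDot lam e ψ₁ E (ut + u) h x

theorem stressInt_add (hE : AEMeasurable E (volume.restrict Ω)) (hlam : 0 < lam)
    (ha₁ : 0 < a₁) (hC0 : CondC0 Ω ψ₁) (hC1a : CondC1a Ω ψ₁ a₁ a₂ a₃ a₄) (hC4a : CondC4a Ω e a₅)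
    (ut u h k : H1 Ω) : stressInt lam e ψ₁ E ut u (h + k) =
      stressInt lam e ψ₁ E ut u h + stressInt lam e ψ₁ E ut u k := by
  unfold stressInt
  rw [integral_stressDot_add hE hlam ha₁ hC0 hC1a hC4a, mul_add]

theorem stressInt_smul (ut u : H1 Ω) (c : ℝ) (h : H1 Ω) :
    stressInt lam e ψ₁ E ut u (c • h) = c * stressInt lam e ψ₁ E ut u h := by
  unfold stressInt
  rw [integral_stressDot_smul, mul_left_comm]

theorem abs_stressInt_le (hlam : 0 < lam) (ha₁ : 0 < a₁) (ha₂ : 0 < a₂) (ha₅ : 0 < a₅)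
    (hC1a : CondC1a Ω ψ₁ a₁ a₂ a₃ a₄) (hC4a : CondC4a Ω e a₅) (ut u h : H1 Ω) :
    |stressInt lam e ψ₁ E ut u h| ≤
      2 * (a₅ * (√lam)⁻¹ + a₂) * energyNorm (ut + u) * energyNorm h := by
  have h1 := abs_integral_stressDot_le (E := E) hlam ha₁ ha₂ ha₅ hC1a hC4a (ut + u) h
  unfold stressInt
  rw [abs_mul, abs_two]
  linarith

theorem abs_stressInt_sub_le (hE : AEMeasurable E (volume.restrict Ω)) (hlam : 0 < lam)
    (ha₁ : 0 < a₁) (ha₂ : 0 < a₂) (ha₄ : 0 < a₄) (ha₅ : 0 < a₅) (hC0 : CondC0 Ω ψ₁)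
    (hC1a : CondC1a Ω ψ₁ a₁ a₂ a₃ a₄) (hC4a : CondC4a Ω e a₅) (ut u v h : H1 Ω) :
    |stressInt lam e ψ₁ E ut u h - stressInt lam e ψ₁ E ut v h| ≤
      (2 * a₂ + 4 * a₄ + 4 * a₅ * (√lam)⁻¹) * (energyNorm (u - v) * energyNorm h) := by
  have h1 := abs_integral_stressDot_sub_le hE hlam ha₁ ha₂ ha₄ ha₅ hC0 hC1a hC4a
    (strainVec_add_sub_add_ae ut u v) h
  unfold stressInt
  rw [← mul_sub, abs_mul, abs_two]
  linarith

theorem le_stressInt_sub (hE : AEMeasurable E (volume.restrict Ω)) (hlam : 0 < lam)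
    (ha₁ : 0 < a₁) (hC0 : CondC0 Ω ψ₁) (hC1a : CondC1a Ω ψ₁ a₁ a₂ a₃ a₄) (hC4a : CondC4a Ω e a₅)
    (ut u v : H1 Ω) :
    min (2 * a₁) (2 * a₃) * energyNorm (u - v) ^ 2 ≤
      stressInt lam e ψ₁ E ut u (u - v) - stressInt lam e ψ₁ E ut v (u - v) := by
  have h1 := le_integral_stressDot_sub hE hlam ha₁ hC0 hC1a hC4a (strainVec_add_sub_add_ae ut u v)
  unfold stressInt
  rw [← mul_sub, ← mul_min_of_nonneg _ _ zero_le_two, mul_assoc]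
  exact mul_le_mul_of_nonneg_left h1 zero_le_two

/-- Korn's inequality bounds every component and derivative by the seminorm, which is therefore
definite on X. -/
theorem IsLipschitzDomain.eq_zero_of_normX (hΩ : IsLipschitzDomain Ω) (hn : 0 < n)
    (hS₁ : IsOpenBoundaryPart Ω S₁) (u : X Ω S₁) (h0 : normX u = 0) : u = 0 := by
  have h := hΩ.exists_korn hn hS₁
  obtain ⟨K, -, hK⟩ := h
  have h1 : ∀ i, ‖u.1.1.1 i‖ ≤ 0 := fun i => ((hK u).2 i).trans_eq (by rw [h0, mul_zero])
  have h2 : ∀ i j, ‖u.1.1.2 i j‖ ≤ 0 := fun i j => ((hK u).1 i j).trans_eq (by rw [h0, mul_zero])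
  exact Subtype.ext (Subtype.ext (Prod.ext (funext fun i => norm_le_zero_iff.1 (h1 i))
    (funext fun i => funext fun j => norm_le_zero_iff.1 (h2 i j))))

end ViscousOperator

end

end ERFluid

/-! ### Assembly of the convergence theorem -/

theorem theorem9p5 {n : ℕ} (hn : n = 2 ∨ n = 3) {Ω S₁ : Set (Space n)}
    (hΩ : IsLipschitzDomain Ω) (hS₁ : IsOpenBoundaryPart Ω S₁)
    -- the data: boundary velocity and its extension, electric field, viscosity functions
    (uhat : Space n → Fin n → ℝ) (ut : H1 Ω) (htrace : HasTrace S₁ ut uhat)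
    (hdiv : ∀ᵐ x ∂(volume.restrict Ω), divg ut x = 0)
    (E : Space n → Space n) (hE : AEMeasurable E (volume.restrict Ω))
    (ψ₁ : ℝ → ℝ → Space n → ℝ) (e : ℝ → Space n → ℝ)
    (a₁ a₂ a₃ a₄ a₅ : ℝ) (ha₁ : 0 < a₁) (ha₂ : 0 < a₂) (ha₃ : 0 < a₃) (ha₄ : 0 < a₄)
    (ha₅ : 0 < a₅)
    (hC0 : CondC0 Ω ψ₁) (hC1a : CondC1a Ω ψ₁ a₁ a₂ a₃ a₄) (hC4a : CondC4a Ω e a₅)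
    (lam r : ℝ) (hlam : 0 < lam) (hr : 0 < r)
    (f : X Ω S₁ →ₗ[ℝ] ℝ) (hf : IsBoundedX f)
    (A : X Ω S₁ →ₗ[ℝ] X Ω S₁ →ₗ[ℝ] ℝ) (b₁ b₂ : ℝ) (hA : IsPreconditioner A b₁ b₂)
    (q₁ q₃ : ℝ) (hq₁ : q₁ = q1 a₁ a₃ b₁) (hq₃ : q₃ = q3 A a₂ a₄ a₅ lam b₂ r) :
    -- the nonlinear problem has a unique solution `u`
    ∃ u : X Ω S₁, IsSolution lam r e ψ₁ E ut f u ∧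
      (∀ v, IsSolution lam r e ψ₁ E ut f v → v = u) ∧
      (∀ t ∈ Ioo 0 (2 * q₁ * (q₃ ^ 2)⁻¹),
        rate q₁ q₃ t < 1 ∧
        -- each step of the iteration is uniquely solvable
        (∀ v, ∃! w, IsStep lam r e ψ₁ E ut f A t v w) ∧
        -- the step is a contraction with factor `k(t)`
        (∀ v v' w w', IsStep lam r e ψ₁ E ut f A t v w → IsStep lam r e ψ₁ E ut f A t v' w' →
          norm1 A (w - w') ≤ rate q₁ q₃ t * norm1 A (v - v')) ∧
        -- convergence and the a priori error bound, for every starting point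
        (∀ useq : ℕ → X Ω S₁, (∀ m, IsStep lam r e ψ₁ E ut f A t (useq m) (useq (m + 1))) →
          Tendsto (fun m => norm1 A (useq m - u)) atTop (𝓝 0) ∧
          ∀ m, norm1 A (useq m - u) ≤ rate q₁ q₃ t ^ m / (1 - rate q₁ q₃ t) *
            (t * dualNorm1 A
              (fun h => L3 lam e ψ₁ E ut (useq 0) h + r * divForm (useq 0) h - f h)))) ∧
      -- the function under the root is nonnegative, and `k` is minimal at `t₀ = q₁ q₃⁻²`
      (∀ s : ℝ, 0 ≤ 1 - 2 * q₁ * s + q₃ ^ 2 * s ^ 2) ∧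
      q₁ * (q₃ ^ 2)⁻¹ ∈ Ioo 0 (2 * q₁ * (q₃ ^ 2)⁻¹) ∧
      rate q₁ q₃ (q₁ * (q₃ ^ 2)⁻¹) = √(1 - q₁ ^ 2 * (q₃ ^ 2)⁻¹) ∧
      ∀ s : ℝ, rate q₁ q₃ (q₁ * (q₃ ^ 2)⁻¹) ≤ rate q₁ q₃ s := by
  have hn0 : 0 < n := by omega
  have hX : Nontrivial (X Ω S₁) := hΩ.nontrivial_X hn0 hS₁
  have hs : 0 ≤ 2 * (a₅ * (√lam)⁻¹ + a₂) := by positivity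
  have hMpos : 0 ≤ 2 * a₂ + 4 * a₄ + 4 * a₅ * (√lam)⁻¹ := by positivity
  have hα : 0 < min (2 * a₁) (2 * a₃) := lt_min (by positivity) (by positivity)
  -- On X, `normX`, `divForm` and `L3` agree by definition with `energyNorm`, `divInt` and
  -- `stressInt` of the underlying fields, so the H¹ estimates serve directly. With α = min(2a₁,
  -- 2a₃) and M = 2a₂ + 4a₄ + 4a₅λ^{-1/2}, the definitions of q₁ and q₃ unfold to the required form.
  have key := @exists_preconditioned_iteration (X Ω S₁) (X Ω S₁).addCommGroup (X Ω S₁).module hX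
    normX normX_nonneg
    (hΩ.eq_zero_of_normX hn0 hS₁) (hΩ.exists_tendsto_normX hn0 hS₁) A b₁ b₂ hA.pos₁ hA.pos₂
    hA.symm hA.bounded hA.coercive divForm (fun u h k => divInt_add_right u.1 h.1 k.1)
    (fun u c h => divInt_smul_right c u.1 h.1) (fun u v h => divInt_sub_left u.1 v.1 h.1)
    (fun u => divInt_self_nonneg u.1) _ (mul_nonneg n.cast_nonneg n.cast_nonneg)
    (fun u h => abs_divInt_le u.1 h.1) (L3 lam e ψ₁ E ut)
    (fun u h k => stressInt_add hE hlam ha₁ hC0 hC1a hC4a ut u.1 h.1 k.1)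
    (fun u c h => stressInt_smul ut u.1 c h.1)
    (fun u => ⟨2 * (a₅ * (√lam)⁻¹ + a₂) * energyNorm (ut + u.1),
      mul_nonneg hs (energyNorm_nonneg _),
      fun h => abs_stressInt_le hlam ha₁ ha₂ ha₅ hC1a hC4a ut u.1 h.1⟩) _ _ hα hMpos
    (fun u v => le_stressInt_sub hE hlam ha₁ hC0 hC1a hC4a ut u.1 v.1)
    (fun u v h => abs_stressInt_sub_le hE hlam ha₁ ha₂ ha₄ ha₅ hC0 hC1a hC4a ut u.1 v.1 h.1)
    f hf r hr q₁ q₃ hq₁ hq₃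
  obtain ⟨⟨hq₁0, hle⟩, u, hsol, huniq, hiter⟩ := key
  exact ⟨u, hsol, huniq, fun t ht => ⟨rate_lt_one hq₁0 hle ht, hiter t ht⟩,
    one_sub_add_nonneg hq₁0 hle, argmin_rate_mem hq₁0 hle, rate_argmin hq₁0 hle,
    rate_argmin_le hq₁0 hle⟩
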